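/- **Setting.** Let $n\ge 1$, $s\in(0,1)$, $n\neq 2s$, $\gamma\in(0,1]$, let $\Omega\subset\mathbb R^n$ be a nonempty bounded open set of class $C^{1,1}$, and $\delta(x)=\operatorname{dist}(x,\partial\Omega)$. Let $\mathcal L$ be a non-negative operator in $L^2(\Omega)$ which has a symmetric positive (measurable) Green's function $\mathcal G_0$ (that is, $\mathcal L^{-1}=\mathbb G_0$ on $L^2(\Omega)$, where $\mathbb G_0(f)(x)=\int_\Omega\mathcal G_0(x,y)f(y)\,dy$) such that, for a constant $\kappa$ and all $x\ne y$ in $\Omega$, $$\kappa^{-1}P(x,y)\le \mathcal G_0(x,y)\le \kappa P(x,y),\qquad P(x,y)=\frac1{|x-y|^{n-2s}}\Big(\frac{\delta(x)^\gamma}{|x-y|^\gamma}\wedge1\Big)\Big(\frac{\delta(y)^\gamma}{|x-y|^\gamma}\wedge1\Big).\tag{K1}$$ Then $\mathcal L$ has eigenvalues $0<\lambda_1\le\lambda_2\le\dots\to\infty$ (with multiplicity) with eigenfunctions $\varphi_1,\varphi_2,\dots$ forming an orthonormal basis of $L^2(\Omega)$; let $\Sigma=\{\lambda_j\}$. Norms: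 $\|f\|_{L^1(\Omega;w)}=\int_\Omega|f|w$, $\|f\|_{wL^\infty(\Omega)}=\|f/w\|_{L^\infty(\Omega)}$, and $\mathbb H^2_{\mathcal L}(\Omega)=\{u\in L^2(\Omega):\|u\|^2_{\mathbb H^2_{\mathcal L}}=\sum_j\lambda_j^2\langle u,\varphi_j\rangle^2<\infty\}$. For $\lambda\in\mathbb R\setminus\Sigma$ put $I=\min\{j:\lambda_j\ge\lambda,\ \lambda_{j+1}>\lambda_j\}$ and $\bar\lambda=\lambda_{I+1}$, so that $\lambda<\lambda_I<\lambda_{I+1}=\bar\lambda$. Let $E=\operatorname{span}\{\varphi_1,\dots,\varphi_I\}$, let $E^\perp$ be its orthogonal complement in $L^2(\Omega)$, and $$\widetilde{E^\perp}=\Big\{f\in L^1(\Omega;\delta^\gamma):\int_\Omega f\varphi_j=0,\ j=1,\dots,I\Big\}=\overline{E^\perp}^{\,L^1(\Omega;\delta^\gamma)}.$$ Let $\mathbb G_\lambda(f)=\sum_j\frac{\langle f,\varphi_j\rangle}{\lambda_j-\lambda}\varphi_j$ for $f\in L^2(\Omega)$. For every $f\in L^1(\Omega;\delta^\gamma)$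 there is a unique $u\in L^1(\Omega;\delta^\gamma)$ with $\int_\Omega u\psi=\int_\Omega f\,\mathbb G_\lambda(\psi)$ for all $\psi\in\delta^\gamma L^\infty(\Omega)$, and $\mathbb G_\lambda(f):=u$ is a bounded linear extension of $\mathbb G_\lambda$ to $L^1(\Omega;\delta^\gamma)$. **Theorem (the solution operator $\mathbb G_\lambda$ on $E^\perp$).** For $\lambda\in\mathbb R\setminus\Sigma$, $\mathbb G_\lambda$ maps continuously $$\begin{aligned} L^1(\Omega;\mathbb G_0(\delta^\alpha))\cap\widetilde{E^\perp}&\to L^1(\Omega;\delta^\alpha)\cap\widetilde{E^\perp}, &&\alpha>-1-\gamma,\\ L^1(\Omega)\cap\widetilde{E^\perp}&\to L^p(\Omega)\cap\widetilde{E^\perp}, && p\in[1,\tfrac n{n-2s}),\\ L^2(\Omega)\cap E^\perp&\to\mathbb H^2_{\mathcal L}(\Omega)\cap E^\perp,\\ L^{p_0}(\Omega)\cap\widetilde{E^\perp}&\to L^{p_1}(\Omega)\cap\widetilde{E^\perp}, && p_0\in(1,\tfrac n{2s}),\ \tfrac1{p_1}=\tfrac1{p_0}-\tfrac{2s}n,\\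 L^q(\Omega)\cap E^\perp&\to L^\infty(\Omega)\cap E^\perp, && q\in(\tfrac n{2s},\infty),\\ \delta^\alpha L^\infty(\Omega)\cap E^\perp&\to\mathbb G_0(\delta^\alpha)L^\infty(\Omega)\cap E^\perp, &&\alpha>-1-\gamma. \end{aligned}$$ The operator norms are bounded uniformly as $\lambda$ approaches $\Sigma$: given $M\in\mathbb R$ and $g>0$, in each line there is a constant $C$ depending only on $n,s,\gamma,\Omega,\kappa$, on $M,g$ and, where they occur, on $\alpha,p,p_0,q$ (and not on $\operatorname{dist}(\lambda,\Sigma)$) that bounds the operator norm for all such $\mathcal L$ and all $\lambda\in\mathbb R\setminus\Sigma$ with $\bar\lambda\le M$, $\lambda_{I+1}-\lambda_I\ge g$ and $\lambda\ge -M$. For the map $L^2\cap E^\perp\to\mathbb H^2_{\mathcal L}\cap E^\perp$ the condition $\lambda\ge-M$ is not needed. -/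

import Mathlib

open MeasureTheory Set Filter Topology
open scoped ENNReal NNReal RealInnerProductSpace

noncomputable section

namespace NonlocalEig

/-- The Euclidean space `ℝⁿ`. -/
abbrev Space (n : ℕ) := EuclideanSpace ℝ (Fin n)

variable {n : ℕ}

/-- `Ω` is a nonempty bounded open set of class `C^{1,1}`: near each boundary point, for some unit
vector `ν`, the set `Ω` is the strict epigraph in direction `ν` of a function of the component of `x`
orthogonal to `ν` which is differentiable with Lipschitz derivative. -/
structure IsC11 (Ω : Set (Space n)) : Prop where
  isOpen : IsOpen Ω
  nonempty : Ω.Nonempty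
  bounded : Bornology.IsBounded Ω
  chart : ∀ z ∈ frontier Ω, ∃ r > (0 : ℝ), ∃ ν : Space n, ‖ν‖ = 1 ∧
    ∃ h : Space n → ℝ, Differentiable ℝ h ∧ (∃ K : ℝ≥0, LipschitzWith K (fderiv ℝ h)) ∧
      ∀ x ∈ Metric.ball z r, x ∈ Ω ↔ h (x - ⟪ν, x⟫ • ν) < ⟪ν, x⟫

/-- The distance to the boundary, `δ(x) = dist(x, ∂Ω)`. -/
def bdist (Ω : Set (Space n)) (x : Space n) : ℝ := Metric.infDist x (frontier Ω)

/-- Classes of measurable functions on `Ω` modulo equality almost everywhere. -/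
abbrev Fn (Ω : Set (Space n)) := Space n →ₘ[volume.restrict Ω] ℝ

/-- `L²(Ω)`. -/
abbrev L2 (Ω : Set (Space n)) := Lp ℝ 2 (volume.restrict Ω : Measure (Space n))

/-- The comparison function
`|x-y|^{-(n-2s)} (δ(x)^γ / |x-y|^γ ∧ 1) (δ(y)^γ / |x-y|^γ ∧ 1)`. -/
def profile (Ω : Set (Space n)) (s γ : ℝ) (x y : Space n) : ℝ :=
  dist x y ^ (-((n : ℝ) - 2 * s)) * min (bdist Ω x ^ γ / dist x y ^ γ) 1 *
    min (bdist Ω y ^ γ / dist x y ^ γ) 1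

/-- A non-negative operator `𝓛` in `L²(Ω)` that has a Green's function `𝒢₀` satisfying the
two-sided bounds (K1) with constant `κ`. The field `green` says that `𝓛⁻¹ = 𝔾₀`, i.e. for
`u, f ∈ L²(Ω)`: `u ∈ dom 𝓛` and `𝓛 u = f` if and only if `u(x) = ∫_Ω 𝒢₀(x,y) f(y) dy` a.e. -/
structure GreenOperator (Ω : Set (Space n)) (s γ κ : ℝ) where
  L : L2 Ω →ₗ.[ℝ] L2 Ω
  kernel : Space n → Space n → ℝ
  L_nonneg : ∀ u : L.domain, 0 ≤ ⟪L u, (u : L2 Ω)⟫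
  kernel_measurable : AEStronglyMeasurable (Function.uncurry kernel)
    ((volume.restrict Ω).prod (volume.restrict Ω))
  kernel_symm : ∀ x ∈ Ω, ∀ y ∈ Ω, x ≠ y → kernel x y = kernel y x
  kernel_pos : ∀ x ∈ Ω, ∀ y ∈ Ω, x ≠ y → 0 < kernel x y
  kernel_lower : ∀ x ∈ Ω, ∀ y ∈ Ω, x ≠ y → κ⁻¹ * profile Ω s γ x y ≤ kernel x y
  kernel_upper : ∀ x ∈ Ω, ∀ y ∈ Ω, x ≠ y → kernel x y ≤ κ * profile Ω s γ x y
  green : ∀ u f : L2 Ω, (u, f) ∈ L.graph ↔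
    ∀ᵐ x ∂(volume.restrict Ω), u x = ∫ y in Ω, kernel x y * f y

variable {Ω : Set (Space n)} {s γ κ : ℝ}

/-- Eigenvalues `λ₁ ≤ λ₂ ≤ …` of `𝓛`, repeated according to multiplicity, with an orthonormal basis
`φ₁, φ₂, …` of `L²(Ω)` of eigenfunctions. Indices are shifted: `val j` is `λ_{j+1}` and
`fn j` is `φ_{j+1}`. -/
structure Eigenbasis (A : GreenOperator Ω s γ κ) where
  val : ℕ → ℝ
  fn : HilbertBasis ℕ ℝ (L2 Ω)
  mono : Monotone val
  eigen : ∀ j, (fn j, val j • fn j) ∈ A.L.graph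

/-! ### Norms, with values in `[0, ∞]` -/

/-- The weight `δ^α`. -/
def powWeight (Ω : Set (Space n)) (α : ℝ) (x : Space n) : ℝ≥0∞ := ENNReal.ofReal (bdist Ω x ^ α)

/-- The weight `𝔾₀(δ^α)`. -/
def GreenOperator.weight (A : GreenOperator Ω s γ κ) (α : ℝ) (x : Space n) : ℝ≥0∞ :=
  ∫⁻ y in Ω, ENNReal.ofReal (A.kernel x y) * powWeight Ω α y

/-- The norm of `L¹(Ω; w)`. -/
def normL1 (w : Space n → ℝ≥0∞) (f : Fn Ω) : ℝ≥0∞ := ∫⁻ x in Ω, ‖f x‖ₑ * w x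

/-- The norm `‖f / w‖_{L^∞(Ω)}` of `w L^∞(Ω)`. -/
def normLinf (w : Space n → ℝ≥0∞) (f : Fn Ω) : ℝ≥0∞ :=
  essSup (fun x => ‖f x‖ₑ / w x) (volume.restrict Ω)

/-- The norm of `L^p(Ω)`. -/
def normLp (p : ℝ≥0∞) (f : Fn Ω) : ℝ≥0∞ := eLpNorm f p (volume.restrict Ω)

/-- The pairing `⟨f, g⟩ = ∫_Ω f g`. -/
def pair (f g : Fn Ω) : ℝ := ∫ x in Ω, f x * g x

namespace Eigenbasis

variable {A : GreenOperator Ω s γ κ} (B : Eigenbasis A)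

/-- The norm `(∑ⱼ λⱼ² ⟨u, φⱼ⟩²)^{1/2}` of `ℍ²_𝓛(Ω)`; a function `u ∈ L²(Ω)` belongs to this space if
and only if the norm is finite. -/
def normH2 (u : Fn Ω) : ℝ≥0∞ :=
  (∑' j, ENNReal.ofReal (B.val j ^ 2 * pair u (B.fn j : Fn Ω) ^ 2)) ^ (1 / 2 : ℝ)

/-- `I = min {j : λⱼ ≥ λ and λⱼ₊₁ > λⱼ}` (with the shift of indices explained above). -/
def index (lam : ℝ) : ℕ := sInf {j | lam ≤ B.val j ∧ B.val j < B.val (j + 1)}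

/-- `λ_I`. -/
def lamI (lam : ℝ) : ℝ := B.val (B.index lam)

/-- `λ̄ = λ_{I+1}`. -/
def lamBar (lam : ℝ) : ℝ := B.val (B.index lam + 1)

/-- `E^⊥ ⊆ L²(Ω)`, the orthogonal complement of `E = span {φ₁, …, φ_I}`. -/
def perp (lam : ℝ) : Set (Fn Ω) :=
  {f | ∃ g : L2 Ω, g ∈ (Submodule.span ℝ (B.fn '' Set.Iic (B.index lam)))ᗮ ∧ (g : Fn Ω) = f}

/-- `Ẽ^⊥ = {f ∈ L¹(Ω; δ^γ) : ∫_Ω f φⱼ = 0 for j = 1, …, I}`. -/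
def perpTilde (lam : ℝ) : Set (Fn Ω) :=
  {f | normL1 (powWeight Ω γ) f < ∞ ∧ ∀ j ≤ B.index lam, pair f (B.fn j : Fn Ω) = 0}

/-- The spectral definition `𝔾_λ(f) = ∑ⱼ ⟨f, φⱼ⟩ / (λⱼ - λ) φⱼ` for `f ∈ L²(Ω)`. -/
def spectralSol (lam : ℝ) (f : L2 Ω) : L2 Ω :=
  ∑' j, (⟪B.fn j, f⟫ / (B.val j - lam)) • (B.fn j : L2 Ω)

/-- `u ∈ L¹(Ω; δ^γ)` is a `𝔾_λ(δ^γ L^∞(Ω))`-weak solution of `𝓛u - λu = f`, `Bu = 0`: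
`∫_Ω u ψ = ∫_Ω f 𝔾_λ(ψ)` for all `ψ ∈ δ^γ L^∞(Ω)` (which is contained in `L²(Ω)`). -/
def IsWeakSol (lam : ℝ) (f u : Fn Ω) : Prop :=
  normL1 (powWeight Ω γ) u < ∞ ∧
    ∀ ψ : L2 Ω, normLinf (powWeight Ω γ) (ψ : Fn Ω) < ∞ →
      pair u (ψ : Fn Ω) = pair f (B.spectralSol lam ψ : Fn Ω)

open Classical in
/-- The solution operator `𝔾_λ`: the weak solution with datum `f` (and `0` if there is none). -/
def solOp (lam : ℝ) (f : Fn Ω) : Fn Ω :=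
  if h : ∃ u, B.IsWeakSol lam f u then h.choose else 0

/-- `𝔾_λ` is a well-defined bounded linear operator on `L¹(Ω; δ^γ)`, given by the unique weak
solution, and it extends the spectral definition on `L²(Ω)`. -/
structure WellDefined (lam : ℝ) : Prop where
  isWeakSol : ∀ f : Fn Ω, normL1 (powWeight Ω γ) f < ∞ → B.IsWeakSol lam f (B.solOp lam f)
  unique : ∀ f u : Fn Ω, normL1 (powWeight Ω γ) f < ∞ → B.IsWeakSol lam f u → u = B.solOp lam f
  linear : ∀ (c : ℝ) (f g : Fn Ω), normL1 (powWeight Ω γ) f < ∞ → normL1 (powWeight Ω γ) g < ∞ →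
    B.solOp lam (c • f + g) = c • B.solOp lam f + B.solOp lam g
  bounded : ∃ C : ℝ≥0, ∀ f : Fn Ω, normL1 (powWeight Ω γ) f < ∞ →
    normL1 (powWeight Ω γ) (B.solOp lam f) ≤ C * normL1 (powWeight Ω γ) f
  extends_spectral : ∀ f : L2 Ω, B.solOp lam (f : Fn Ω) = (B.spectralSol lam f : Fn Ω)

/-- `𝔾_λ` maps `{f ∈ S : NX f < ∞}` into `{u ∈ S' : NY u < ∞}` with operator norm at most `C`. -/
def Maps (lam : ℝ) (C : ℝ≥0) (NX : Fn Ω → ℝ≥0∞) (S : Set (Fn Ω)) (NY : Fn Ω → ℝ≥0∞)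
    (S' : Set (Fn Ω)) : Prop :=
  ∀ f ∈ S, NX f < ∞ → B.solOp lam f ∈ S' ∧ NY (B.solOp lam f) ≤ C * NX f

/-- `λ` is not an eigenvalue, `λ̄ ≤ M`, and the spectral gap `λ_{I+1} - λ_I` is at least `g`. -/
def Gap (M g lam : ℝ) : Prop :=
  lam ∉ Set.range B.val ∧ B.lamBar lam ≤ M ∧ g ≤ B.lamBar lam - B.lamI lam

end Eigenbasis

end NonlocalEig

end

/-! Write T for the Green operator 𝔾₀, R for the resolvent 𝔾_λ, and d = δ^γ. The heart of the matter
is a pointwise domination: if f annihilates φ₁, …, φ_I, then |R f| ≤ C·T|f| almost everywhere, with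
C independent of the distance from λ to the spectrum (`GreenOperator.Regular.enorm_solOp_le`). All
mapping properties but the one into ℍ² are then inherited from T. The weighted L¹ line is the
symmetry of the kernel and the weighted L^∞ line is monotonicity. The unweighted lines follow from T
being dominated by the Riesz potential of order 2s, through Young, Hölder and
Hardy–Littlewood–Sobolev. The ℍ² line is read off the spectral coefficients.

The domination rests on a Neumann expansion with its remainder kept, R f = Σ_{i<2m} λ^i T^{i+1} f +
λ^{2m} T^m R T^m f, and on three properties of T acting on non-negative functions, collected in
`RegKernel`: (1) T² F ≤ C·T F; (2) T^m F ≤ C·d·∫F d for some m = N + 1; (3) d·∫F d ≤ C·T F. By (1)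
each term of the sum is at most a constant times T|f|. By (2) T^m is bounded from L¹(d) to L² and
from L² to d·L^∞; between the two copies R has norm at most 1/g on E^⊥, because the remaining
eigenvalues lie at least g above λ. So the remainder is at most a constant times d·∫|f| d, which (3)
turns back into T|f|. Density of L² in L¹(d) extends both R and the bound
(`RegKernel.enorm_le_of_approx`).

For n > 2s, property (1) is the integrated 3G inequality. Property (2) combines two effects of
iteration: the singularity of the kernel on the diagonal disappears after finitely many
compositions, and T gains decay at the boundary up to the power γ. Property (3) holds because Ω is
bounded. They are checked for the comparison function and pass to every comparable kernel, so the
constants depend on κ only (`GreenOperator.exists_regular`). Property (2) also makes a power of T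
Hilbert–Schmidt, whence compactness and the eigenbasis.

For n < 2s no such operator exists: the kernel would vanish on the diagonal but not off it, which is
incompatible with 𝓛 ≥ 0 (`isEmpty_greenOperator`). -/

noncomputable section

namespace NonlocalEig

/-! ### Integral operators with a non-negative kernel -/

section KernelOp

variable {X : Type*} [MeasurableSpace X] {μ : Measure X}

/-- The integral operator with kernel `k`, acting on functions with values in `[0, ∞]`. -/
def kernelOp (μ : Measure X) (k : X → X → ℝ≥0) (F : X → ℝ≥0∞) (x : X) : ℝ≥0∞ :=
  ∫⁻ y, k x y * F y ∂μ

/-- Weighted Jensen inequality: `(∫ F G)^p ≤ (∫ F)^(p-1) ∫ F G^p`. -/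
theorem lintegral_mul_rpow_le {p : ℝ} (hp : 1 ≤ p) {F G : X → ℝ≥0∞} (hF : Measurable F)
    (hG : Measurable G) :
    (∫⁻ x, F x * G x ∂μ) ^ p ≤ (∫⁻ x, F x ∂μ) ^ (p - 1) * ∫⁻ x, F x * G x ^ p ∂μ := by
  rcases hp.eq_or_lt with rfl | hp
  · simp
  have hp0 : 0 < p := by linarith
  have hpq : p.HolderConjugate (p / (p - 1)) := Real.HolderConjugate.conjExponent hp
  by_cases hFt : ∃ᵐ x ∂μ, F x = ∞
  · have h1 : ∫⁻ x, F x ∂μ = ∞ := by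
      by_contra h
      exact hFt ((ae_lt_top hF h).mono fun x hx => hx.ne)
    by_cases h2 : ∫⁻ x, F x * G x ^ p ∂μ = 0
    · rw [lintegral_eq_zero_iff (by fun_prop)] at h2
      have h3 : ∫⁻ x, F x * G x ∂μ = 0 := by
        rw [lintegral_eq_zero_iff (by fun_prop)]
        filter_upwards [h2] with x hx
        simp only [Pi.zero_apply, mul_eq_zero, ENNReal.rpow_eq_zero_iff] at hx ⊢
        rcases hx with h | ⟨h, -⟩ | ⟨-, h⟩
        · exact Or.inl h
        · exact Or.inr h
        · linarith
      rw [h3, ENNReal.zero_rpow_of_pos hp0]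
      exact zero_le
    · rw [h1, ENNReal.top_rpow_of_pos (by linarith), ENNReal.top_mul h2]
      exact le_top
  have hfin : ∀ᵐ x ∂μ, F x ≠ ∞ := by simpa [not_frequently] using hFt
  -- Hölder with exponents p and p/(p-1) for the splitting F G = (F^(1/p) G) · F^(1-1/p).
  have key := ENNReal.lintegral_mul_le_Lp_mul_Lq μ hpq
    (f := fun x => F x ^ (1 / p) * G x) (g := fun x => F x ^ (1 - 1 / p))
    ((hF.pow_const _).mul hG).aemeasurable (hF.pow_const _).aemeasurable
  have e1 : ∫⁻ x, ((fun x => F x ^ (1 / p) * G x) * fun x => F x ^ (1 - 1 / p)) x ∂μ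
      = ∫⁻ x, F x * G x ∂μ := by
    refine lintegral_congr_ae ?_
    filter_upwards [hfin] with x hx
    simp only [Pi.mul_apply]
    rw [mul_right_comm, ← ENNReal.rpow_add_of_nonneg _ _ (by positivity)
      (by rw [sub_nonneg, div_le_one hp0]; exact hp.le)]
    simp
  have e2 : ∀ x, (F x ^ (1 / p) * G x) ^ p = F x * G x ^ p := by
    intro x
    rw [ENNReal.mul_rpow_of_nonneg _ _ hp0.le, ← ENNReal.rpow_mul, one_div_mul_cancel hp0.ne',
      ENNReal.rpow_one]
  have hp1 : p - 1 ≠ 0 := by linarith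
  have e3 : ∀ x, (F x ^ (1 - 1 / p)) ^ (p / (p - 1)) = F x := by
    intro x
    rw [← ENNReal.rpow_mul, show (1 - 1 / p) * (p / (p - 1)) = 1 by field_simp, ENNReal.rpow_one]
  rw [e1] at key
  simp only [e2, e3] at key
  calc (∫⁻ x, F x * G x ∂μ) ^ p
      ≤ ((∫⁻ x, F x * G x ^ p ∂μ) ^ (1 / p) * (∫⁻ x, F x ∂μ) ^ (1 / (p / (p - 1)))) ^ p :=
        ENNReal.rpow_le_rpow key hp0.le
    _ = (∫⁻ x, F x ∂μ) ^ (p - 1) * ∫⁻ x, F x * G x ^ p ∂μ := by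
        rw [ENNReal.mul_rpow_of_nonneg _ _ hp0.le, ← ENNReal.rpow_mul, ← ENNReal.rpow_mul,
          one_div_mul_cancel hp0.ne', ENNReal.rpow_one,
          show 1 / (p / (p - 1)) * p = p - 1 by field_simp, mul_comm]

variable {k : X → X → ℝ≥0}

theorem measurable_kernelOp [SFinite μ] (hk : Measurable (Function.uncurry k)) {F : X → ℝ≥0∞}
    (hF : Measurable F) : Measurable (kernelOp μ k F) :=
  Measurable.lintegral_prod_right' (f := fun q : X × X => (k q.1 q.2 : ℝ≥0∞) * F q.2)
    (hk.coe_nnreal_ennreal.mul (hF.comp measurable_snd))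

theorem measurable_kernelOp_iterate [SFinite μ] (hk : Measurable (Function.uncurry k))
    {F : X → ℝ≥0∞} (hF : Measurable F) (m : ℕ) : Measurable ((kernelOp μ k)^[m] F) := by
  induction m with
  | zero => exact hF
  | succ m ih => rw [Function.iterate_succ_apply']; exact measurable_kernelOp hk ih

theorem kernelOp_mono {F G : X → ℝ≥0∞} (h : F ≤ᵐ[μ] G) : kernelOp μ k F ≤ kernelOp μ k G :=
  fun x => lintegral_mono_ae (h.mono fun y hy => by gcongr)

theorem measurable_kernel_mul (hk : Measurable (Function.uncurry k)) {F : X → ℝ≥0∞}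
    (hF : Measurable F) (x : X) : Measurable fun y => (k x y : ℝ≥0∞) * F y :=
  (hk.of_uncurry_left).coe_nnreal_ennreal.mul hF

theorem kernelOp_const_mul (hk : Measurable (Function.uncurry k)) {F : X → ℝ≥0∞}
    (hF : Measurable F) (c : ℝ≥0∞) :
    kernelOp μ k (fun x => c * F x) = fun x => c * kernelOp μ k F x := by
  funext x
  unfold kernelOp
  rw [← lintegral_const_mul _ (measurable_kernel_mul hk hF x)]
  exact lintegral_congr fun y => by ring

theorem lintegral_kernelOp_mul [SFinite μ] (hk : Measurable (Function.uncurry k))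
    (hs : ∀ x y, k x y = k y x) {F G : X → ℝ≥0∞} (hF : Measurable F) (hG : Measurable G) :
    ∫⁻ x, kernelOp μ k F x * G x ∂μ = ∫⁻ x, F x * kernelOp μ k G x ∂μ := by
  have h1 : ∀ x, kernelOp μ k F x * G x = ∫⁻ y, k x y * F y * G x ∂μ := fun x =>
    (lintegral_mul_const _ (measurable_kernel_mul hk hF x)).symm
  have h2 : ∀ y, F y * kernelOp μ k G y = ∫⁻ x, k x y * F y * G x ∂μ := fun y => by
    unfold kernelOp
    rw [← lintegral_const_mul _ (measurable_kernel_mul hk hG y)]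
    exact lintegral_congr fun x => by rw [hs y x]; ring
  simp only [h1, h2]
  refine lintegral_lintegral_swap ?_
  exact ((hk.coe_nnreal_ennreal.mul (hF.comp measurable_snd)).mul
    (hG.comp measurable_fst)).aemeasurable

/-- A symmetric kernel `k` which is comparable with its square and some power of which is
comparable with `d(x) d(y)`, quantitatively in terms of `C`. -/
structure RegKernel (μ : Measure X) (k : X → X → ℝ≥0) (d : X → ℝ≥0) (N : ℕ) (C : ℝ≥0) : Prop where
  meas : Measurable (Function.uncurry k)
  symm : ∀ x y, k x y = k y x
  d_meas : Measurable d
  d_pos : ∀ᵐ x ∂μ, 0 < d x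
  d_le : ∀ᵐ x ∂μ, d x ≤ C
  measure_le : μ univ ≤ C
  one_le : 1 ≤ C
  comp_le : ∀ F : X → ℝ≥0∞, Measurable F →
    ∀ᵐ x ∂μ, kernelOp μ k (kernelOp μ k F) x ≤ C * kernelOp μ k F x
  iter_le : ∀ F : X → ℝ≥0∞, Measurable F →
    ∀ᵐ x ∂μ, (kernelOp μ k)^[N + 1] F x ≤ C * d x * ∫⁻ y, F y * d y ∂μ
  lower : ∀ F : X → ℝ≥0∞, Measurable F →
    ∀ᵐ x ∂μ, d x * ∫⁻ y, F y * d y ∂μ ≤ C * kernelOp μ k F x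
  one : ∀ᵐ x ∂μ, kernelOp μ k 1 x ≤ C

namespace RegKernel

variable {d : X → ℝ≥0} {N : ℕ} {C : ℝ≥0} (h : RegKernel μ k d N C)
include h

theorem isFiniteMeasure : IsFiniteMeasure μ := ⟨h.measure_le.trans_lt ENNReal.coe_lt_top⟩

theorem iterate_succ_le [SFinite μ] (m : ℕ) {F : X → ℝ≥0∞} (hF : Measurable F) :
    ∀ᵐ x ∂μ, (kernelOp μ k)^[m + 1] F x ≤ (C : ℝ≥0∞) ^ m * kernelOp μ k F x := by
  induction m with
  | zero => simp
  | succ m ih =>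
    have h2 := kernelOp_mono (k := k) ih
    rw [kernelOp_const_mul h.meas (measurable_kernelOp h.meas hF)] at h2
    filter_upwards [h.comp_le F hF] with x hx
    rw [Function.iterate_succ_apply']
    calc _ ≤ (C : ℝ≥0∞) ^ m * kernelOp μ k (kernelOp μ k F) x := h2 x
      _ ≤ (C : ℝ≥0∞) ^ m * (C * kernelOp μ k F x) := by gcongr
      _ = _ := by ring

theorem measurable_d : Measurable fun x => (d x : ℝ≥0∞) := h.d_meas.coe_nnreal_ennreal

theorem lintegral_d_sq_le : ∫⁻ x, (d x : ℝ≥0∞) * d x ∂μ ≤ (C : ℝ≥0∞) ^ 3 := by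
  calc ∫⁻ x, (d x : ℝ≥0∞) * d x ∂μ ≤ ∫⁻ _, (C : ℝ≥0∞) * C ∂μ := by
        refine lintegral_mono_ae (h.d_le.mono fun x hx => ?_)
        gcongr
    _ = C * C * μ univ := lintegral_const _
    _ ≤ C * C * C := by gcongr; exact h.measure_le
    _ = _ := by ring

theorem lintegral_d_sq_pos (hμ : μ ≠ 0) : 0 < ∫⁻ x, (d x : ℝ≥0∞) * d x ∂μ := by
  have hd := h.measurable_d
  rw [pos_iff_ne_zero, Ne, lintegral_eq_zero_iff (by fun_prop)]
  intro h0
  refine hμ (ae_eq_bot.mp (eventually_false_iff_eq_bot.mp ?_))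
  filter_upwards [h0, h.d_pos] with x hx hx'
  simp [hx'.ne'] at hx

/-- `𝔾(d) ≤ C' d`. -/
theorem exists_kernelOp_d_le [SFinite μ] (hμ : μ ≠ 0) :
    ∃ D : ℝ≥0, ∀ᵐ x ∂μ, kernelOp μ k (fun y => d y) x ≤ D * d x := by
  set J : ℝ≥0∞ := ∫⁻ x, (d x : ℝ≥0∞) * d x ∂μ with hJ
  have hJ0 := (h.lintegral_d_sq_pos hμ).ne'
  have hJt : J ≠ ∞ := ne_top_of_le_ne_top (by finiteness) h.lintegral_d_sq_le
  -- The lower bound on the kernel, applied to d itself, gives d ≤ (C/J)·T d. Applying T repeatedly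
  -- replaces T d by T^(N+1) d at the cost of (C/J)^N, and the smoothing bound returns a multiple of
  -- d.
  have hlow : ∀ᵐ x ∂μ, (d x : ℝ≥0∞) ≤ C / J * kernelOp μ k (fun y => d y) x := by
    filter_upwards [h.lower _ h.measurable_d] with x hx
    rw [← ENNReal.mul_div_right_comm, ENNReal.le_div_iff_mul_le (Or.inl hJ0) (Or.inl hJt)]
    exact hx
  have hm := fun m => measurable_kernelOp_iterate (μ := μ) h.meas h.measurable_d m
  have hiter : ∀ m : ℕ, ∀ᵐ x ∂μ, kernelOp μ k (fun y => d y) x ≤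
      (C / J) ^ m * (kernelOp μ k)^[m + 1] (fun y => d y) x := by
    intro m
    induction m with
    | zero => simp
    | succ m ih =>
      have h1 : ∀ j : ℕ, ∀ᵐ x ∂μ, (kernelOp μ k)^[j] (fun y => (d y : ℝ≥0∞)) x ≤
          C / J * (kernelOp μ k)^[j + 1] (fun y => d y) x := by
        intro j
        induction j with
        | zero => simpa using hlow
        | succ j ihj =>
          refine ae_of_all _ fun x => ?_
          have := kernelOp_mono (k := k) ihj x
          rw [kernelOp_const_mul h.meas (hm _)] at this
          simpa only [Function.iterate_succ_apply'] using this
      filter_upwards [ih, h1 (m + 1)] with x hx hx'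
      calc _ ≤ _ := hx
        _ ≤ (C / J) ^ m * (C / J * (kernelOp μ k)^[m + 1 + 1] (fun y => d y) x) := by gcongr
        _ = _ := by ring
  have hD : (C / J) ^ N * (C * J) ≠ ∞ := by
    have : (C : ℝ≥0∞) / J ≠ ∞ := ENNReal.div_ne_top ENNReal.coe_ne_top hJ0
    finiteness
  refine ⟨((C / J) ^ N * (C * J)).toNNReal, ?_⟩
  filter_upwards [hiter N, h.iter_le _ h.measurable_d] with x hx hx'
  rw [ENNReal.coe_toNNReal hD]
  calc _ ≤ _ := hx
    _ ≤ (C / J) ^ N * (C * d x * J) := by gcongr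
    _ = _ := by ring

end RegKernel

end KernelOp

end NonlocalEig
end

/-! ### The integral operator on L² -/

noncomputable section

namespace NonlocalEig

section KernelL2

variable {X : Type*} [MeasurableSpace X] {μ : Measure X}

theorem eLpNorm_two_sq {f : X → ℝ} : eLpNorm f 2 μ ^ (2 : ℝ) = ∫⁻ x, ‖f x‖ₑ ^ (2 : ℝ) ∂μ := by
  rw [eLpNorm_eq_lintegral_rpow_enorm_toReal (by norm_num) (by norm_num), ← ENNReal.rpow_mul]
  simp

theorem measurable_enorm_Lp (f : X →ₘ[μ] ℝ) : Measurable fun x => ‖f x‖ₑ := f.measurable.enorm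

namespace RegKernel

variable {k : X → X → ℝ≥0} {d : X → ℝ≥0} {N : ℕ} {C : ℝ≥0} (h : RegKernel μ k d N C)
include h

/-- Schur test: Jensen for the weight k(x, ·), whose mass is at most C, then symmetry of k and the
same mass bound in the other variable. -/
theorem lintegral_kernelOp_sq_le [SFinite μ] {F : X → ℝ≥0∞} (hF : Measurable F) :
    ∫⁻ x, kernelOp μ k F x ^ (2 : ℝ) ∂μ ≤ (C : ℝ≥0∞) ^ (2 : ℝ) * ∫⁻ x, F x ^ (2 : ℝ) ∂μ := by
  have hF2 : Measurable fun x => F x ^ (2 : ℝ) := hF.pow_const _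
  calc ∫⁻ x, kernelOp μ k F x ^ (2 : ℝ) ∂μ
      ≤ ∫⁻ x, C * kernelOp μ k (fun y => F y ^ (2 : ℝ)) x ∂μ := by
        refine lintegral_mono_ae (h.one.mono fun x hx => ?_)
        refine (lintegral_mul_rpow_le (by norm_num)
          (h.meas.of_uncurry_left).coe_nnreal_ennreal hF).trans ?_
        have : ∫⁻ y, (k x y : ℝ≥0∞) ∂μ ≤ C := by simpa [kernelOp] using hx
        rw [show (2 : ℝ) - 1 = 1 by norm_num, ENNReal.rpow_one]
        exact mul_le_mul_left this _
    _ = C * ∫⁻ x, F x ^ (2 : ℝ) * kernelOp μ k 1 x ∂μ := by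
        rw [lintegral_const_mul _ (measurable_kernelOp h.meas hF2),
          ← lintegral_kernelOp_mul h.meas h.symm hF2 measurable_one]
        simp
    _ ≤ C * ∫⁻ x, F x ^ (2 : ℝ) * C ∂μ := by
        gcongr 1
        exact lintegral_mono_ae (h.one.mono fun x hx => by gcongr)
    _ = _ := by
        rw [lintegral_mul_const _ hF2]
        simp only [ENNReal.rpow_ofNat]
        ring

theorem eLpNorm_integral_le [SFinite μ] (f : X →ₘ[μ] ℝ) :
    eLpNorm (fun x => ∫ y, k x y * f y ∂μ) 2 μ ≤ C * eLpNorm f 2 μ := by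
  rw [← ENNReal.rpow_le_rpow_iff (z := 2) (by norm_num), ENNReal.mul_rpow_of_nonneg _ _ (by norm_num),
    eLpNorm_two_sq, eLpNorm_two_sq]
  refine le_trans (lintegral_mono fun x => ?_) (h.lintegral_kernelOp_sq_le (measurable_enorm_Lp f))
  gcongr
  refine (enorm_integral_le_lintegral_enorm _).trans (le_of_eq ?_)
  simp [kernelOp, enorm_mul]

theorem aestronglyMeasurable_integral [SFinite μ] (f : X →ₘ[μ] ℝ) :
    AEStronglyMeasurable (fun x => ∫ y, k x y * f y ∂μ) μ := by
  have : StronglyMeasurable fun q : X × X => (k q.1 q.2 : ℝ) * f q.2 :=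
    (h.meas.coe_nnreal_real.mul (f.measurable.comp measurable_snd)).stronglyMeasurable
  exact this.integral_prod_right'.aestronglyMeasurable

theorem memLp_integral [SFinite μ] (f : Lp ℝ 2 μ) :
    MemLp (fun x => ∫ y, k x y * f y ∂μ) 2 μ :=
  ⟨h.aestronglyMeasurable_integral _,
    (h.eLpNorm_integral_le _).trans_lt (ENNReal.mul_lt_top ENNReal.coe_lt_top (Lp.eLpNorm_lt_top f))⟩

theorem kernelOp_lt_top [SFinite μ] (f : Lp ℝ 2 μ) :
    ∀ᵐ x ∂μ, kernelOp μ k (fun y => ‖f y‖ₑ) x < ∞ := by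
  have hm := measurable_kernelOp (μ := μ) h.meas (measurable_enorm_Lp (f : X →ₘ[μ] ℝ))
  have hfin : ∫⁻ x, kernelOp μ k (fun y => ‖f y‖ₑ) x ^ (2 : ℝ) ∂μ ≠ ∞ := by
    refine ne_top_of_le_ne_top ?_ (h.lintegral_kernelOp_sq_le (measurable_enorm_Lp (f : X →ₘ[μ] ℝ)))
    rw [← eLpNorm_two_sq]
    have := Lp.eLpNorm_ne_top f
    finiteness
  filter_upwards [ae_lt_top (hm.pow_const _) hfin] with x hx
  by_contra hc
  rw [not_lt_top_iff.mp hc] at hx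
  simp at hx

theorem integrable_kernel_mul [SFinite μ] (f : Lp ℝ 2 μ) :
    ∀ᵐ x ∂μ, Integrable (fun y => (k x y : ℝ) * f y) μ := by
  filter_upwards [h.kernelOp_lt_top f] with x hx
  refine ⟨?_, ?_⟩
  · exact ((h.meas.of_uncurry_left).coe_nnreal_real.mul
      (f : X →ₘ[μ] ℝ).measurable).aestronglyMeasurable
  · rw [hasFiniteIntegral_iff_enorm]
    simpa [kernelOp, enorm_mul] using hx

/-- The integral operator with kernel `k` on `L²`. -/
def opL2 [SFinite μ] : Lp ℝ 2 μ →L[ℝ] Lp ℝ 2 μ :=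
  LinearMap.mkContinuous
    { toFun := fun f => (h.memLp_integral f).toLp _
      map_add' := fun f g => by
        rw [← MemLp.toLp_add]
        refine MemLp.toLp_congr _ _ ?_
        filter_upwards [h.integrable_kernel_mul f, h.integrable_kernel_mul g] with x hf hg
        simp only [Pi.add_apply]
        rw [← integral_add hf hg]
        refine integral_congr_ae ?_
        filter_upwards [Lp.coeFn_add f g] with y hy
        rw [hy, Pi.add_apply, mul_add]
      map_smul' := fun c f => by
        rw [RingHom.id_apply, ← MemLp.toLp_const_smul]
        refine MemLp.toLp_congr _ _ (ae_of_all _ fun x => ?_)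
        simp only [Pi.smul_apply, smul_eq_mul]
        rw [← integral_const_mul]
        refine integral_congr_ae ?_
        filter_upwards [Lp.coeFn_smul c f] with y hy
        rw [hy, Pi.smul_apply, smul_eq_mul]
        ring } C fun f => by
    change ‖(h.memLp_integral f).toLp _‖ ≤ _
    rw [Lp.norm_toLp, Lp.norm_def, ← ENNReal.coe_toReal C, ← ENNReal.toReal_mul]
    exact ENNReal.toReal_mono (ENNReal.mul_ne_top ENNReal.coe_ne_top (Lp.eLpNorm_ne_top f))
      (h.eLpNorm_integral_le _)

theorem opL2_coe [SFinite μ] (f : Lp ℝ 2 μ) :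
    h.opL2 f =ᵐ[μ] fun x => ∫ y, k x y * f y ∂μ := (h.memLp_integral f).coeFn_toLp

theorem enorm_opL2_le [SFinite μ] (f : Lp ℝ 2 μ) :
    ∀ᵐ x ∂μ, ‖h.opL2 f x‖ₑ ≤ kernelOp μ k (fun y => ‖f y‖ₑ) x := by
  filter_upwards [h.opL2_coe f] with x hx
  rw [hx]
  refine (enorm_integral_le_lintegral_enorm _).trans (le_of_eq ?_)
  simp [kernelOp, enorm_mul]

theorem enorm_opL2_pow_le [SFinite μ] (m : ℕ) (f : Lp ℝ 2 μ) :
    ∀ᵐ x ∂μ, ‖(h.opL2 ^ m) f x‖ₑ ≤ (kernelOp μ k)^[m] (fun y => ‖f y‖ₑ) x := by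
  induction m with
  | zero => simp
  | succ m ih =>
    rw [pow_succ', Function.iterate_succ']
    filter_upwards [h.enorm_opL2_le ((h.opL2 ^ m) f)] with x hx
    exact hx.trans (kernelOp_mono ih x)

/-- Fubini and the symmetry of k; the double integral converges absolutely because T|f| and |g| are
both square integrable. -/
theorem inner_opL2 [SFinite μ] (f g : Lp ℝ 2 μ) : ⟪h.opL2 f, g⟫ = ⟪f, h.opL2 g⟫ := by
  have e : ∀ f g : Lp ℝ 2 μ, ⟪h.opL2 f, g⟫ = ∫ x, ∫ y, k x y * f y * g x ∂μ ∂μ := by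
    intro f g
    rw [L2.inner_def]
    refine integral_congr_ae ?_
    filter_upwards [h.opL2_coe f] with x hx
    rw [hx, integral_mul_const]
    simp [mul_comm]
  rw [real_inner_comm _ f, e, e, integral_integral_swap]
  · refine integral_congr_ae (ae_of_all _ fun x => integral_congr_ae (ae_of_all _ fun y => ?_))
    simp only [h.symm x y]
    ring
  · have hmf := (f : X →ₘ[μ] ℝ).measurable
    have hmg := (g : X →ₘ[μ] ℝ).measurable
    refine ⟨((h.meas.coe_nnreal_real.mul (hmf.comp measurable_snd)).mul
      (hmg.comp measurable_fst)).aestronglyMeasurable, ?_⟩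
    rw [hasFiniteIntegral_iff_enorm, lintegral_prod]
    swap
    · exact ((h.meas.coe_nnreal_real.mul (hmf.comp measurable_snd)).mul
        (hmg.comp measurable_fst)).enorm.aemeasurable
    have e2 : ∀ x, ∫⁻ y, ‖Function.uncurry (fun x y => (k x y : ℝ) * f y * g x) (x, y)‖ₑ ∂μ =
        kernelOp μ k (fun y => ‖f y‖ₑ) x * ‖g x‖ₑ := by
      intro x
      simp only [Function.uncurry_apply_pair, enorm_mul]
      rw [lintegral_mul_const _ ?_]
      · simp [kernelOp]
      · exact (h.meas.of_uncurry_left).coe_nnreal_real.enorm.mul hmf.enorm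
    simp only [e2]
    refine lt_of_le_of_lt (ENNReal.lintegral_mul_le_Lp_mul_Lq μ Real.HolderConjugate.two_two
      (measurable_kernelOp h.meas hmf.enorm).aemeasurable hmg.enorm.aemeasurable) ?_
    refine ENNReal.mul_lt_top (ENNReal.rpow_lt_top_of_nonneg (by norm_num) ?_)
      (ENNReal.rpow_lt_top_of_nonneg (by norm_num) ?_)
    · refine ne_top_of_le_ne_top ?_ (h.lintegral_kernelOp_sq_le hmf.enorm)
      rw [← eLpNorm_two_sq]
      have := Lp.eLpNorm_ne_top f
      finiteness
    · rw [← eLpNorm_two_sq]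
      have := Lp.eLpNorm_ne_top g
      finiteness

end RegKernel

end KernelL2

end NonlocalEig
end

noncomputable section

namespace NonlocalEig

/-! ### Compact self-adjoint operators and their eigenbases -/

section Compact

variable {H : Type} [NormedAddCommGroup H] [InnerProductSpace ℝ H] [CompleteSpace H]

omit [CompleteSpace H] in
theorem isCompactOperator_sum_smulRight {ι : Type*} (s : Finset ι) (u v : ι → H) :
    IsCompactOperator (∑ i ∈ s, (innerSL ℝ (u i)).smulRight (v i) : H →L[ℝ] H) := by
  have h1 : ∀ i, (innerSL ℝ (u i)).smulRight (v i) ∈ compactOperator (RingHom.id ℝ) H H := by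
    intro i
    have h2 : IsCompactOperator (ContinuousLinearMap.toSpanSingleton ℝ (v i)) :=
      isCompactOperator_of_locallyCompactSpace_rng (ContinuousLinearMap.toSpanSingleton ℝ (v i))
    exact h2.comp_clm (innerSL ℝ (u i))
  exact (compactOperator (RingHom.id ℝ) H H).sum_mem fun i _ => h1 i

/-- Hilbert–Schmidt operators are compact. -/
theorem isCompactOperator_of_sum_sq_le {ι : Type*} (b : HilbertBasis ι ℝ H) (S : H →L[ℝ] H)
    (K : ℝ) (hK : ∀ s : Finset ι, ∑ i ∈ s, ‖S (b i)‖ ^ 2 ≤ K) : IsCompactOperator S := by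
  classical
  have hsum : Summable fun i => ‖S (b i)‖ ^ 2 :=
    summable_of_sum_le (fun i => by positivity) hK
  -- The approximants are S composed with the projections onto finitely many basis vectors. By
  -- Cauchy–Schwarz and Bessel the error is at most the square root of a tail of Σ ‖S bᵢ‖².
  refine isCompactOperator_of_tendsto (l := (atTop : Filter (Finset ι)))
    (F := fun s => ∑ i ∈ s, (innerSL ℝ (b i)).smulRight (S (b i))) ?_
    (Eventually.of_forall fun s => isCompactOperator_sum_smulRight s _ _)
  rw [Metric.tendsto_atTop]
  intro ε hε
  obtain ⟨s₀, hs₀⟩ := summable_iff_vanishing_norm.mp hsum ((ε / 2) ^ 2) (by positivity)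
  refine ⟨s₀, fun s hs => ?_⟩
  rw [dist_eq_norm']
  refine lt_of_le_of_lt (ContinuousLinearMap.opNorm_le_bound _ (by positivity) fun x => ?_)
    (half_lt_self hε)
  have hx : HasSum (fun i => ⟪b i, x⟫ • S (b i)) (S x) := by
    have := (b.hasSum_repr x).mapL S
    simpa [b.repr_apply_apply] using this
  have hlim : Tendsto (fun t : Finset ι => ‖∑ i ∈ t, ⟪b i, x⟫ • S (b i)
      - ∑ i ∈ s, ⟪b i, x⟫ • S (b i)‖) atTop (𝓝 ‖S x - ∑ i ∈ s, ⟪b i, x⟫ • S (b i)‖) :=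
    (Tendsto.sub_const hx _).norm
  have hval : (S - ∑ i ∈ s, (innerSL ℝ (b i)).smulRight (S (b i))) x =
      S x - ∑ i ∈ s, ⟪b i, x⟫ • S (b i) := by
    simp
  rw [hval]
  refine le_of_tendsto hlim ?_
  filter_upwards [eventually_ge_atTop s] with t ht
  rw [← Finset.sum_sdiff ht, add_sub_cancel_right]
  have hd : Disjoint (t \ s) s₀ :=
    Finset.disjoint_of_subset_right hs Finset.sdiff_disjoint
  have h1 := hs₀ _ hd
  rw [Real.norm_of_nonneg (Finset.sum_nonneg fun i _ => by positivity)] at h1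
  have h2 : ∑ i ∈ t \ s, ‖⟪b i, x⟫‖ ^ 2 ≤ ‖x‖ ^ 2 := b.orthonormal.sum_inner_products_le x
  calc ‖∑ i ∈ t \ s, ⟪b i, x⟫ • S (b i)‖ ≤ ∑ i ∈ t \ s, ‖⟪b i, x⟫‖ * ‖S (b i)‖ :=
        (norm_sum_le _ _).trans (Finset.sum_le_sum fun i _ => (norm_smul _ _).le)
    _ ≤ √(∑ i ∈ t \ s, ‖⟪b i, x⟫‖ ^ 2) * √(∑ i ∈ t \ s, ‖S (b i)‖ ^ 2) :=
        Real.sum_mul_le_sqrt_mul_sqrt _ _ _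
    _ ≤ √(‖x‖ ^ 2) * √((ε / 2) ^ 2) := by gcongr
    _ = ε / 2 * ‖x‖ := by
        rw [Real.sqrt_sq (norm_nonneg _), Real.sqrt_sq (by positivity), mul_comm]

/-- A symmetric operator with compact square is compact. -/
theorem isCompactOperator_of_sq {T : H →L[ℝ] H} (hT : ∀ x y, ⟪T x, y⟫ = ⟪x, T y⟫)
    (h2 : IsCompactOperator (T * T : H →L[ℝ] H)) : IsCompactOperator T := by
  have hc := (isCompactOperator_iff_isCompact_closure_image_closedBall
    ((T * T : H →L[ℝ] H) : H →ₗ[ℝ] H) one_pos).mp h2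
  refine (isCompactOperator_iff_isCompact_closure_image_closedBall
    (T : H →ₗ[ℝ] H) one_pos).mpr ?_
  -- Since ‖T z‖² = ⟨T² z, z⟩ and differences of points of the unit ball have norm at most 2, an
  -- ε²/2-net for the image under T² provides an ε-net for the image under T.
  have htb : TotallyBounded ((T : H →ₗ[ℝ] H) '' Metric.closedBall 0 1) := by
    have htb2 := hc.totallyBounded.subset subset_closure
    rw [Metric.totallyBounded_iff]
    intro ε hε
    obtain ⟨t, ht, htf, hcov⟩ :=
      Metric.finite_approx_of_totallyBounded htb2 (ε ^ 2 / 2) (by positivity)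
    have ht' : ∀ y ∈ t, ∃ x ∈ Metric.closedBall (0 : H) 1, T (T x) = y := fun y hy => ht hy
    choose! g hg1 hg2 using ht'
    refine ⟨(fun y => T (g y)) '' t, htf.image _, ?_⟩
    rintro _ ⟨x, hx, rfl⟩
    have hx2 := hcov ⟨x, hx, rfl⟩
    simp only [mem_iUnion, exists_prop] at hx2 ⊢
    obtain ⟨y, hyt, hy⟩ := hx2
    refine ⟨T (g y), ⟨y, hyt, rfl⟩, ?_⟩
    have hgy := hg1 y hyt
    have e1 : ‖T (T (x - g y))‖ < ε ^ 2 / 2 := by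
      rw [Metric.mem_ball, dist_eq_norm, ← hg2 y hyt] at hy
      rw [map_sub, map_sub]
      exact hy
    have e2 : ‖x - g y‖ ≤ 2 := by
      rw [mem_closedBall_zero_iff] at hx hgy
      linarith [norm_sub_le x (g y)]
    have e3 : ‖T (x - g y)‖ ^ 2 < ε ^ 2 := by
      rw [← real_inner_self_eq_norm_sq, hT, real_inner_comm]
      calc ⟪T (T (x - g y)), x - g y⟫ ≤ ‖T (T (x - g y))‖ * ‖x - g y‖ := real_inner_le_norm _ _
        _ ≤ ‖T (T (x - g y))‖ * 2 := by gcongr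
        _ < ε ^ 2 := by linarith
    rw [Metric.mem_ball, dist_eq_norm]
    change ‖T x - T (g y)‖ < ε
    rw [← map_sub]
    exact lt_of_pow_lt_pow_left₀ 2 hε.le e3
  exact htb.closure.isCompact_of_isClosed isClosed_closure

/-- All powers of T are symmetric, so the square-root step can be repeated m times. -/
theorem isCompactOperator_of_pow_two_pow {T : H →L[ℝ] H} (hT : ∀ x y, ⟪T x, y⟫ = ⟪x, T y⟫) (m : ℕ)
    (hm : IsCompactOperator (T ^ 2 ^ m : H →L[ℝ] H)) : IsCompactOperator T := by
  have hpow : ∀ (j : ℕ) (x y : H), ⟪(T ^ j) x, y⟫ = ⟪x, (T ^ j) y⟫ := by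
    intro j
    induction j with
    | zero => intro x y; rfl
    | succ j ih =>
      intro x y
      rw [pow_succ, mul_apply_eq_comp, ih, hT, ← mul_apply_eq_comp, ← pow_succ', pow_succ]
  induction m with
  | zero => simpa using hm
  | succ m ih =>
    refine ih (isCompactOperator_of_sq (hpow _) ?_)
    rwa [← pow_add, ← two_mul, ← pow_succ']

/-- Order the index set by f, breaking ties by an injection into ℕ. Finite sublevel sets make this
order locally finite with a least and no greatest element, hence isomorphic to ℕ. -/
theorem exists_monotone_equiv {ι : Type*} [Infinite ι] [Countable ι] (f : ι → ℝ)
    (hf : ∀ c, {i | f i ≤ c}.Finite) : ∃ e : ℕ ≃ ι, Monotone (f ∘ e) := by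
  obtain ⟨g, hg⟩ := exists_injective_nat ι
  let F : ι → ℝ ×ₗ ℕ := fun i => toLex (f i, g i)
  have hF : Function.Injective F := fun i j hij => hg (congrArg (fun q => (ofLex q).2) hij)
  let : LinearOrder ι := LinearOrder.lift' F hF
  have hle : ∀ {i j : ι}, i ≤ j → f i ≤ f j := by
    intro i j hij
    have : F i ≤ F j := hij
    rw [Prod.Lex.toLex_le_toLex] at this
    rcases this with h | h
    · exact h.le
    · exact h.1.le
  let : LocallyFiniteOrder ι := LocallyFiniteOrder.ofFiniteIcc fun a b =>
    (hf (f b)).subset fun i hi => hle hi.2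
  have : NoMaxOrder ι := ⟨fun a => by
    by_contra hc
    push Not at hc
    exact infinite_univ ((hf (f a)).subset fun i _ => hle (hc i))⟩
  obtain ⟨i₀⟩ : Nonempty ι := inferInstance
  have hfin : {i | i ≤ i₀}.Finite := (hf (f i₀)).subset fun i hi => hle hi
  obtain ⟨m, hm, hmin⟩ := hfin.exists_minimal ⟨i₀, le_refl i₀⟩
  have hbot : ∀ i, m ≤ i := by
    intro i
    rcases le_total i i₀ with h | h
    · rcases le_total m i with h' | h'
      · exact h'
      · exact hmin h h'
    · exact le_trans hm h
  let : OrderBot ι := { bot := m, bot_le := hbot }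
  let : SuccOrder ι := LinearLocallyFiniteOrder.succOrder ι
  let : PredOrder ι := LinearLocallyFiniteOrder.predOrder ι
  let e : ι ≃o ℕ := orderIsoNatOfLinearSuccPredArch
  exact ⟨e.symm.toEquiv, fun a b hab => hle (e.symm.monotone hab)⟩

omit [CompleteSpace H] in
/-- An operator some power of which has bounded Hilbert–Schmidt norm has only finitely many
orthonormal eigenvectors with eigenvalue bounded from below. -/
theorem finite_setOf_eigenvalue_le {T : H →L[ℝ] H} {m : ℕ} {K : ℝ} {ι : Type} {v : ι → H}
    (hv : Orthonormal ℝ v) (hHS : ∀ s : Finset ι, ∑ i ∈ s, ‖(T ^ m) (v i)‖ ^ 2 ≤ K) {val : ι → ℝ}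
    (hpos : ∀ i, 0 < val i) (heig : ∀ i, T (v i) = (val i)⁻¹ • v i) (c : ℝ) :
    {i | val i ≤ c}.Finite := by
  have hpow : ∀ (i : ι) (j : ℕ), (T ^ j) (v i) = (val i)⁻¹ ^ j • v i := by
    intro i j
    induction j with
    | zero => simp
    | succ j ih => rw [pow_succ', mul_apply_eq_comp, ih, map_smul, heig, smul_smul, ← pow_succ]
  by_contra hinf
  obtain ⟨i₀, hi₀⟩ := Set.Infinite.nonempty hinf
  have hc : 0 < c := (hpos i₀).trans_le hi₀
  -- An eigenvector with `val i ≤ c` contributes at least c^(-2m) to the Hilbert–Schmidt sum, so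
  -- there are at most K·c^(2m) of them.
  obtain ⟨n, hn⟩ := exists_nat_gt (K * (c ^ m) ^ 2)
  obtain ⟨s, hs, hcard⟩ := Set.Infinite.exists_subset_card_eq hinf n
  have h1 : ∑ i ∈ s, ((c ^ m)⁻¹) ^ 2 ≤ K := by
    refine le_trans (Finset.sum_le_sum fun i hi => ?_) (hHS s)
    rw [hpow, norm_smul, hv.1, mul_one, Real.norm_of_nonneg (by have := hpos i; positivity), ← inv_pow]
    have : val i ≤ c := hs hi
    have := hpos i
    gcongr
  rw [Finset.sum_const, hcard, nsmul_eq_mul, inv_pow, ← div_eq_mul_inv,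
    div_le_iff₀ (by positivity)] at h1
  linarith

/-- The spectral theorem for compact symmetric operators, with orthonormal bases of the eigenspaces
put together. `val` lists the reciprocals of the eigenvalues of T, that is, the eigenvalues of its
inverse; the Hilbert–Schmidt bound leaves finitely many below each level, so they can be listed in
increasing order. -/
theorem exists_eigenbasis (hinf : ¬ FiniteDimensional ℝ H) {T : H →L[ℝ] H}
    (hc : IsCompactOperator T) (hT : ∀ x y, ⟪T x, y⟫ = ⟪x, T y⟫) (hpos : ∀ x, 0 ≤ ⟪T x, x⟫)
    (hinj : ∀ x, T x = 0 → x = 0) (m : ℕ) (K : ℝ)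
    (hHS : ∀ {ι : Type} {v : ι → H}, Orthonormal ℝ v → ∀ s : Finset ι,
      ∑ i ∈ s, ‖(T ^ m) (v i)‖ ^ 2 ≤ K) :
    ∃ (b : HilbertBasis ℕ ℝ H) (val : ℕ → ℝ), Monotone val ∧ (∀ j, 0 < val j) ∧
      ∀ j, T (b j) = (val j)⁻¹ • b j := by
  have hsym : (T : H →ₗ[ℝ] H).IsSymmetric := hT
  let V : ℝ → Submodule ℝ H := fun μ => Module.End.eigenspace (T : H →ₗ[ℝ] H) μ
  have hV : ∀ {μ : ℝ} {x : H}, x ∈ V μ → T x = μ • x := fun hx => Module.End.mem_eigenspace_iff.mp hx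
  have hfd : ∀ μ, FiniteDimensional ℝ (V μ) := by
    intro μ
    by_cases hμ : μ = 0
    · have : V μ = ⊥ := by
        rw [eq_bot_iff]
        intro x hx
        have := hV hx
        rw [hμ, zero_smul] at this
        exact hinj x this
      rw [this]
      infer_instance
    · exact ContinuousLinearMap.finite_dimensional_eigenspace hc μ hμ
  let ι := Σ μ : ℝ, Fin (Module.finrank ℝ (V μ))
  let v : ι → H := fun i => (stdOrthonormalBasis ℝ (V i.1) i.2 : V i.1)
  have hv : Orthonormal ℝ v :=
    (hsym.orthogonalFamily_eigenspaces).orthonormal_sigma_orthonormal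
      (v_family := fun μ => stdOrthonormalBasis ℝ (V μ))
      fun μ => (stdOrthonormalBasis ℝ (V μ)).orthonormal
  have hTv : ∀ i : ι, T (v i) = i.1 • v i := fun i => hV (stdOrthonormalBasis ℝ (V i.1) i.2).2
  have hpos' : ∀ i : ι, 0 < i.1 := by
    intro i
    have h1 := hpos (v i)
    rw [hTv, real_inner_smul_left, real_inner_self_eq_norm_sq, hv.1] at h1
    refine lt_of_le_of_ne (by simpa using h1) fun h0 => ?_
    have h2 := hinj (v i) (by rw [hTv, ← h0, zero_smul])
    have h3 := hv.1 i
    rw [h2, norm_zero] at h3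
    exact zero_ne_one h3
  have hspan : (Submodule.span ℝ (Set.range v))ᗮ = ⊥ := by
    rw [eq_bot_iff, ← ContinuousLinearMap.orthogonalComplement_iSup_eigenspaces_eq_bot hc hsym]
    refine Submodule.orthogonal_le (iSup_le fun μ x hx => ?_)
    have h1 := (stdOrthonormalBasis ℝ (V μ)).sum_repr ⟨x, hx⟩
    have h2 : x = ∑ i, (stdOrthonormalBasis ℝ (V μ)).repr ⟨x, hx⟩ i • v ⟨μ, i⟩ := by
      have := congrArg (Subtype.val) h1
      simpa [v] using this.symm
    rw [h2]
    exact Submodule.sum_mem _ fun i _ => Submodule.smul_mem _ _ (Submodule.subset_span ⟨_, rfl⟩)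
  have hfin : ∀ c, {i : ι | i.1⁻¹ ≤ c}.Finite := fun c =>
    finite_setOf_eigenvalue_le (m := m) hv (hHS hv) (val := fun i => i.1⁻¹)
      (fun i => inv_pos.mpr (hpos' i)) (fun i => by rw [hTv, inv_inv]) c
  have : Infinite ι := by
    by_contra hfi
    rw [not_infinite_iff_finite] at hfi
    have := Fintype.ofFinite ι
    exact hinf (((HilbertBasis.mkOfOrthogonalEqBot hv hspan).toOrthonormalBasis).toBasis.finiteDimensional_of_finite)
  have : Countable ι := by
    have : (⋃ n : ℕ, {i : ι | i.1⁻¹ ≤ n}) = univ :=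
      eq_univ_of_forall fun i => mem_iUnion.mpr (exists_nat_ge i.1⁻¹)
    rw [← countable_univ_iff, ← this]
    exact countable_iUnion fun n => (hfin n).countable
  obtain ⟨e, he⟩ := exists_monotone_equiv (fun i : ι => i.1⁻¹) hfin
  have hve : Orthonormal ℝ (v ∘ e) := hv.comp e e.injective
  have hspan' : (Submodule.span ℝ (Set.range (v ∘ e)))ᗮ = ⊥ := by
    rwa [e.surjective.range_comp]
  refine ⟨HilbertBasis.mkOfOrthogonalEqBot hve hspan', _, he,
    fun j => inv_pos.mpr (hpos' (e j)), fun j => ?_⟩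
  rw [HilbertBasis.coe_mkOfOrthogonalEqBot]
  simp [hTv]

end Compact

end NonlocalEig
end

/-! ### Hilbert–Schmidt bounds and compactness -/

noncomputable section

namespace NonlocalEig

namespace RegKernel

variable {X : Type} [MeasurableSpace X] {μ : Measure X} [SFinite μ]
variable {k : X → X → ℝ≥0} {d : X → ℝ≥0} {N : ℕ} {C : ℝ≥0} (h : RegKernel μ k d N C)
include h

omit [SFinite μ] in
theorem lintegral_enorm_mul_d_le (f : Lp ℝ 2 μ) :
    ∫⁻ x, ‖f x‖ₑ * d x ∂μ ≤ (C : ℝ≥0∞) ^ 2 * ‖f‖ₑ := by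
  have h1 := ENNReal.lintegral_mul_le_Lp_mul_Lq μ Real.HolderConjugate.two_two
    (measurable_enorm_Lp (f : X →ₘ[μ] ℝ)).aemeasurable h.measurable_d.aemeasurable
  rw [← eLpNorm_two_sq, ← ENNReal.rpow_mul, ← Lp.enorm_def] at h1
  refine h1.trans ?_
  rw [mul_one_div_cancel two_ne_zero, ENNReal.rpow_one, mul_comm]
  gcongr
  calc (∫⁻ x, (d x : ℝ≥0∞) ^ (2 : ℝ) ∂μ) ^ (1 / 2 : ℝ) ≤ ((C : ℝ≥0∞) ^ 4) ^ (1 / 2 : ℝ) := by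
        gcongr
        refine le_trans (le_of_eq ?_) (h.lintegral_d_sq_le.trans ?_)
        · simp [pow_two]
        · exact pow_le_pow_right₀ (by exact_mod_cast h.one_le) (by norm_num)
    _ = (C : ℝ≥0∞) ^ 2 := by
        rw [← ENNReal.rpow_natCast, ← ENNReal.rpow_mul, ← ENNReal.rpow_natCast]
        norm_num

theorem enorm_opL2_pow_succ_le (f : Lp ℝ 2 μ) :
    ∀ᵐ x ∂μ, ‖(h.opL2 ^ (N + 1)) f x‖ₑ ≤ C * d x * ∫⁻ y, ‖f y‖ₑ * d y ∂μ := by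
  filter_upwards [h.enorm_opL2_pow_le (N + 1) f,
    h.iter_le _ (measurable_enorm_Lp (f : X →ₘ[μ] ℝ))] with x hx hx'
  exact hx.trans hx'

/-- Smoothing from L² to d·L^∞, by Cauchy–Schwarz for ∫|f| d. This is the factor to the left of the
resolvent in the remainder term. -/
theorem enorm_opL2_pow_succ_le_norm (f : Lp ℝ 2 μ) :
    ∀ᵐ x ∂μ, ‖(h.opL2 ^ (N + 1)) f x‖ₑ ≤ (C : ℝ≥0∞) ^ 3 * d x * ‖f‖ₑ := by
  filter_upwards [h.enorm_opL2_pow_succ_le f] with x hx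
  calc _ ≤ _ := hx
    _ ≤ C * d x * ((C : ℝ≥0∞) ^ 2 * ‖f‖ₑ) := by gcongr; exact h.lintegral_enorm_mul_d_le f
    _ = _ := by ring

/-- Smoothing from L¹(d) to L², since d and the total mass are at most C. This is the factor to the
right of the resolvent in the remainder term. -/
theorem enorm_opL2_pow_succ_norm_le (f : Lp ℝ 2 μ) :
    ‖(h.opL2 ^ (N + 1)) f‖ₑ ≤ (C : ℝ≥0∞) ^ 3 * ∫⁻ y, ‖f y‖ₑ * d y ∂μ := by
  set J := ∫⁻ y, ‖f y‖ₑ * d y ∂μ with hJ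
  rw [Lp.enorm_def, ← ENNReal.rpow_le_rpow_iff (z := 2) (by norm_num), eLpNorm_two_sq]
  have hC1 : (1 : ℝ≥0∞) ≤ C := by exact_mod_cast h.one_le
  calc ∫⁻ x, ‖(h.opL2 ^ (N + 1)) f x‖ₑ ^ (2 : ℝ) ∂μ
      ≤ ∫⁻ _, (C * C * J) ^ (2 : ℝ) ∂μ := by
        refine lintegral_mono_ae ?_
        filter_upwards [h.enorm_opL2_pow_succ_le f, h.d_le] with x hx hd
        gcongr
        refine hx.trans ?_
        gcongr
    _ = (C * C * J) ^ (2 : ℝ) * μ univ := lintegral_const _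
    _ ≤ (C * C * J) ^ (2 : ℝ) * (C : ℝ≥0∞) ^ 2 := by
        gcongr
        exact h.measure_le.trans (le_self_pow₀ hC1 two_ne_zero)
    _ = _ := by
        simp only [ENNReal.rpow_ofNat]
        ring

/-- `m`-th powers with `m > N` map `L²` into `L^∞`. -/
theorem exists_norm_opL2_pow_le (j : ℕ) :
    ∃ D : ℝ, 0 ≤ D ∧ ∀ f : Lp ℝ 2 μ, ∀ᵐ x ∂μ, ‖(h.opL2 ^ (N + 1 + j)) f x‖ ≤ D * ‖f‖ := by
  refine ⟨C ^ 4 * ‖h.opL2 ^ j‖, by positivity, fun f => ?_⟩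
  rw [pow_add]
  filter_upwards [h.enorm_opL2_pow_succ_le_norm ((h.opL2 ^ j) f), h.d_le] with x hx hd
  have h1 : ‖(h.opL2 ^ (N + 1)) ((h.opL2 ^ j) f) x‖ₑ ≤ (C : ℝ≥0∞) ^ 4 * ‖(h.opL2 ^ j) f‖ₑ := by
    refine hx.trans ?_
    calc (C : ℝ≥0∞) ^ 3 * d x * ‖(h.opL2 ^ j) f‖ₑ ≤ (C : ℝ≥0∞) ^ 3 * C * ‖(h.opL2 ^ j) f‖ₑ := by
          gcongr
      _ = _ := by ring
  have h2 : ‖(h.opL2 ^ (N + 1)) ((h.opL2 ^ j) f) x‖ ≤ (C : ℝ) ^ 4 * ‖(h.opL2 ^ j) f‖ := by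
    have := ENNReal.toReal_mono (by finiteness) h1
    simpa [ENNReal.toReal_mul] using this
  calc _ ≤ _ := h2
    _ ≤ (C : ℝ) ^ 4 * (‖h.opL2 ^ j‖ * ‖f‖) := by
        gcongr
        exact ContinuousLinearMap.le_opNorm _ _
    _ = _ := by ring

omit h [SFinite μ] in
/-- Bessel's inequality for an operator from `L²` to `L^∞`. -/
theorem sum_norm_sq_le_of_linfty [IsFiniteMeasure μ] {S : Lp ℝ 2 μ →L[ℝ] Lp ℝ 2 μ} {D : ℝ}
    (hD : 0 ≤ D) (hS : ∀ f, ∀ᵐ x ∂μ, ‖S f x‖ ≤ D * ‖f‖) {ι : Type*} {v : ι → Lp ℝ 2 μ}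
    (hv : Orthonormal ℝ v) (s : Finset ι) : ∑ i ∈ s, ‖S (v i)‖ ^ 2 ≤ D ^ 2 * μ.real univ := by
  have key : ∀ᵐ x ∂μ, ∑ i : s, (S (v i) x) ^ 2 ≤ D ^ 2 := by
    -- The exceptional null set depends on the coefficients, hence countably many rational vectors
    -- first. Density then gives, at almost every x, the bound for all real vectors, and c_i =
    -- S(v_i)(x) is the extremal choice.
    have h1 : ∀ᵐ x ∂μ, ∀ c : s → ℚ,
        |∑ i, (c i : ℝ) * S (v i) x| ≤ D * √(∑ i, (c i : ℝ) ^ 2) := by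
      rw [ae_all_iff]
      intro c
      have hin := (hv.comp _ (Subtype.val_injective (p := (· ∈ s)))).inner_sum
        (fun i => (c i : ℝ)) (fun i => (c i : ℝ)) Finset.univ
      simp only [Function.comp_apply] at hin
      have hnorm : ‖∑ i, (c i : ℝ) • v i‖ = √(∑ i, (c i : ℝ) ^ 2) := by
        rw [eq_comm, Real.sqrt_eq_iff_mul_self_eq (Finset.sum_nonneg fun i _ => sq_nonneg _)
          (norm_nonneg _), ← pow_two, ← real_inner_self_eq_norm_sq, hin]
        simp [pow_two]
      have hsum := Lp.coeFn_finsetSum (μ := μ) (p := 2) Finset.univ fun i => (c i : ℝ) • S (v i)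
      have hsm : ∀ᵐ x ∂μ, ∀ i : s, ((c i : ℝ) • S (v i) : Lp ℝ 2 μ) x = (c i : ℝ) * S (v i) x := by
        rw [ae_all_iff]
        intro i
        filter_upwards [Lp.coeFn_smul (c i : ℝ) (S (v i))] with x hx
        simpa using hx
      filter_upwards [hS (∑ i, (c i : ℝ) • v i), hsum, hsm] with x hx hx2 hx3
      rw [hnorm, map_sum] at hx
      simp only [map_smul] at hx
      rw [hx2] at hx
      simpa [hx3] using hx
    filter_upwards [h1] with x hx
    have h2 : ∀ c : s → ℝ, |∑ i, c i * S (v i) x| ≤ D * √(∑ i, c i ^ 2) := by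
      have hdr : DenseRange (Pi.map fun (_ : s) (q : ℚ) => (q : ℝ)) :=
        DenseRange.piMap fun _ => Rat.denseRange_cast
      intro c
      refine hdr.induction_on (p := fun c : s → ℝ => |∑ i, c i * S (v i) x| ≤ D * √(∑ i, c i ^ 2)) c
        (isClosed_le (by fun_prop) (by fun_prop)) fun c => hx c
    have h3 := h2 fun i => S (v i) x
    simp only [← pow_two] at h3
    have hnn : 0 ≤ ∑ i : s, (S (v i) x) ^ 2 := Finset.sum_nonneg fun i _ => sq_nonneg _
    set Q := ∑ i : s, (S (v i) x) ^ 2 with hQ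
    rw [abs_of_nonneg hnn] at h3
    have h4 : Q = √Q * √Q := (Real.mul_self_sqrt hnn).symm
    rcases eq_or_lt_of_le (Real.sqrt_nonneg Q) with h0 | h0
    · rw [h4, ← h0, mul_zero]
      positivity
    · have h5 : √Q ≤ D := by
        rw [h4] at h3
        simpa using le_of_mul_le_mul_right (by simpa using h3) h0
      rw [h4, pow_two]
      gcongr
  have hint : ∀ i : s, Integrable (fun x => (S (v i) x) ^ 2) μ := fun i =>
    (Lp.memLp (S (v i))).integrable_sq
  calc ∑ i ∈ s, ‖S (v i)‖ ^ 2 = ∑ i : s, ∫ x, (S (v i) x) ^ 2 ∂μ := by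
        rw [← Finset.sum_coe_sort]
        refine Finset.sum_congr rfl fun i _ => ?_
        rw [← real_inner_self_eq_norm_sq, L2.inner_def]
        simp [pow_two]
    _ = ∫ x, ∑ i : s, (S (v i) x) ^ 2 ∂μ := (integral_finsetSum _ fun i _ => hint i).symm
    _ ≤ ∫ _, D ^ 2 ∂μ := integral_mono_ae (integrable_finsetSum _ fun i _ => hint i)
        (integrable_const _) key
    _ = _ := by simp [mul_comm]

theorem exists_sum_norm_sq_le (j : ℕ) : ∃ K : ℝ, ∀ {ι : Type} {v : ι → Lp ℝ 2 μ},
    Orthonormal ℝ v → ∀ s : Finset ι, ∑ i ∈ s, ‖(h.opL2 ^ (N + 1 + j)) (v i)‖ ^ 2 ≤ K := by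
  have := h.isFiniteMeasure
  obtain ⟨D, hD, hD'⟩ := h.exists_norm_opL2_pow_le j
  exact ⟨_, fun hv s => sum_norm_sq_le_of_linfty hD hD' hv s⟩

/-- As 2^N ≥ N + 1, the power T^(2^N) is Hilbert–Schmidt; compactness descends to T by taking square
roots. -/
theorem isCompactOperator_opL2 : IsCompactOperator h.opL2 := by
  obtain ⟨j, hj⟩ := Nat.exists_eq_add_of_le (Nat.lt_two_pow_self (n := N))
  refine isCompactOperator_of_pow_two_pow h.inner_opL2 N ?_
  obtain ⟨K, hK⟩ := h.exists_sum_norm_sq_le j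
  obtain ⟨w, b, -⟩ := exists_hilbertBasis ℝ (Lp ℝ 2 μ)
  refine isCompactOperator_of_sum_sq_le b _ K fun s => ?_
  rw [hj]
  exact hK b.orthonormal s

end RegKernel

end NonlocalEig
end

noncomputable section

namespace NonlocalEig

/-! ### The spectral resolvent -/

section Resolvent

variable {H : Type} [NormedAddCommGroup H] [InnerProductSpace ℝ H] [CompleteSpace H]

omit [CompleteSpace H] in
theorem ext_inner_hilbertBasis (b : HilbertBasis ℕ ℝ H) {x y : H}
    (hxy : ∀ j, ⟪b j, x⟫ = ⟪b j, y⟫) : x = y := by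
  refine b.repr.injective ?_
  ext j
  rw [b.repr_apply_apply, b.repr_apply_apply, hxy]

omit [CompleteSpace H] in
theorem hasSum_inner_sq (b : HilbertBasis ℕ ℝ H) (x : H) :
    HasSum (fun j => ⟪b j, x⟫ ^ 2) (‖x‖ ^ 2) := by
  have := b.hasSum_inner_mul_inner x x
  rw [real_inner_self_eq_norm_sq] at this
  refine this.congr_fun fun j => ?_
  rw [real_inner_comm, pow_two]

/-- `∑ⱼ ⟨f, bⱼ⟩ / (vⱼ - λ) bⱼ`. -/
def resolvent (b : HilbertBasis ℕ ℝ H) (val : ℕ → ℝ) (lam : ℝ) (f : H) : H :=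
  ∑' j, (⟪b j, f⟫ / (val j - lam)) • b j

variable {b : HilbertBasis ℕ ℝ H} {val : ℕ → ℝ} {lam g : ℝ} {f : H}

-- The alternative in `hf` serves two purposes: all of L², with g the distance from λ to the
-- spectrum, and E^⊥, where the low coefficients vanish and g is the spectral gap.
omit [CompleteSpace H] in
theorem coef_sq_le (hg : 0 < g) (hf : ∀ j, ⟪b j, f⟫ = 0 ∨ g ≤ |val j - lam|) (j : ℕ) :
    (⟪b j, f⟫ / (val j - lam)) ^ 2 ≤ ⟪b j, f⟫ ^ 2 / g ^ 2 := by
  rcases hf j with h0 | h0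
  · simp [h0]
  · rw [div_pow, ← sq_abs (val j - lam)]
    gcongr

theorem hasSum_resolvent (hg : 0 < g) (hf : ∀ j, ⟪b j, f⟫ = 0 ∨ g ≤ |val j - lam|) :
    HasSum (fun j => (⟪b j, f⟫ / (val j - lam)) • b j) (resolvent b val lam f) := by
  refine Summable.hasSum ?_
  have hV := b.orthonormal.orthogonalFamily
  have := hV.summable_iff_norm_sq_summable fun j => ⟪b j, f⟫ / (val j - lam)
  simp only [LinearIsometry.toSpanSingleton_apply] at this
  rw [this]
  refine Summable.of_nonneg_of_le (fun j => by positivity) (fun j => ?_)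
    ((hasSum_inner_sq b f).summable.div_const (g ^ 2))
  rw [Real.norm_eq_abs, sq_abs]
  exact coef_sq_le hg hf j

theorem inner_resolvent (hg : 0 < g) (hf : ∀ j, ⟪b j, f⟫ = 0 ∨ g ≤ |val j - lam|) (i : ℕ) :
    ⟪b i, resolvent b val lam f⟫ = ⟪b i, f⟫ / (val i - lam) := by
  have h1 := (hasSum_resolvent hg hf).mapL (innerSL ℝ (b i))
  simp only [innerSL_apply_apply, real_inner_smul_right] at h1
  refine h1.unique ?_
  convert hasSum_single i ?_ using 1
  · simp [b.orthonormal.1 i]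
  · intro j hj
    rw [b.orthonormal.2 hj.symm, mul_zero]

theorem norm_resolvent_le (hg : 0 < g) (hf : ∀ j, ⟪b j, f⟫ = 0 ∨ g ≤ |val j - lam|) :
    ‖resolvent b val lam f‖ ≤ ‖f‖ / g := by
  refine le_of_sq_le_sq ?_ (by positivity)
  rw [div_pow]
  refine hasSum_le (fun j => ?_) (hasSum_inner_sq b _) ((hasSum_inner_sq b f).div_const (g ^ 2))
  rw [inner_resolvent hg hf]
  exact coef_sq_le hg hf j

variable {T : H →L[ℝ] H}

omit [CompleteSpace H] in
theorem inner_eigen (hT : ∀ x y, ⟪T x, y⟫ = ⟪x, T y⟫) (heig : ∀ j, T (b j) = (val j)⁻¹ • b j)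
    (j m : ℕ) (x : H) : ⟪b j, (T ^ m) x⟫ = (val j)⁻¹ ^ m * ⟪b j, x⟫ := by
  induction m generalizing x with
  | zero => simp
  | succ m ih =>
    rw [pow_succ, mul_apply_eq_comp, ih, ← hT, heig, real_inner_smul_left, pow_succ]
    ring

/-- On the j-th coefficient this is the identity 1/(v-λ) = Σ_{i<m} λ^i v^(-i-1) + λ^m v^(-m)/(v-λ).
The remainder is kept, so λ need not be small. -/
theorem resolvent_eq_sum (hT : ∀ x y, ⟪T x, y⟫ = ⟪x, T y⟫)
    (heig : ∀ j, T (b j) = (val j)⁻¹ • b j) (hval : ∀ j, 0 < val j) (hg : 0 < g)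
    (hlam : ∀ j, val j ≠ lam) (hf : ∀ j, ⟪b j, f⟫ = 0 ∨ g ≤ |val j - lam|) (m : ℕ) :
    resolvent b val lam f = ∑ i ∈ Finset.range m, lam ^ i • (T ^ (i + 1)) f +
      lam ^ m • (T ^ m) (resolvent b val lam f) := by
  refine ext_inner_hilbertBasis b fun j => ?_
  rw [inner_add_right, inner_sum, real_inner_smul_right, inner_eigen hT heig,
    inner_resolvent hg hf]
  simp only [real_inner_smul_right, inner_eigen hT heig]
  have h1 := (hval j).ne'
  have h2 : val j - lam ≠ 0 := sub_ne_zero.mpr (hlam j)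
  induction m with
  | zero => simp
  | succ m ih =>
    have key : lam ^ m * ((val j)⁻¹ ^ m * (⟪b j, f⟫ / (val j - lam))) =
        lam ^ m * ((val j)⁻¹ ^ (m + 1) * ⟪b j, f⟫) +
          lam ^ (m + 1) * ((val j)⁻¹ ^ (m + 1) * (⟪b j, f⟫ / (val j - lam))) := by
      simp only [inv_pow]
      field_simp
      ring
    rw [Finset.sum_range_succ, add_assoc, ← key]
    exact ih

theorem resolvent_pow (hT : ∀ x y, ⟪T x, y⟫ = ⟪x, T y⟫)
    (heig : ∀ j, T (b j) = (val j)⁻¹ • b j) (hg : 0 < g)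
    (hf : ∀ j, ⟪b j, f⟫ = 0 ∨ g ≤ |val j - lam|) (m : ℕ) :
    (T ^ m) (resolvent b val lam f) = resolvent b val lam ((T ^ m) f) := by
  have hf' : ∀ j, ⟪b j, (T ^ m) f⟫ = 0 ∨ g ≤ |val j - lam| := fun j =>
    (hf j).imp_left fun h0 => by rw [inner_eigen hT heig, h0, mul_zero]
  refine ext_inner_hilbertBasis b fun j => ?_
  rw [inner_eigen hT heig, inner_resolvent hg hf, inner_resolvent hg hf', inner_eigen hT heig]
  ring

theorem inner_resolvent_comm (hg : 0 < g) (hval : ∀ j, g ≤ |val j - lam|) (x y : H) :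
    ⟪resolvent b val lam x, y⟫ = ⟪x, resolvent b val lam y⟫ := by
  rw [← b.tsum_inner_mul_inner, ← b.tsum_inner_mul_inner]
  refine tsum_congr fun j => ?_
  rw [real_inner_comm, inner_resolvent hg fun j => Or.inr (hval j),
    inner_resolvent hg fun j => Or.inr (hval j), real_inner_comm x]
  ring

theorem resolvent_add_smul (hg : 0 < g) (hval : ∀ j, g ≤ |val j - lam|) (c : ℝ) (x y : H) :
    resolvent b val lam (c • x + y) = c • resolvent b val lam x + resolvent b val lam y := by
  refine ext_inner_hilbertBasis b fun j => ?_
  simp only [inner_add_right, real_inner_smul_right, inner_resolvent hg fun j => Or.inr (hval j)]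
  ring

end Resolvent

/-! ### Pointwise domination of the resolvent -/

namespace RegKernel

variable {X : Type} [MeasurableSpace X] {μ : Measure X} [SFinite μ]
variable {k : X → X → ℝ≥0} {d : X → ℝ≥0} {N : ℕ} {C : ℝ≥0} (h : RegKernel μ k d N C)

/-- The constant in the pointwise bound for the resolvent. -/
def resolventConst (N : ℕ) (C M g : ℝ≥0) : ℝ≥0 :=
  ∑ i ∈ Finset.range (2 * (N + 1)), M ^ i * C ^ i + M ^ (2 * (N + 1)) * (C ^ 7 * g⁻¹)

include h

/-- Pointwise domination of the resolvent by the integral operator, on the span of the eigenvectors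
whose eigenvalues keep a distance from `lam`. -/
theorem enorm_resolvent_le {b : HilbertBasis ℕ ℝ (Lp ℝ 2 μ)} {val : ℕ → ℝ}
    (heig : ∀ j, h.opL2 (b j) = (val j)⁻¹ • b j) (hval : ∀ j, 0 < val j) {lam : ℝ}
    (hlam : ∀ j, val j ≠ lam) {M g : ℝ≥0} (hM : |lam| ≤ M) (hg : 0 < g) {f : Lp ℝ 2 μ}
    (hf : ∀ j, ⟪b j, f⟫ = 0 ∨ (g : ℝ) ≤ |val j - lam|) :
    ∀ᵐ x ∂μ, ‖resolvent b val lam f x‖ₑ ≤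
      resolventConst N C M g * kernelOp μ k (fun y => ‖f y‖ₑ) x := by
  have hg' : (0 : ℝ) < g := hg
  have hmf := measurable_enorm_Lp (f : X →ₘ[μ] ℝ)
  set R := resolvent b val lam f with hR
  set P := h.opL2 ^ (N + 1) with hP
  set J := ∫⁻ y, ‖f y‖ₑ * d y ∂μ with hJ
  set F := fun y => ‖f y‖ₑ with hF
  have hPf : ∀ j, ⟪b j, P f⟫ = 0 ∨ (g : ℝ) ≤ |val j - lam| := fun j =>
    (hf j).imp_left fun h0 => by rw [hP, inner_eigen h.inner_opL2 heig, h0, mul_zero]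
  have hlamM : ‖lam‖ₑ ≤ M := by
    rw [← ofReal_norm, Real.norm_eq_abs]
    exact ENNReal.ofReal_le_of_le_toReal hM
  -- An even number 2(N+1) of terms, so that the remainder T^(2(N+1)) R f becomes T^(N+1) R T^(N+1)
  -- f, with one smoothing factor on each side of R.
  have e1 := resolvent_eq_sum h.inner_opL2 heig hval hg' hlam hf (2 * (N + 1))
  rw [← hR, two_mul, pow_add h.opL2, mul_apply_eq_comp, resolvent_pow h.inner_opL2 heig hg' hf,
    ← hP] at e1
  have hnorm : ‖resolvent b val lam (P f)‖ₑ ≤ (g : ℝ≥0∞)⁻¹ * ((C : ℝ≥0∞) ^ 3 * J) := by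
    refine le_trans ?_ (mul_le_mul_right (h.enorm_opL2_pow_succ_norm_le f) _)
    rw [← ofReal_norm, ← ofReal_norm, ← hP]
    refine (ENNReal.ofReal_le_ofReal (norm_resolvent_le hg' hPf)).trans ?_
    rw [ENNReal.ofReal_div_of_pos hg', ENNReal.ofReal_coe_nnreal, mul_comm, div_eq_mul_inv]
  -- The exponent 7 is 3 + 3 from the two smoothing factors and 1 from bounding d·∫|f| d by T|f|.
  have h2 : ∀ᵐ x ∂μ, ‖P (resolvent b val lam (P f)) x‖ₑ ≤
      (C : ℝ≥0∞) ^ 7 * (g : ℝ≥0∞)⁻¹ * kernelOp μ k F x := by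
    filter_upwards [h.enorm_opL2_pow_succ_le_norm (resolvent b val lam (P f)),
      h.lower F hmf] with x hx hx2
    calc _ ≤ _ := hx
      _ ≤ (C : ℝ≥0∞) ^ 3 * d x * ((g : ℝ≥0∞)⁻¹ * ((C : ℝ≥0∞) ^ 3 * J)) := by gcongr
      _ = (C : ℝ≥0∞) ^ 6 * (g : ℝ≥0∞)⁻¹ * (d x * J) := by ring
      _ ≤ (C : ℝ≥0∞) ^ 6 * (g : ℝ≥0∞)⁻¹ * (C * kernelOp μ k F x) := by gcongr
      _ = _ := by ring
  have h3 : ∀ᵐ x ∂μ, ∀ i, ‖(h.opL2 ^ (i + 1)) f x‖ₑ ≤ (C : ℝ≥0∞) ^ i * kernelOp μ k F x := by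
    rw [ae_all_iff]
    intro i
    filter_upwards [h.enorm_opL2_pow_le (i + 1) f, h.iterate_succ_le i hmf] with x hx hx2
    exact hx.trans hx2
  have hsm : ∀ᵐ x ∂μ, ∀ i, (lam ^ i • (h.opL2 ^ (i + 1)) f : Lp ℝ 2 μ) x =
      lam ^ i * (h.opL2 ^ (i + 1)) f x := by
    rw [ae_all_iff]
    intro i
    filter_upwards [Lp.coeFn_smul (lam ^ i) ((h.opL2 ^ (i + 1)) f)] with x hx
    simpa using hx
  have hsum := Lp.coeFn_finsetSum (μ := μ) (p := 2) (Finset.range (N + 1 + (N + 1)))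
    fun i => lam ^ i • (h.opL2 ^ (i + 1)) f
  have hlast := Lp.coeFn_smul (lam ^ (N + 1 + (N + 1))) (P (resolvent b val lam (P f)))
  have hadd := Lp.coeFn_add (∑ i ∈ Finset.range (N + 1 + (N + 1)), lam ^ i • (h.opL2 ^ (i + 1)) f)
    (lam ^ (N + 1 + (N + 1)) • P (resolvent b val lam (P f)))
  rw [← e1] at hadd
  filter_upwards [h2, h3, hsm, hsum, hlast, hadd] with x hx2 hx3 hxsm hxsum hxlast hxadd
  rw [hxadd, Pi.add_apply, hxsum, hxlast, Pi.smul_apply, Finset.sum_apply, Finset.sum_congr rfl fun i _ => hxsm i]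
  refine (enorm_add_le _ _).trans ?_
  rw [resolventConst, ENNReal.coe_add, add_mul, two_mul, ENNReal.ofNNReal_finsetSum, Finset.sum_mul]
  refine add_le_add ((enorm_sum_le _ _).trans (Finset.sum_le_sum fun i _ => ?_)) ?_
  · rw [enorm_mul, enorm_pow]
    calc ‖lam‖ₑ ^ i * ‖(h.opL2 ^ (i + 1)) f x‖ₑ
        ≤ (M : ℝ≥0∞) ^ i * ((C : ℝ≥0∞) ^ i * kernelOp μ k F x) := by
          gcongr
          exact hx3 i
      _ = _ := by push_cast; ring
  · rw [smul_eq_mul, enorm_mul, enorm_pow]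
    calc _ ≤ (M : ℝ≥0∞) ^ (N + 1 + (N + 1)) *
          ((C : ℝ≥0∞) ^ 7 * (g : ℝ≥0∞)⁻¹ * kernelOp μ k F x) := by gcongr
      _ = _ := by
        rw [ENNReal.coe_mul, ENNReal.coe_mul, ENNReal.coe_inv hg.ne']
        push_cast
        ring

end RegKernel

end NonlocalEig
end

noncomputable section

namespace NonlocalEig

/-! ### The weighted space `L¹(d)` -/

section WeightedL1

variable {X : Type} [MeasurableSpace X] {μ : Measure X} {d : X → ℝ≥0}

/-- The norm of `L¹(μ; d)`. -/
def weightedNorm (d : X → ℝ≥0) (f : X →ₘ[μ] ℝ) : ℝ≥0∞ := ∫⁻ x, ‖f x‖ₑ * d x ∂μ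

theorem measurable_enorm_mul (hd : Measurable d) (f : X →ₘ[μ] ℝ) :
    Measurable fun x => ‖f x‖ₑ * (d x : ℝ≥0∞) :=
  (measurable_enorm_Lp f).mul hd.coe_nnreal_ennreal

theorem weightedNorm_add_le (hd : Measurable d) (f g : X →ₘ[μ] ℝ) :
    weightedNorm d (f + g) ≤ weightedNorm d f + weightedNorm d g := by
  unfold weightedNorm
  rw [← lintegral_add_left (measurable_enorm_mul hd f)]
  refine lintegral_mono_ae ?_
  filter_upwards [AEEqFun.coeFn_add f g] with x hx
  rw [hx, Pi.add_apply, ← add_mul]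
  gcongr
  exact enorm_add_le _ _

theorem weightedNorm_smul (hd : Measurable d) (c : ℝ) (f : X →ₘ[μ] ℝ) :
    weightedNorm d (c • f) = ‖c‖ₑ * weightedNorm d f := by
  unfold weightedNorm
  rw [← lintegral_const_mul _ (measurable_enorm_mul hd f)]
  refine lintegral_congr_ae ?_
  filter_upwards [AEEqFun.coeFn_smul c f] with x hx
  rw [hx, Pi.smul_apply, smul_eq_mul, enorm_mul, mul_assoc]

theorem weightedNorm_neg (f : X →ₘ[μ] ℝ) : weightedNorm d (-f) = weightedNorm d f := by
  refine lintegral_congr_ae ?_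
  filter_upwards [AEEqFun.coeFn_neg f] with x hx
  rw [hx, Pi.neg_apply, enorm_neg]

theorem weightedNorm_le_add_sub (hd : Measurable d) (f g : X →ₘ[μ] ℝ) :
    weightedNorm d f ≤ weightedNorm d (f - g) + weightedNorm d g := by
  conv_lhs => rw [← sub_add_cancel f g]
  exact weightedNorm_add_le hd _ _

theorem weightedNorm_sub_lt_top (hd : Measurable d) {f g : X →ₘ[μ] ℝ}
    (hf : weightedNorm d f < ∞) (hg : weightedNorm d g < ∞) : weightedNorm d (f - g) < ∞ := by
  rw [sub_eq_add_neg]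
  refine (weightedNorm_add_le hd _ _).trans_lt ?_
  rw [weightedNorm_neg]
  exact ENNReal.add_lt_top.mpr ⟨hf, hg⟩

theorem weightedNorm_mono {f : X →ₘ[μ] ℝ} {G : X → ℝ≥0∞} (h : ∀ᵐ x ∂μ, ‖f x‖ₑ ≤ G x) :
    weightedNorm d f ≤ ∫⁻ x, G x * d x ∂μ :=
  lintegral_mono_ae (h.mono fun x hx => by gcongr)

theorem integrable_mul_of_le {f ψ : X →ₘ[μ] ℝ} (hf : weightedNorm d f < ∞) {D : ℝ≥0}
    (hψ : ∀ᵐ x ∂μ, ‖ψ x‖ₑ ≤ D * d x) : Integrable (fun x => f x * ψ x) μ := by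
  refine ⟨(f.measurable.mul ψ.measurable).aestronglyMeasurable, ?_⟩
  rw [hasFiniteIntegral_iff_enorm]
  calc ∫⁻ x, ‖f x * ψ x‖ₑ ∂μ ≤ ∫⁻ x, D * (‖f x‖ₑ * d x) ∂μ := by
        refine lintegral_mono_ae (hψ.mono fun x hx => ?_)
        rw [enorm_mul]
        calc ‖f x‖ₑ * ‖ψ x‖ₑ ≤ ‖f x‖ₑ * (D * d x) := by gcongr
          _ = _ := by ring
    _ = D * weightedNorm d f := lintegral_const_mul' _ _ ENNReal.coe_ne_top
    _ < ∞ := ENNReal.mul_lt_top ENNReal.coe_lt_top hf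

theorem enorm_integral_mul_le {f ψ : X →ₘ[μ] ℝ} {D : ℝ≥0}
    (hψ : ∀ᵐ x ∂μ, ‖ψ x‖ₑ ≤ D * d x) : ‖∫ x, f x * ψ x ∂μ‖ₑ ≤ D * weightedNorm d f := by
  refine (enorm_integral_le_lintegral_enorm _).trans ?_
  rw [weightedNorm, ← lintegral_const_mul' _ _ ENNReal.coe_ne_top]
  refine lintegral_mono_ae (hψ.mono fun x hx => ?_)
  rw [enorm_mul]
  calc ‖f x‖ₑ * ‖ψ x‖ₑ ≤ ‖f x‖ₑ * (D * d x) := by gcongr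
    _ = _ := by ring

theorem integral_sub_mul {f g ψ : X →ₘ[μ] ℝ} (hf : weightedNorm d f < ∞)
    (hg : weightedNorm d g < ∞) {D : ℝ≥0} (hψ : ∀ᵐ x ∂μ, ‖ψ x‖ₑ ≤ D * d x) :
    ∫ x, (f - g) x * ψ x ∂μ = ∫ x, f x * ψ x ∂μ - ∫ x, g x * ψ x ∂μ := by
  rw [← integral_sub (integrable_mul_of_le hf hψ) (integrable_mul_of_le hg hψ)]
  refine integral_congr_ae ?_
  filter_upwards [AEEqFun.coeFn_sub f g] with x hx
  rw [hx, Pi.sub_apply, sub_mul]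

/-- `L²` is dense in `L¹(d)`. -/
theorem exists_L2_weightedNorm_sub_lt [IsFiniteMeasure μ] (hd : Measurable d) {f : X →ₘ[μ] ℝ}
    (hf : weightedNorm d f < ∞) {ε : ℝ≥0∞} (hε : 0 < ε) :
    ∃ h : Lp ℝ 2 μ, weightedNorm d (f - (h : X →ₘ[μ] ℝ)) < ε := by
  -- The truncations of f to {|f| ≤ m} are bounded, hence in L², and converge to f in L¹(d) by
  -- dominated convergence.
  let S : ℕ → Set X := fun m => {x | ‖f x‖ ≤ m}
  have hS : ∀ m, MeasurableSet (S m) := fun m => measurableSet_le f.measurable.norm measurable_const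
  have hmem : ∀ m, MemLp ((S m).indicator f) 2 μ := fun m => by
    refine MemLp.of_bound (f.measurable.indicator (hS m)).aestronglyMeasurable m
      (ae_of_all _ fun x => ?_)
    by_cases hx : x ∈ S m
    · rw [indicator_of_mem hx]
      exact hx
    · rw [indicator_of_notMem hx, norm_zero]
      positivity
  have hlim : Tendsto (fun m : ℕ => ∫⁻ x, ‖f x - (S m).indicator f x‖ₑ * d x ∂μ) atTop
      (𝓝 (∫⁻ _, 0 ∂μ)) := by
    refine tendsto_lintegral_of_dominated_convergence (fun x => ‖f x‖ₑ * d x) (fun m => ?_)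
      (fun m => ae_of_all _ fun x => ?_) hf.ne (ae_of_all _ fun x => ?_)
    · exact (f.measurable.sub (f.measurable.indicator (hS m))).enorm.mul hd.coe_nnreal_ennreal
    · by_cases hx : x ∈ S m
      · simp [indicator_of_mem hx]
      · simp [indicator_of_notMem hx]
    · obtain ⟨m₀, hm₀⟩ := exists_nat_ge ‖f x‖
      refine tendsto_const_nhds.congr' ?_
      filter_upwards [eventually_ge_atTop m₀] with m hm
      have hx : x ∈ S m := hm₀.trans (by exact_mod_cast hm)
      simp [indicator_of_mem hx]
  rw [lintegral_zero] at hlim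
  obtain ⟨m, hm⟩ := (hlim.eventually_lt_const hε).exists
  refine ⟨(hmem m).toLp _, lt_of_eq_of_lt (lintegral_congr_ae ?_) hm⟩
  filter_upwards [AEEqFun.coeFn_sub f ((hmem m).toLp _ : X →ₘ[μ] ℝ), (hmem m).coeFn_toLp]
    with x hx hx2
  rw [hx, Pi.sub_apply, hx2]

/-- Test with sign(u)·d, which lies in L² because d is bounded: the pairing becomes ∫|u| d, and d >
0. -/
theorem eq_zero_of_forall_integral_mul_eq_zero [IsFiniteMeasure μ] (hd : Measurable d)
    (hpos : ∀ᵐ x ∂μ, 0 < d x) {D : ℝ≥0} (hle : ∀ᵐ x ∂μ, d x ≤ D) {u : X →ₘ[μ] ℝ}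
    (hu : weightedNorm d u < ∞)
    (h0 : ∀ ψ : Lp ℝ 2 μ, (∀ᵐ x ∂μ, ‖ψ x‖ₑ ≤ d x) → ∫ x, u x * ψ x ∂μ = 0) : u = 0 := by
  let p : X → ℝ := fun x => SignType.sign (u x) * d x
  have hsign : Measurable fun t : ℝ => ((SignType.sign t : SignType) : ℝ) := by
    have : (fun t : ℝ => ((SignType.sign t : SignType) : ℝ)) =
        fun t => if 0 < t then 1 else if t < 0 then -1 else 0 := by
      funext t
      rcases lt_trichotomy t 0 with h | h | h
      · simp [h, h.not_gt]
      · simp [h]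
      · simp [h]
    rw [this]
    exact Measurable.ite measurableSet_Ioi measurable_const
      (Measurable.ite measurableSet_Iio measurable_const measurable_const)
  have hpm : Measurable p := (hsign.comp u.measurable).mul hd.coe_nnreal_real
  have hsle : ∀ t : ℝ, ‖((SignType.sign t : SignType) : ℝ)‖ₑ ≤ 1 := by
    intro t
    rcases lt_trichotomy t 0 with h | h | h <;> simp [h]
  have hpe : ∀ x, ‖p x‖ₑ ≤ d x := fun x => by
    rw [enorm_mul, Real.enorm_of_nonneg (NNReal.coe_nonneg _), ENNReal.ofReal_coe_nnreal]
    exact (mul_le_mul_left (hsle _) _).trans (one_mul _).le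
  have hmem : MemLp p 2 μ := by
    refine MemLp.of_enorm_bound (C := D) hpm.aestronglyMeasurable (by simp)
      (hle.mono fun x hx => (hpe x).trans (by exact_mod_cast hx))
  have h1 := h0 (hmem.toLp p) (hmem.coeFn_toLp.mono fun x hx => by rw [hx]; exact hpe x)
  have h2 : ∫ x, ‖u x‖ * d x ∂μ = 0 := by
    rw [← h1]
    refine integral_congr_ae (hmem.coeFn_toLp.mono fun x hx => ?_)
    simp only [hx, p]
    rw [← mul_assoc, Real.norm_eq_abs, ← self_mul_sign]
  rw [integral_eq_zero_iff_of_nonneg_ae (ae_of_all _ fun x => by positivity)] at h2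
  · refine AEEqFun.ext ?_
    filter_upwards [h2, hpos, AEEqFun.coeFn_zero (μ := μ) (β := ℝ)] with x hx hx2 hx3
    rw [hx3]
    simpa [hx2.ne'] using hx
  · refine ⟨(u.measurable.norm.mul hd.coe_nnreal_real).aestronglyMeasurable, ?_⟩
    rw [hasFiniteIntegral_iff_enorm]
    simpa [weightedNorm, enorm_mul] using hu

theorem aeeqFun_mul_add (a f g : X →ₘ[μ] ℝ) : a * (f + g) = a * f + a * g := by
  refine AEEqFun.ext ?_
  filter_upwards [AEEqFun.coeFn_mul a (f + g), AEEqFun.coeFn_add f g, AEEqFun.coeFn_mul a f,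
    AEEqFun.coeFn_mul a g, AEEqFun.coeFn_add (a * f) (a * g)] with x h1 h2 h3 h4 h5
  simp only [h1, h2, h3, h4, h5, Pi.add_apply, Pi.mul_apply, mul_add]

theorem aeeqFun_mul_smul (c : ℝ) (a f : X →ₘ[μ] ℝ) : a * (c • f) = c • (a * f) := by
  refine AEEqFun.ext ?_
  filter_upwards [AEEqFun.coeFn_mul a (c • f), AEEqFun.coeFn_smul c f, AEEqFun.coeFn_mul a f,
    AEEqFun.coeFn_smul c (a * f)] with x h1 h2 h3 h4
  simp only [h1, h2, h3, h4, Pi.smul_apply, Pi.mul_apply, mul_smul_comm]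

theorem aeeqFun_mul_sub (a f g : X →ₘ[μ] ℝ) : a * (f - g) = a * f - a * g := by
  rw [eq_sub_iff_add_eq, ← aeeqFun_mul_add, sub_add_cancel]

/-- Extension by density of an operator on `L²` which is bounded for the norm of `L¹(d)`. -/
theorem exists_extension [IsFiniteMeasure μ] (hd : Measurable d) (hpos : ∀ᵐ x ∂μ, 0 < d x)
    {D : ℝ≥0} (hle : ∀ᵐ x ∂μ, d x ≤ D)
    (G : Lp ℝ 2 μ →ₗ[ℝ] Lp ℝ 2 μ) {K : ℝ≥0}
    (hG : ∀ h : Lp ℝ 2 μ, weightedNorm d (G h : X →ₘ[μ] ℝ) ≤ K * weightedNorm d (h : X →ₘ[μ] ℝ))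
    {f : X →ₘ[μ] ℝ} (hf : weightedNorm d f < ∞) :
    ∃ u : X →ₘ[μ] ℝ, weightedNorm d u < ∞ ∧
      ∀ h : Lp ℝ 2 μ, weightedNorm d (u - (G h : X →ₘ[μ] ℝ)) ≤
        K * weightedNorm d (f - (h : X →ₘ[μ] ℝ)) := by
  -- Multiplication by d identifies L¹(d) isometrically with the Banach space L¹, where a bounded
  -- map defined on a dense subspace extends; multiplication by 1/d leads back.
  let δ : X →ₘ[μ] ℝ := AEEqFun.mk (fun x => (d x : ℝ)) hd.coe_nnreal_real.aestronglyMeasurable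
  have hdi : Measurable fun x => (d x : ℝ)⁻¹ := hd.coe_nnreal_real.inv
  let δi : X →ₘ[μ] ℝ := AEEqFun.mk (fun x => (d x : ℝ)⁻¹) hdi.aestronglyMeasurable
  have hδδ : δ * δi = 1 := by
    refine AEEqFun.ext ?_
    filter_upwards [AEEqFun.coeFn_mul δ δi, AEEqFun.coeFn_mk (μ := μ) _
      hd.coe_nnreal_real.aestronglyMeasurable, AEEqFun.coeFn_mk (μ := μ) _
      hdi.aestronglyMeasurable, hpos, AEEqFun.coeFn_one (μ := μ) (β := ℝ)]
      with x h1 h2 h3 h4 h5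
    rw [h1, h5, Pi.mul_apply, h2, h3]
    exact mul_inv_cancel₀ (by exact_mod_cast h4.ne')
  have hnorm : ∀ v : X →ₘ[μ] ℝ, eLpNorm (δ * v : X →ₘ[μ] ℝ) 1 μ = weightedNorm d v := by
    intro v
    rw [eLpNorm_one_eq_lintegral_enorm]
    refine lintegral_congr_ae ?_
    filter_upwards [AEEqFun.coeFn_mul δ v, AEEqFun.coeFn_mk (μ := μ) _
      hd.coe_nnreal_real.aestronglyMeasurable] with x h1 h2
    rw [h1, Pi.mul_apply, h2, enorm_mul, mul_comm, Real.enorm_of_nonneg (NNReal.coe_nonneg _),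
      ENNReal.ofReal_coe_nnreal]
  have hfin : ∀ h : Lp ℝ 2 μ, weightedNorm d (h : X →ₘ[μ] ℝ) < ∞ := by
    intro h
    calc weightedNorm d (h : X →ₘ[μ] ℝ) ≤ ∫⁻ x, D * ‖h x‖ₑ ∂μ :=
          lintegral_mono_ae (hle.mono fun x hx => by rw [mul_comm]; gcongr)
      _ = D * eLpNorm h 1 μ := by
          rw [lintegral_const_mul' _ _ ENNReal.coe_ne_top, eLpNorm_one_eq_lintegral_enorm]
      _ < ∞ := ENNReal.mul_lt_top ENNReal.coe_lt_top
          ((Lp.memLp h).mono_exponent (by norm_num : (1 : ℝ≥0∞) ≤ 2)).2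
  let e : Lp ℝ 2 μ →ₗ[ℝ] Lp ℝ 1 μ :=
    { toFun := fun h => ⟨δ * h, Lp.mem_Lp_iff_eLpNorm_lt_top.mpr (by rw [hnorm]; exact hfin h)⟩
      map_add' := fun h h' => Subtype.ext (aeeqFun_mul_add _ _ _)
      map_smul' := fun c h => Subtype.ext (aeeqFun_mul_smul _ _ _) }
  have hen : ∀ h, ‖e h‖ = (weightedNorm d (h : X →ₘ[μ] ℝ)).toReal := fun h => by
    rw [Lp.norm_def, ← hnorm]
    rfl
  have hfn : ∀ h, ‖(e ∘ₗ G) h‖ ≤ K * ‖e h‖ := fun h => by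
    rw [LinearMap.comp_apply, hen, hen, ← ENNReal.coe_toReal K, ← ENNReal.toReal_mul]
    exact ENNReal.toReal_mono (ENNReal.mul_ne_top ENNReal.coe_ne_top (hfin h).ne) (hG h)
  have hdense : DenseRange e := by
    rw [Metric.denseRange_iff]
    intro v ε hε
    have hv : δ * (δi * v) = (v : X →ₘ[μ] ℝ) := by rw [← mul_assoc, hδδ, one_mul]
    have hvn : weightedNorm d (δi * v : X →ₘ[μ] ℝ) < ∞ := by
      rw [← hnorm, hv]
      exact Lp.eLpNorm_lt_top v
    obtain ⟨h, hh⟩ := exists_L2_weightedNorm_sub_lt hd hvn (ENNReal.ofReal_pos.mpr hε)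
    refine ⟨h, ?_⟩
    rw [dist_eq_norm, Lp.norm_def]
    have : ((v - e h : Lp ℝ 1 μ) : X →ₘ[μ] ℝ) = δ * (δi * v - h) := by
      rw [aeeqFun_mul_sub, hv]
      rfl
    rw [this, hnorm]
    exact ENNReal.toReal_lt_of_lt_ofReal hh
  let Φ : Lp ℝ 1 μ →L[ℝ] Lp ℝ 1 μ := (e ∘ₗ G).extendOfNorm e
  have hΦe : ∀ h, Φ (e h) = e (G h) := fun h =>
    LinearMap.extendOfNorm_eq hdense ⟨K, hfn⟩ h
  have hΦn : ∀ v, ‖Φ v‖ ≤ K * ‖v‖ := LinearMap.norm_extendOfNorm_apply_le hdense K hfn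
  let v : Lp ℝ 1 μ := ⟨δ * f, Lp.mem_Lp_iff_eLpNorm_lt_top.mpr (by rw [hnorm]; exact hf)⟩
  have hu : δ * (δi * Φ v) = (Φ v : X →ₘ[μ] ℝ) := by rw [← mul_assoc, hδδ, one_mul]
  refine ⟨δi * Φ v, ?_, fun h => ?_⟩
  · rw [← hnorm, hu]
    exact Lp.eLpNorm_lt_top _
  · have e1 : ((Φ (v - e h) : Lp ℝ 1 μ) : X →ₘ[μ] ℝ) = δ * (δi * Φ v - G h) := by
      rw [aeeqFun_mul_sub, hu, map_sub, hΦe]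
      rfl
    have e2 : ((v - e h : Lp ℝ 1 μ) : X →ₘ[μ] ℝ) = δ * (f - h) := by
      rw [aeeqFun_mul_sub]
      rfl
    rw [← hnorm, ← hnorm, ← e1, ← e2, ← Lp.enorm_def, ← Lp.enorm_def, ← ofReal_norm,
      ← ofReal_norm, ← ENNReal.ofReal_coe_nnreal, ← ENNReal.ofReal_mul (NNReal.coe_nonneg K)]
    exact ENNReal.ofReal_le_ofReal (hΦn _)

end WeightedL1

/-! ### Pointwise bounds under limits in L¹(d) -/

namespace RegKernel

variable {X : Type} [MeasurableSpace X] {μ : Measure X} [SFinite μ]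
variable {k : X → X → ℝ≥0} {d : X → ℝ≥0} {N : ℕ} {C : ℝ≥0} (h : RegKernel μ k d N C)
include h

/-- T is bounded on L¹(d): by symmetry it can be moved onto d, where T d ≤ D d. -/
theorem lintegral_kernelOp_mul_d_le {D : ℝ≥0}
    (hD : ∀ᵐ x ∂μ, kernelOp μ k (fun y => d y) x ≤ D * d x) (f : X →ₘ[μ] ℝ) :
    ∫⁻ x, kernelOp μ k (fun y => ‖f y‖ₑ) x * d x ∂μ ≤ D * weightedNorm d f := by
  rw [lintegral_kernelOp_mul h.meas h.symm (measurable_enorm_Lp f) h.measurable_d, weightedNorm,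
    ← lintegral_const_mul' _ _ ENNReal.coe_ne_top]
  refine lintegral_mono_ae (hD.mono fun x hx => ?_)
  calc _ ≤ ‖f x‖ₑ * (D * d x) := by gcongr
    _ = _ := by ring

/-- A pointwise bound by the integral operator passes to limits in `L¹(d)`. -/
theorem enorm_le_of_approx (hμ : μ ≠ 0) {f u : X →ₘ[μ] ℝ} {c K : ℝ≥0}
    (happ : ∀ ε : ℝ≥0, 0 < ε → ∃ f' u' : X →ₘ[μ] ℝ, weightedNorm d (f - f') ≤ ε ∧
      weightedNorm d (u - u') ≤ K * ε ∧
      ∀ᵐ x ∂μ, ‖u' x‖ₑ ≤ c * kernelOp μ k (fun y => ‖f' y‖ₑ) x) :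
    ∀ᵐ x ∂μ, ‖u x‖ₑ ≤ c * kernelOp μ k (fun y => ‖f y‖ₑ) x := by
  obtain ⟨D, hD⟩ := h.exists_kernelOp_d_le hμ
  have hmk := fun f : X →ₘ[μ] ℝ => measurable_kernelOp (μ := μ) h.meas (measurable_enorm_Lp f)
  have hmd := h.measurable_d
  have hmu := measurable_enorm_Lp u
  have hmf := hmk f
  -- Subtraction in [0,∞] is truncated, so Q is the positive part of |u| - c·T|f|, weighted by d.
  -- Boundedness of T on L¹(d) gives ∫Q ≤ (K + cD)ε for every ε > 0, so Q vanishes.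
  set Q : X → ℝ≥0∞ := fun x => (‖u x‖ₑ - c * kernelOp μ k (fun y => ‖f y‖ₑ) x) * d x with hQ
  have hQm : Measurable Q := (hmu.sub (hmf.const_mul _)).mul hmd
  have hQ0 : ∫⁻ x, Q x ∂μ = 0 := by
    have hb : ∀ ε : ℝ≥0, 0 < ε → ∫⁻ x, Q x ∂μ ≤ (K + c * D : ℝ≥0) * ε := by
      intro ε hε
      obtain ⟨f', u', h1, h2, h3⟩ := happ ε hε
      calc ∫⁻ x, Q x ∂μ
          ≤ ∫⁻ x, ‖(u - u') x‖ₑ * d x +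
              c * (kernelOp μ k (fun y => ‖(f - f') y‖ₑ) x * d x) ∂μ := by
            refine lintegral_mono_ae ?_
            have hf' : ∀ᵐ y ∂μ, ‖f' y‖ₑ ≤ ‖f y‖ₑ + ‖(f - f') y‖ₑ := by
              filter_upwards [AEEqFun.coeFn_sub f f'] with y hy
              rw [hy, Pi.sub_apply]
              calc ‖f' y‖ₑ = ‖f y - (f y - f' y)‖ₑ := by rw [sub_sub_cancel]
                _ ≤ _ := enorm_sub_le
            filter_upwards [h3, AEEqFun.coeFn_sub u u'] with x hx3 hx
            rw [← mul_assoc, ← add_mul]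
            refine mul_le_mul_left ?_ _
            rw [tsub_le_iff_right]
            have e1 : ‖u x‖ₑ ≤ ‖(u - u') x‖ₑ + ‖u' x‖ₑ := by
              rw [hx, Pi.sub_apply]
              calc ‖u x‖ₑ = ‖(u x - u' x) + u' x‖ₑ := by rw [sub_add_cancel]
                _ ≤ _ := enorm_add_le _ _
            have e2 : kernelOp μ k (fun y => ‖f' y‖ₑ) x ≤
                kernelOp μ k (fun y => ‖f y‖ₑ) x + kernelOp μ k (fun y => ‖(f - f') y‖ₑ) x := by
              refine (kernelOp_mono (k := k) hf' x).trans (le_of_eq ?_)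
              unfold kernelOp
              rw [← lintegral_add_left (measurable_kernel_mul h.meas (measurable_enorm_Lp f) x)]
              exact lintegral_congr fun y => mul_add _ _ _
            calc ‖u x‖ₑ ≤ ‖(u - u') x‖ₑ + ‖u' x‖ₑ := e1
              _ ≤ ‖(u - u') x‖ₑ + c * (kernelOp μ k (fun y => ‖f y‖ₑ) x +
                  kernelOp μ k (fun y => ‖(f - f') y‖ₑ) x) := by
                gcongr
                exact hx3.trans (by gcongr)
              _ = _ := by ring
        _ = weightedNorm d (u - u') +
              c * ∫⁻ x, kernelOp μ k (fun y => ‖(f - f') y‖ₑ) x * d x ∂μ := by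
            rw [lintegral_add_left (measurable_enorm_mul h.d_meas _),
              lintegral_const_mul' _ _ ENNReal.coe_ne_top, weightedNorm]
        _ ≤ K * ε + c * (D * ε) := by
            gcongr
            exact (h.lintegral_kernelOp_mul_d_le hD _).trans (by gcongr)
        _ = _ := by push_cast; ring
    by_contra hne
    set P : ℝ≥0 := K + c * D + 1 with hP
    have hP0 : 0 < P := by positivity
    have hI : ∫⁻ x, Q x ∂μ ≠ ∞ := ne_top_of_le_ne_top (by finiteness) (hb 1 one_pos)
    set q := (∫⁻ x, Q x ∂μ).toNNReal with hq
    have hqe : ∫⁻ x, Q x ∂μ = q := (ENNReal.coe_toNNReal hI).symm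
    have hq0 : 0 < q := by
      rw [hqe] at hne
      exact pos_iff_ne_zero.mpr fun h0 => hne (by rw [h0]; rfl)
    have := hb (q / P) (by positivity)
    rw [hqe] at this
    norm_cast at this
    have h4 : (K + c * D) * (q / P) < q := by
      rw [← mul_div_assoc, div_lt_iff₀ hP0, mul_comm]
      gcongr
      exact lt_add_one _
    exact absurd this (not_le.mpr h4)
  rw [lintegral_eq_zero_iff hQm] at hQ0
  filter_upwards [hQ0, h.d_pos] with x hx hd
  simp only [hQ, Pi.zero_apply, mul_eq_zero, ENNReal.coe_eq_zero, hd.ne', or_false] at hx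
  exact tsub_eq_zero_iff_le.mp hx

end RegKernel

end NonlocalEig
end

/-! ### The inverse of 𝓛, eigenbases, and weak solutions in L¹(δ^γ) -/

noncomputable section

namespace NonlocalEig

variable {n : ℕ} {Ω : Set (Space n)} {s γ κ : ℝ}

/-- The weight `δ^γ` with values in `ℝ≥0`. -/
def bweight (Ω : Set (Space n)) (γ : ℝ) (x : Space n) : ℝ≥0 := (bdist Ω x ^ γ).toNNReal

/-- The kernel of `A` agrees almost everywhere with a regularizing kernel `k`. -/
structure GreenOperator.Regular (A : GreenOperator Ω s γ κ) (k : Space n → Space n → ℝ≥0) (N : ℕ)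
    (C : ℝ≥0) : Prop where
  reg : RegKernel (volume.restrict Ω) k (bweight Ω γ) N C
  ae_eq : ∀ᵐ x ∂(volume.restrict Ω), ∀ᵐ y ∂(volume.restrict Ω), A.kernel x y = k x y

namespace GreenOperator.Regular

variable {A : GreenOperator Ω s γ κ} {k : Space n → Space n → ℝ≥0} {N : ℕ} {C : ℝ≥0}
  (h : A.Regular k N C)
include h

theorem graph_iff (u f : L2 Ω) : (u, f) ∈ A.L.graph ↔ u = h.reg.opL2 f := by
  rw [A.green, Lp.ext_iff]
  have h1 : ∀ᵐ x ∂(volume.restrict Ω), ∫ y in Ω, A.kernel x y * f y = h.reg.opL2 f x := by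
    filter_upwards [h.ae_eq, h.reg.opL2_coe f] with x hx hx2
    rw [hx2]
    exact integral_congr_ae (hx.mono fun y hy => by simp only [hy])
  exact ⟨fun hu => by filter_upwards [hu, h1] with x hx hx2; rw [hx, hx2],
    fun hu => by filter_upwards [hu, h1] with x hx hx2; rw [hx, hx2]⟩

/-- For u = T f this is ⟨u, 𝓛u⟩ ≥ 0. -/
theorem inner_nonneg (f : L2 Ω) : 0 ≤ ⟪h.reg.opL2 f, f⟫ := by
  have h1 := (h.graph_iff (h.reg.opL2 f) f).mpr rfl
  obtain ⟨y, hy1, hy2⟩ := (LinearPMap.mem_graph_iff _).mp h1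
  have := A.L_nonneg y
  simp only at hy1 hy2
  rw [hy1, hy2] at this
  rwa [real_inner_comm]

/-- If T f = 0, then f = 𝓛0 = 0. -/
theorem injective (f : L2 Ω) (hf : h.reg.opL2 f = 0) : f = 0 := by
  have h1 := (h.graph_iff 0 f).mpr hf.symm
  obtain ⟨y, hy1, hy2⟩ := (LinearPMap.mem_graph_iff _).mp h1
  have : y = 0 := Subtype.ext hy1
  rw [this, LinearPMap.map_zero] at hy2
  exact hy2.symm

/-- Inverting the eigenvalue equation gives T(λφ) = φ ≠ 0, which excludes λ = 0; the sign comes from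
T ≥ 0. -/
theorem eigen_aux (B : Eigenbasis A) (j : ℕ) :
    0 < B.val j ∧ h.reg.opL2 (B.fn j) = (B.val j)⁻¹ • B.fn j := by
  have h1 := (h.graph_iff _ _).mp (B.eigen j)
  rw [map_smul] at h1
  have hn : ‖B.fn j‖ = 1 := B.fn.orthonormal.1 j
  have h0 : B.val j ≠ 0 := by
    intro h0
    rw [h0, zero_smul] at h1
    rw [h1, norm_zero] at hn
    exact zero_ne_one hn
  have h2 : h.reg.opL2 (B.fn j) = (B.val j)⁻¹ • B.fn j := by
    conv_rhs => rw [h1]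
    rw [smul_smul, inv_mul_cancel₀ h0, one_smul]
  refine ⟨lt_of_le_of_ne ?_ h0.symm, h2⟩
  have h3 := h.inner_nonneg (B.fn j)
  rw [h2, real_inner_smul_left, real_inner_self_eq_norm_sq, hn] at h3
  simpa using h3

theorem nonempty_eigenbasis (hinf : ¬ FiniteDimensional ℝ (L2 Ω)) : Nonempty (Eigenbasis A) := by
  obtain ⟨K, hK⟩ := h.reg.exists_sum_norm_sq_le 0
  obtain ⟨b, val, hmono, hpos, heig⟩ := exists_eigenbasis hinf h.reg.isCompactOperator_opL2
    h.reg.inner_opL2 h.inner_nonneg h.injective _ K hK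
  refine ⟨⟨val, b, hmono, fun j => (h.graph_iff _ _).mpr ?_⟩⟩
  rw [map_smul, heig, smul_smul, mul_inv_cancel₀ (hpos j).ne', one_smul]

theorem tendsto_val (B : Eigenbasis A) : Tendsto B.val atTop atTop := by
  obtain ⟨K, hK⟩ := h.reg.exists_sum_norm_sq_le 0
  refine tendsto_atTop_atTop_of_monotone B.mono fun c => ?_
  by_contra hc
  push Not at hc
  have := finite_setOf_eigenvalue_le (m := N + 1 + 0) B.fn.orthonormal (hK B.fn.orthonormal)
    (fun j => (h.eigen_aux B j).1) (fun j => (h.eigen_aux B j).2) c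
  exact infinite_univ (this.subset fun j _ => (hc j).le)

variable (B : Eigenbasis A) {lam : ℝ}

/-- The infimum of the empty set in ℕ is 0, so nonemptiness is the point. Without a jump from some
index with eigenvalue at least λ onwards, the eigenvalues would stay bounded. -/
theorem index_spec (lam : ℝ) :
    lam ≤ B.val (B.index lam) ∧ B.val (B.index lam) < B.val (B.index lam + 1) := by
  have hne : {j | lam ≤ B.val j ∧ B.val j < B.val (j + 1)}.Nonempty := by
    by_contra hemp
    rw [not_nonempty_iff_eq_empty, eq_empty_iff_forall_notMem] at hemp
    simp only [mem_ofPred_eq, not_and, not_lt] at hemp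
    obtain ⟨j₀, hj₀⟩ := ((tendsto_atTop.mp (h.tendsto_val B)) lam).exists
    have hb : ∀ i, B.val (j₀ + i) ≤ B.val j₀ := by
      intro i
      induction i with
      | zero => rfl
      | succ i ih =>
        exact (hemp (j₀ + i) (hj₀.trans (B.mono (Nat.le_add_right _ _)))).trans ih
    obtain ⟨j₁, hj₁, hj₁'⟩ := (((tendsto_atTop.mp (h.tendsto_val B)) (B.val j₀ + 1)).and
      (eventually_ge_atTop j₀)).exists
    have := hb (j₁ - j₀)
    rw [Nat.add_sub_cancel' hj₁'] at this
    linarith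
  exact Nat.sInf_mem hne

theorem exists_dist_pos (hlam : lam ∉ Set.range B.val) :
    ∃ c : ℝ≥0, 0 < c ∧ ∀ j, (c : ℝ) ≤ |B.val j - lam| := by
  obtain ⟨J, hJ⟩ := ((tendsto_atTop.mp (h.tendsto_val B)) (lam + 1)).exists
  have hne : ∀ j, 0 < |B.val j - lam| := fun j =>
    abs_pos.mpr (sub_ne_zero.mpr fun hj => hlam ⟨j, hj⟩)
  obtain ⟨i, -, hi⟩ := (Finset.range (J + 1)).exists_min_image (fun j => |B.val j - lam|)
    ⟨0, by simp⟩
  -- Beyond J all eigenvalues exceed λ by at least 1; among the finitely many others i is a nearest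
  -- one to λ.
  refine ⟨(min 1 |B.val i - lam|).toNNReal, by simpa using sub_ne_zero.mpr fun hj => hlam ⟨i, hj⟩,
    fun j => ?_⟩
  rw [Real.coe_toNNReal _ (le_min zero_le_one (abs_nonneg _))]
  rcases le_or_gt j J with hj | hj
  · exact (min_le_right _ _).trans (hi j (by simpa using Nat.lt_succ_of_le hj))
  · refine (min_le_left _ _).trans (le_trans ?_ (le_abs_self _))
    have := B.mono hj.le
    linarith

omit h in
theorem ne_of_notMem (hlam : lam ∉ Set.range B.val) (j : ℕ) : B.val j ≠ lam :=
  fun hj => hlam ⟨j, hj⟩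

omit h in
theorem exists_bound_of_normLinf {w : Space n → ℝ≥0∞} {ψ : Fn Ω} (hw : ∀ᵐ x ∂(volume.restrict Ω),
    w x ≠ 0 ∧ w x ≠ ∞) : ∀ᵐ x ∂(volume.restrict Ω), ‖ψ x‖ₑ ≤ normLinf w ψ * w x := by
  filter_upwards [hw, ae_le_essSup (f := fun x => ‖ψ x‖ₑ / w x) (μ := volume.restrict Ω)]
    with x hx hx2
  exact (ENNReal.div_le_iff hx.1 hx.2).mp hx2

omit h in
theorem normLinf_le_of_bound {w : Space n → ℝ≥0∞} {ψ : Fn Ω} {c : ℝ≥0∞}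
    (hψ : ∀ᵐ x ∂(volume.restrict Ω), ‖ψ x‖ₑ ≤ c * w x) : normLinf w ψ ≤ c :=
  essSup_le_of_ae_le _ (hψ.mono fun _ hx => ENNReal.div_le_of_le_mul hx)

theorem exists_bound {ψ : Fn Ω} (hψ : normLinf (powWeight Ω γ) ψ < ∞) :
    ∃ D : ℝ≥0, ∀ᵐ x ∂(volume.restrict Ω), ‖ψ x‖ₑ ≤ D * bweight Ω γ x := by
  refine ⟨(normLinf (powWeight Ω γ) ψ).toNNReal, ?_⟩
  rw [ENNReal.coe_toNNReal hψ.ne]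
  refine exists_bound_of_normLinf ?_
  filter_upwards [h.reg.d_pos] with x hx
  exact ⟨(ENNReal.coe_pos.mpr hx).ne', ENNReal.coe_ne_top⟩

/-- Since φ_j = λ_j^(N+1) T^(N+1) φ_j, the eigenfunction inherits the boundary decay produced by
T^(N+1). This makes φ_j an admissible test function and its pairing continuous on L¹(δ^γ). -/
theorem exists_eigenfunction_bound (j : ℕ) :
    ∃ D : ℝ≥0, ∀ᵐ x ∂(volume.restrict Ω), ‖B.fn j x‖ₑ ≤ D * bweight Ω γ x := by
  have hpow : ∀ m : ℕ, (h.reg.opL2 ^ m) (B.fn j) = (B.val j)⁻¹ ^ m • B.fn j := by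
    intro m
    induction m with
    | zero => simp
    | succ m ih =>
      rw [pow_succ', mul_apply_eq_comp, ih, map_smul, (h.eigen_aux B j).2, smul_smul, ← pow_succ]
  have e1 : B.fn j = (h.reg.opL2 ^ (N + 1)) (B.val j ^ (N + 1) • B.fn j) := by
    rw [map_smul, hpow, smul_smul, ← mul_pow, mul_inv_cancel₀ (h.eigen_aux B j).1.ne', one_pow,
      one_smul]
  refine ⟨C ^ 3 * (‖B.val j ^ (N + 1) • B.fn j‖ₑ).toNNReal, ?_⟩
  filter_upwards [h.reg.enorm_opL2_pow_succ_le_norm (B.val j ^ (N + 1) • B.fn j)] with x hx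
  rw [← e1] at hx
  refine hx.trans (le_of_eq ?_)
  rw [ENNReal.coe_mul, ENNReal.coe_toNNReal enorm_ne_top]
  push_cast
  ring

theorem weightedNorm_L2_lt_top (f : L2 Ω) : weightedNorm (bweight Ω γ) (f : Fn Ω) < ∞ :=
  (h.reg.lintegral_enorm_mul_d_le f).trans_lt (by finiteness)

/-- Domination on all of L², with a constant that degenerates as λ approaches the spectrum. It
serves to construct 𝔾_λ on L¹(δ^γ), not for the uniform estimates. -/
theorem exists_spectralSol_bound (hlam : lam ∉ Set.range B.val) :
    ∃ K : ℝ≥0, ∀ f : L2 Ω, ∀ᵐ x ∂(volume.restrict Ω),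
      ‖B.spectralSol lam f x‖ₑ ≤ K * kernelOp (volume.restrict Ω) k (fun y => ‖f y‖ₑ) x := by
  obtain ⟨c, hc, hc'⟩ := h.exists_dist_pos B hlam
  exact ⟨_, fun f => h.reg.enorm_resolvent_le (M := ‖lam‖₊) (fun j => (h.eigen_aux B j).2)
    (fun j => (h.eigen_aux B j).1) (ne_of_notMem B hlam) le_rfl hc (fun j => Or.inr (hc' j))⟩

/-- `𝔾_λ` preserves `δ^γ L^∞`. -/
theorem exists_spectralSol_bound_of_le (hμ : (volume.restrict Ω : Measure (Space n)) ≠ 0)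
    (hlam : lam ∉ Set.range B.val) {ψ : L2 Ω} {D : ℝ≥0}
    (hψ : ∀ᵐ x ∂(volume.restrict Ω), ‖ψ x‖ₑ ≤ D * bweight Ω γ x) :
    ∃ D' : ℝ≥0, ∀ᵐ x ∂(volume.restrict Ω), ‖B.spectralSol lam ψ x‖ₑ ≤ D' * bweight Ω γ x := by
  obtain ⟨K, hK⟩ := h.exists_spectralSol_bound B hlam
  obtain ⟨E, hE⟩ := h.reg.exists_kernelOp_d_le hμ
  refine ⟨K * (D * E), ?_⟩
  filter_upwards [hK ψ, hE] with x hx hx2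
  have h1 := kernelOp_mono (k := k) hψ x
  rw [kernelOp_const_mul h.reg.meas h.reg.measurable_d] at h1
  have h2 := h1.trans (mul_le_mul_right hx2 _)
  calc _ ≤ _ := hx
    _ ≤ K * (D * (E * bweight Ω γ x)) := by
      gcongr
    _ = _ := by push_cast; ring

theorem exists_weightedNorm_spectralSol_le (hμ : (volume.restrict Ω : Measure (Space n)) ≠ 0)
    (hlam : lam ∉ Set.range B.val) :
    ∃ K : ℝ≥0, ∀ f : L2 Ω, weightedNorm (bweight Ω γ) (B.spectralSol lam f : Fn Ω) ≤
      K * weightedNorm (bweight Ω γ) (f : Fn Ω) := by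
  obtain ⟨K, hK⟩ := h.exists_spectralSol_bound B hlam
  obtain ⟨E, hE⟩ := h.reg.exists_kernelOp_d_le hμ
  refine ⟨K * E, fun f => (weightedNorm_mono (hK f)).trans ?_⟩
  have : ∀ x, K * kernelOp (volume.restrict Ω) k (fun y => ‖f y‖ₑ) x * (bweight Ω γ x : ℝ≥0∞) =
      K * (kernelOp (volume.restrict Ω) k (fun y => ‖f y‖ₑ) x * bweight Ω γ x) :=
    fun x => mul_assoc _ _ _
  simp only [this]
  rw [lintegral_const_mul' _ _ ENNReal.coe_ne_top, ENNReal.coe_mul, mul_assoc]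
  gcongr
  exact h.reg.lintegral_kernelOp_mul_d_le hE _

omit h in
theorem pair_eq_inner (f g : L2 Ω) : pair (f : Fn Ω) (g : Fn Ω) = ⟪f, g⟫ := by
  rw [L2.inner_def]
  exact integral_congr_ae (ae_of_all _ fun x => by simp [mul_comm])

theorem spectralSol_add_smul (hlam : lam ∉ Set.range B.val) (c : ℝ) (f g : L2 Ω) :
    B.spectralSol lam (c • f + g) = c • B.spectralSol lam f + B.spectralSol lam g := by
  obtain ⟨r, hr, hr'⟩ := h.exists_dist_pos B hlam
  exact resolvent_add_smul (b := B.fn) hr hr' c f g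

theorem inner_spectralSol_comm (hlam : lam ∉ Set.range B.val) (f g : L2 Ω) :
    ⟪B.spectralSol lam f, g⟫ = ⟪f, B.spectralSol lam g⟫ := by
  obtain ⟨r, hr, hr'⟩ := h.exists_dist_pos B hlam
  exact inner_resolvent_comm (b := B.fn) hr hr' f g

theorem inner_fn_spectralSol (hlam : lam ∉ Set.range B.val) (f : L2 Ω) (j : ℕ) :
    ⟪B.fn j, B.spectralSol lam f⟫ = ⟪B.fn j, f⟫ / (B.val j - lam) := by
  obtain ⟨r, hr, hr'⟩ := h.exists_dist_pos B hlam
  exact inner_resolvent (b := B.fn) hr (fun j => Or.inr (hr' j)) j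

theorem eq_of_isWeakSol {f u v : Fn Ω} (hu : B.IsWeakSol lam f u)
    (hv : B.IsWeakSol lam f v) : u = v := by
  have := h.reg.isFiniteMeasure
  rw [← sub_eq_zero]
  refine eq_zero_of_forall_integral_mul_eq_zero h.reg.d_meas h.reg.d_pos h.reg.d_le
    (weightedNorm_sub_lt_top h.reg.d_meas hu.1 hv.1) fun ψ hψ => ?_
  have hψ1 : ∀ᵐ x ∂(volume.restrict Ω), ‖ψ x‖ₑ ≤ (1 : ℝ≥0) * bweight Ω γ x := by simpa using hψ
  have hψ2 : normLinf (powWeight Ω γ) (ψ : Fn Ω) < ∞ :=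
    (normLinf_le_of_bound hψ1).trans_lt ENNReal.coe_lt_top
  rw [integral_sub_mul hu.1 hv.1 hψ1]
  exact sub_eq_zero.mpr ((hu.2 ψ hψ2).trans (hv.2 ψ hψ2).symm)

/-- The solution is the extension of the spectral operator by density; the second clause records
closeness to its values on L². The weak formulation is the limit of the symmetry of 𝔾_λ on L². -/
theorem exists_weakSol (hμ : (volume.restrict Ω : Measure (Space n)) ≠ 0)
    (hlam : lam ∉ Set.range B.val) :
    ∃ K : ℝ≥0, ∀ f : Fn Ω, weightedNorm (bweight Ω γ) f < ∞ → ∃ u, B.IsWeakSol lam f u ∧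
      ∀ g : L2 Ω, weightedNorm (bweight Ω γ) (u - (B.spectralSol lam g : Fn Ω)) ≤
        K * weightedNorm (bweight Ω γ) (f - (g : Fn Ω)) := by
  have := h.reg.isFiniteMeasure
  obtain ⟨K, hK⟩ := h.exists_weightedNorm_spectralSol_le B hμ hlam
  have hadd := h.spectralSol_add_smul B hlam
  have h0 : B.spectralSol lam 0 = 0 := by
    have := hadd 1 0 0
    simpa using this
  let G : L2 Ω →ₗ[ℝ] L2 Ω :=
    { toFun := B.spectralSol lam
      map_add' := fun f g => by simpa using hadd 1 f g
      map_smul' := fun c f => by simpa [h0] using hadd c f 0 }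
  refine ⟨K, fun f hf => ?_⟩
  obtain ⟨u, hu1, hu2⟩ := exists_extension h.reg.d_meas h.reg.d_pos h.reg.d_le G hK hf
  refine ⟨u, ⟨hu1, fun ψ hψ => ?_⟩, hu2⟩
  obtain ⟨D, hD⟩ := h.exists_bound hψ
  obtain ⟨D', hD'⟩ := h.exists_spectralSol_bound_of_le B hμ hlam hD
  rw [← sub_eq_zero, ← enorm_eq_zero]
  by_contra hne
  set q := ‖pair u (ψ : Fn Ω) - pair f (B.spectralSol lam ψ : Fn Ω)‖ₑ with hq
  have hD0 : (D * K + D' + 1 : ℝ≥0∞) ≠ 0 := by simp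
  have hDt : (D * K + D' + 1 : ℝ≥0∞) ≠ ∞ := by finiteness
  -- With f approximated this closely by g ∈ L², the two pairings differ from those for g by at most
  -- DK·ε and D'·ε, and those for g agree. The defect q would then be less than itself.
  have hε : 0 < q / (D * K + D' + 1) := ENNReal.div_pos hne hDt
  obtain ⟨g, hg⟩ := exists_L2_weightedNorm_sub_lt h.reg.d_meas hf hε
  have e1 : pair u (ψ : Fn Ω) - pair (B.spectralSol lam g : Fn Ω) (ψ : Fn Ω) =
      ∫ x in Ω, (u - (B.spectralSol lam g : Fn Ω)) x * ψ x :=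
    (integral_sub_mul hu1 (h.weightedNorm_L2_lt_top _) hD).symm
  have e2 : pair f (B.spectralSol lam ψ : Fn Ω) - pair (g : Fn Ω) (B.spectralSol lam ψ : Fn Ω) =
      ∫ x in Ω, (f - (g : Fn Ω)) x * B.spectralSol lam ψ x :=
    (integral_sub_mul hf (h.weightedNorm_L2_lt_top _) hD').symm
  have e3 : pair (B.spectralSol lam g : Fn Ω) (ψ : Fn Ω) =
      pair (g : Fn Ω) (B.spectralSol lam ψ : Fn Ω) := by
    rw [pair_eq_inner, pair_eq_inner, h.inner_spectralSol_comm B hlam]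
  have e4 : q ≤ D * (K * (q / (D * K + D' + 1))) + D' * (q / (D * K + D' + 1)) := by
    have : pair u (ψ : Fn Ω) - pair f (B.spectralSol lam ψ : Fn Ω) =
        (∫ x in Ω, (u - (B.spectralSol lam g : Fn Ω)) x * ψ x) -
          ∫ x in Ω, (f - (g : Fn Ω)) x * B.spectralSol lam ψ x := by
      rw [← e1, ← e2, e3]
      ring
    refine (congrArg enorm this).le.trans ?_
    refine enorm_sub_le.trans (add_le_add ?_ ?_)
    · refine (enorm_integral_mul_le hD).trans ?_
      gcongr
      exact (hu2 g).trans (by gcongr)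
    · refine (enorm_integral_mul_le hD').trans ?_
      gcongr
  have hqt : q ≠ ∞ := enorm_ne_top
  have e5 : D * (K * (q / (D * K + D' + 1))) + D' * (q / (D * K + D' + 1)) < q := by
    have hpos : q / (D * K + D' + 1) ≠ ∞ := ENNReal.div_ne_top hqt hD0
    calc D * (K * (q / (D * K + D' + 1))) + D' * (q / (D * K + D' + 1))
        < D * (K * (q / (D * K + D' + 1))) + D' * (q / (D * K + D' + 1)) +
            q / (D * K + D' + 1) := ENNReal.lt_add_right (by finiteness) hε.ne'
      _ = (D * K + D' + 1) * (q / (D * K + D' + 1)) := by ring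
      _ = q := ENNReal.mul_div_cancel hD0 hDt
  exact absurd e4 (not_le.mpr e5)

theorem isWeakSol_solOp (hμ : (volume.restrict Ω : Measure (Space n)) ≠ 0)
    (hlam : lam ∉ Set.range B.val) {f : Fn Ω} (hf : weightedNorm (bweight Ω γ) f < ∞) :
    B.IsWeakSol lam f (B.solOp lam f) := by
  obtain ⟨K, hK⟩ := h.exists_weakSol B hμ hlam
  have hex : ∃ u, B.IsWeakSol lam f u := (hK f hf).imp fun u hu => hu.1
  rw [Eigenbasis.solOp, dif_pos hex]
  exact hex.choose_spec

/-- `solOp` is an arbitrary choice of weak solution; uniqueness identifies it with the extension by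
density. -/
theorem exists_solOp_bound (hμ : (volume.restrict Ω : Measure (Space n)) ≠ 0)
    (hlam : lam ∉ Set.range B.val) :
    ∃ K : ℝ≥0, ∀ f : Fn Ω, weightedNorm (bweight Ω γ) f < ∞ →
      ∀ g : L2 Ω, weightedNorm (bweight Ω γ) (B.solOp lam f - (B.spectralSol lam g : Fn Ω)) ≤
        K * weightedNorm (bweight Ω γ) (f - (g : Fn Ω)) := by
  obtain ⟨K, hK⟩ := h.exists_weakSol B hμ hlam
  refine ⟨K, fun f hf g => ?_⟩
  obtain ⟨u, hu, hu2⟩ := hK f hf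
  rw [h.eq_of_isWeakSol B (h.isWeakSol_solOp B hμ hlam hf) hu]
  exact hu2 g

theorem solOp_L2 (hμ : (volume.restrict Ω : Measure (Space n)) ≠ 0)
    (hlam : lam ∉ Set.range B.val) (f : L2 Ω) :
    B.solOp lam (f : Fn Ω) = (B.spectralSol lam f : Fn Ω) := by
  have hf := h.weightedNorm_L2_lt_top f
  refine h.eq_of_isWeakSol B (h.isWeakSol_solOp B hμ hlam hf)
    ⟨h.weightedNorm_L2_lt_top _, fun ψ _ => ?_⟩
  rw [pair_eq_inner, pair_eq_inner, h.inner_spectralSol_comm B hlam]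

theorem wellDefined (hμ : (volume.restrict Ω : Measure (Space n)) ≠ 0)
    (hlam : lam ∉ Set.range B.val) : B.WellDefined lam where
  isWeakSol f hf := h.isWeakSol_solOp B hμ hlam hf
  unique f u hf hu := h.eq_of_isWeakSol B hu (h.isWeakSol_solOp B hμ hlam hf)
  linear c f g hf hg := by
    have hdm : Measurable (bweight Ω γ) := h.reg.d_meas
    have hsm : ∀ u : Fn Ω, weightedNorm (bweight Ω γ) u < ∞ →
        weightedNorm (bweight Ω γ) (c • u) < ∞ := fun u hu => by
      rw [weightedNorm_smul hdm]
      exact ENNReal.mul_lt_top enorm_lt_top hu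
    have hadd : ∀ u v : Fn Ω, weightedNorm (bweight Ω γ) u < ∞ →
        weightedNorm (bweight Ω γ) v < ∞ → weightedNorm (bweight Ω γ) (c • u + v) < ∞ :=
      fun u v hu hv => (weightedNorm_add_le hdm _ _).trans_lt (ENNReal.add_lt_top.mpr ⟨hsm u hu, hv⟩)
    have hpair : ∀ (u v : Fn Ω), weightedNorm (bweight Ω γ) u < ∞ →
        weightedNorm (bweight Ω γ) v < ∞ → ∀ (ψ : Fn Ω) (D : ℝ≥0),
        (∀ᵐ x ∂(volume.restrict Ω), ‖ψ x‖ₑ ≤ D * bweight Ω γ x) →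
        pair (c • u + v) ψ = c * pair u ψ + pair v ψ := by
      intro u v hu hv ψ D hD
      have h1 := integrable_mul_of_le hu hD
      have h2 := integrable_mul_of_le hv hD
      unfold pair
      rw [← integral_const_mul, ← integral_add (h1.const_mul c) h2]
      refine integral_congr_ae ?_
      filter_upwards [AEEqFun.coeFn_add (c • u) v, AEEqFun.coeFn_smul c u] with x hx hx2
      simp only [hx, Pi.add_apply, hx2, Pi.smul_apply, smul_eq_mul]
      ring
    have hwf := h.isWeakSol_solOp B hμ hlam hf
    have hwg := h.isWeakSol_solOp B hμ hlam hg
    refine h.eq_of_isWeakSol B (h.isWeakSol_solOp B hμ hlam (hadd _ _ hf hg))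
      ⟨hadd _ _ hwf.1 hwg.1, fun ψ hψ => ?_⟩
    obtain ⟨D, hD⟩ := h.exists_bound hψ
    obtain ⟨D', hD'⟩ := h.exists_spectralSol_bound_of_le B hμ hlam hD
    rw [hpair _ _ hwf.1 hwg.1 _ D hD, hpair _ _ hf hg _ D' hD', hwf.2 ψ hψ, hwg.2 ψ hψ]
  bounded := by
    obtain ⟨K, hK⟩ := h.exists_solOp_bound B hμ hlam
    refine ⟨K, fun f hf => ?_⟩
    have h1 := hK f hf 0
    have h0 : B.spectralSol lam 0 = 0 := by
      have := h.spectralSol_add_smul B hlam 1 0 0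
      simpa using this
    rw [h0] at h1
    have h2 : ((0 : L2 Ω) : Fn Ω) = 0 := rfl
    rw [h2, sub_zero, sub_zero] at h1
    exact h1
  extends_spectral f := h.solOp_L2 B hμ hlam f

end GreenOperator.Regular

end NonlocalEig
end

/-! ### The spaces E^⊥ and Ẽ^⊥; weighted and ℍ² mapping properties -/

noncomputable section

namespace NonlocalEig

variable {n : ℕ} {Ω : Set (Space n)} {s γ κ : ℝ}

theorem measurable_bdist : Measurable (bdist Ω) := (Metric.continuous_infDist_pt _).measurable

theorem measurable_powWeight (α : ℝ) : Measurable (powWeight Ω α) :=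
  (measurable_bdist.pow_const α).ennreal_ofReal

namespace GreenOperator.Regular

variable {A : GreenOperator Ω s γ κ} {k : Space n → Space n → ℝ≥0} {N : ℕ} {C : ℝ≥0}
  (h : A.Regular k N C) (B : Eigenbasis A) {lam : ℝ}
include h

omit h in
theorem mem_perp_iff {f : Fn Ω} :
    f ∈ B.perp lam ↔ ∃ g : L2 Ω, (∀ j ≤ B.index lam, ⟪B.fn j, g⟫ = 0) ∧ (g : Fn Ω) = f := by
  refine exists_congr fun g => and_congr_left fun _ => ?_
  rw [Submodule.mem_orthogonal]
  constructor
  · exact fun hg j hj => hg _ (Submodule.subset_span ⟨j, hj, rfl⟩)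
  · intro hg u hu
    refine Submodule.span_induction (p := fun u _ => ⟪u, g⟫ = 0) ?_ (inner_zero_left _)
      (fun x y _ _ hx hy => by rw [inner_add_left, hx, hy, add_zero])
      (fun c x _ hx => by rw [real_inner_smul_left, hx, mul_zero]) hu
    rintro _ ⟨j, hj, rfl⟩
    exact hg j hj

theorem perp_subset_perpTilde : B.perp lam ⊆ B.perpTilde lam := by
  intro f hf
  obtain ⟨g, hg, rfl⟩ := (mem_perp_iff B).mp hf
  refine ⟨h.weightedNorm_L2_lt_top g, fun j hj => ?_⟩
  rw [pair_eq_inner, real_inner_comm, hg j hj]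

/-- Approximate f by g ∈ L² and subtract the projection Q of g onto E. The coefficients of Q are
small because f annihilates φ_j, so that ⟨g, φ_j⟩ = -∫(f-g)φ_j; the constant S absorbs this
correction. -/
theorem exists_perp_near {f : Fn Ω} (hf : f ∈ B.perpTilde lam) {ε : ℝ≥0∞} (hε : 0 < ε) :
    ∃ g : L2 Ω, (∀ j ≤ B.index lam, ⟪B.fn j, g⟫ = 0) ∧
      weightedNorm (bweight Ω γ) (f - (g : Fn Ω)) < ε := by
  have := h.reg.isFiniteMeasure
  choose D hD using fun j => h.exists_eigenfunction_bound B j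
  set s := Finset.range (B.index lam + 1) with hs
  set S : ℝ≥0 := 1 + C ^ 2 * ∑ j ∈ s, D j with hS
  have hS0 : 0 < S := by positivity
  have hS1 : (S : ℝ≥0∞) ≠ 0 := by exact_mod_cast hS0.ne'
  obtain ⟨g, hg⟩ := exists_L2_weightedNorm_sub_lt h.reg.d_meas hf.1
    (ENNReal.div_pos hε.ne' (ENNReal.coe_ne_top (r := S)))
  set η := weightedNorm (bweight Ω γ) (f - (g : Fn Ω)) with hη
  have hc : ∀ j ∈ s, ‖⟪B.fn j, g⟫‖ₑ ≤ D j * η := by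
    intro j hj
    have hj' : j ≤ B.index lam := Nat.lt_succ_iff.mp (Finset.mem_range.mp hj)
    have e1 := integral_sub_mul hf.1 (h.weightedNorm_L2_lt_top g) (hD j)
    have e2 : ∫ x in Ω, f x * B.fn j x = 0 := hf.2 j hj'
    have e3 : ∫ x in Ω, g x * B.fn j x = ⟪B.fn j, g⟫ := by
      rw [real_inner_comm]
      exact pair_eq_inner g (B.fn j)
    rw [e2, e3, zero_sub] at e1
    rw [← enorm_neg, ← e1]
    exact enorm_integral_mul_le (hD j)
  set Q : L2 Ω := ∑ j ∈ s, ⟪B.fn j, g⟫ • B.fn j with hQ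
  refine ⟨g - Q, fun i hi => ?_, ?_⟩
  · have hi' : i ∈ s := Finset.mem_range.mpr (Nat.lt_succ_iff.mpr hi)
    rw [inner_sub_right, hQ, B.fn.orthonormal.inner_right_sum _ hi', sub_self]
  · have e1 : f - ((g - Q : L2 Ω) : Fn Ω) = (f - (g : Fn Ω)) + (Q : Fn Ω) := by
      have : ((g - Q : L2 Ω) : Fn Ω) = (g : Fn Ω) - (Q : Fn Ω) := rfl
      rw [this]
      abel
    have e2 : ‖Q‖ₑ ≤ (∑ j ∈ s, D j : ℝ≥0) * η := by
      rw [ENNReal.ofNNReal_finsetSum, Finset.sum_mul]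
      refine (enorm_sum_le _ _).trans (Finset.sum_le_sum fun j hj => ?_)
      rw [enorm_smul]
      have : ‖B.fn j‖ₑ = 1 := by
        rw [← ofReal_norm, B.fn.orthonormal.1 j, ENNReal.ofReal_one]
      rw [this, mul_one]
      exact hc j hj
    calc weightedNorm (bweight Ω γ) (f - ((g - Q : L2 Ω) : Fn Ω))
        ≤ η + (C : ℝ≥0∞) ^ 2 * ((∑ j ∈ s, D j : ℝ≥0) * η) := by
          rw [e1]
          refine (weightedNorm_add_le h.reg.d_meas _ _).trans ?_
          gcongr
          exact (h.reg.lintegral_enorm_mul_d_le Q).trans (mul_le_mul_right e2 _)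
      _ = S * η := by
          rw [hS]
          push_cast
          ring
      _ < S * (ε / S) := (ENNReal.mul_lt_mul_iff_right hS1 ENNReal.coe_ne_top).mpr hg
      _ = ε := ENNReal.mul_div_cancel hS1 ENNReal.coe_ne_top

/-- Ẽ^⊥ is the closure of E^⊥: density is `exists_perp_near`, and closedness holds because pairing
with φ_j is continuous on L¹(δ^γ). -/
theorem mem_perpTilde_iff {f : Fn Ω} :
    f ∈ B.perpTilde lam ↔ ∀ ε > (0 : ℝ≥0∞), ∃ g ∈ B.perp lam,
      normL1 (powWeight Ω γ) (f - g) < ε := by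
  constructor
  · intro hf ε hε
    obtain ⟨g, hg, hg2⟩ := h.exists_perp_near B hf hε
    exact ⟨g, (mem_perp_iff B).mpr ⟨g, hg, rfl⟩, hg2⟩
  · intro hf
    have hfin : weightedNorm (bweight Ω γ) f < ∞ := by
      obtain ⟨g, hg, hg2⟩ := hf 1 one_pos
      refine (weightedNorm_le_add_sub h.reg.d_meas f g).trans_lt (ENNReal.add_lt_top.mpr ⟨?_, ?_⟩)
      · exact lt_of_lt_of_le hg2 le_top
      · exact (h.perp_subset_perpTilde B hg).1
    refine ⟨hfin, fun j hj => ?_⟩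
    obtain ⟨D, hD⟩ := h.exists_eigenfunction_bound B j
    rw [← enorm_eq_zero]
    by_contra hne
    have hD0 : ((D : ℝ≥0∞) + 1) ≠ 0 := by simp
    have hDt : ((D : ℝ≥0∞) + 1) ≠ ∞ := by finiteness
    obtain ⟨g, hg, hg2⟩ := hf _ (ENNReal.div_pos hne hDt)
    have hg' := h.perp_subset_perpTilde B hg
    have e1 := integral_sub_mul hfin hg'.1 (hD)
    have e2 : ∫ x in Ω, g x * B.fn j x = 0 := hg'.2 j hj
    rw [e2, sub_zero] at e1
    set q := ‖pair f (B.fn j : Fn Ω)‖ₑ with hq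
    have e3 : q ≤ D * (q / (D + 1)) := by
      rw [hq]
      refine (congrArg enorm e1).symm.le.trans ((enorm_integral_mul_le hD).trans ?_)
      exact mul_le_mul_right hg2.le _
    have hqt : q ≠ ∞ := enorm_ne_top
    have hpos : q / (D + 1) ≠ ∞ := ENNReal.div_ne_top hqt hD0
    have e4 : D * (q / (D + 1)) < q := by
      calc D * (q / (D + 1)) < D * (q / (D + 1)) + q / (D + 1) :=
            ENNReal.lt_add_right (by finiteness) (ENNReal.div_pos hne hDt).ne'
        _ = (D + 1) * (q / (D + 1)) := by ring
        _ = q := ENNReal.mul_div_cancel hD0 hDt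
    exact absurd e3 (not_le.mpr e4)

variable (hμ : (volume.restrict Ω : Measure (Space n)) ≠ 0)
include hμ

/-- Use φ_j as test function: 𝔾_λ φ_j is a multiple of φ_j, which f annihilates. -/
theorem solOp_mem_perpTilde (hlam : lam ∉ Set.range B.val) {f : Fn Ω} (hf : f ∈ B.perpTilde lam) :
    B.solOp lam f ∈ B.perpTilde lam := by
  have hw := h.isWeakSol_solOp B hμ hlam hf.1
  refine ⟨hw.1, fun j hj => ?_⟩
  obtain ⟨D, hD⟩ := h.exists_eigenfunction_bound B j
  rw [hw.2 (B.fn j) ((normLinf_le_of_bound hD).trans_lt ENNReal.coe_lt_top)]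
  have e1 : B.spectralSol lam (B.fn j) = (B.val j - lam)⁻¹ • B.fn j := by
    refine ext_inner_hilbertBasis B.fn fun i => ?_
    rw [h.inner_fn_spectralSol B hlam, real_inner_smul_right]
    by_cases hij : i = j
    · rw [hij, div_eq_inv_mul]
    · rw [B.fn.orthonormal.2 hij, mul_zero, zero_div]
  rw [e1]
  have e2 : pair f (((B.val j - lam)⁻¹ • B.fn j : L2 Ω) : Fn Ω) =
      (B.val j - lam)⁻¹ * pair f (B.fn j : Fn Ω) := by
    unfold pair
    rw [← integral_const_mul]
    refine integral_congr_ae ?_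
    filter_upwards [Lp.coeFn_smul (B.val j - lam)⁻¹ (B.fn j)] with x hx
    rw [hx, Pi.smul_apply, smul_eq_mul]
    ring
  rw [e2, hf.2 j hj, mul_zero]

theorem solOp_mem_perp (hlam : lam ∉ Set.range B.val) {f : Fn Ω} (hf : f ∈ B.perp lam) :
    B.solOp lam f ∈ B.perp lam := by
  obtain ⟨g, hg, rfl⟩ := (mem_perp_iff B).mp hf
  rw [h.solOp_L2 B hμ hlam]
  refine (mem_perp_iff B).mpr ⟨_, fun j hj => ?_, rfl⟩
  rw [h.inner_fn_spectralSol B hlam, hg j hj, zero_div]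

omit hμ in
theorem lt_of_gap {M g : ℝ} (hgap : B.Gap M g lam) : lam < M := by
  have h1 := h.index_spec B lam
  have h2 : B.val (B.index lam + 1) ≤ M := hgap.2.1
  linarith

omit hμ in
theorem gap_le {M g : ℝ} (hgap : B.Gap M g lam) {j : ℕ} (hj : B.index lam < j) :
    g ≤ B.val j - lam := by
  have h1 := h.index_spec B lam
  have h2 : g ≤ B.val (B.index lam + 1) - B.val (B.index lam) := hgap.2.2
  have h3 : B.val (B.index lam + 1) ≤ B.val j := B.mono hj
  linarith

/-- The solution operator on the orthogonal complement is dominated by `𝔾₀`, uniformly. -/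
theorem enorm_solOp_le {M g : ℝ} (hg : 0 < g) (hgap : B.Gap M g lam) (hM : -M ≤ lam) {f : Fn Ω}
    (hf : f ∈ B.perpTilde lam) :
    ∀ᵐ x ∂(volume.restrict Ω), ‖B.solOp lam f x‖ₑ ≤
      RegKernel.resolventConst N C M.toNNReal g.toNNReal *
        kernelOp (volume.restrict Ω) k (fun y => ‖f y‖ₑ) x := by
  -- K may blow up near the spectrum, but it only governs the convergence of the approximants and
  -- does not enter the final constant.
  obtain ⟨K, hK⟩ := h.exists_solOp_bound B hμ hgap.1
  refine h.reg.enorm_le_of_approx hμ (K := K) fun ε hε => ?_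
  obtain ⟨f', hf', hf'2⟩ := h.exists_perp_near B hf (ENNReal.coe_pos.mpr hε)
  refine ⟨f', B.spectralSol lam f', hf'2.le, (hK f hf.1 f').trans (by gcongr), ?_⟩
  -- The approximant lies in E^⊥: its coefficients up to I vanish, and the later eigenvalues are at
  -- least g above λ. Together with |λ| ≤ M this is all that the constant sees.
  refine h.reg.enorm_resolvent_le (fun j => (h.eigen_aux B j).2) (fun j => (h.eigen_aux B j).1)
    (ne_of_notMem B hgap.1) ?_ (by simpa using hg) fun j => ?_
  · exact (abs_le.mpr ⟨hM, (h.lt_of_gap B hgap).le⟩).trans (Real.le_coe_toNNReal M)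
  · rcases le_or_gt j (B.index lam) with hj | hj
    · exact Or.inl (hf' j hj)
    · rw [Real.coe_toNNReal _ hg.le]
      exact Or.inr ((h.gap_le B hgap hj).trans (le_abs_self _))

omit hμ in
theorem weight_eq (α : ℝ) : ∀ᵐ x ∂(volume.restrict Ω),
    A.weight α x = kernelOp (volume.restrict Ω) k (powWeight Ω α) x := by
  filter_upwards [h.ae_eq] with x hx
  refine lintegral_congr_ae (hx.mono fun y hy => ?_)
  simp only
  rw [hy, ENNReal.ofReal_coe_nnreal]

/-- Duality: ∫ T|f| δ^α = ∫ |f| T(δ^α), and T(δ^α) is the weight of the source space. -/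
theorem maps_weightedL1 (α : ℝ) {M g : ℝ} (hg : 0 < g) (hgap : B.Gap M g lam) (hM : -M ≤ lam) :
    B.Maps lam (RegKernel.resolventConst N C M.toNNReal g.toNNReal) (normL1 (A.weight α))
      (B.perpTilde lam) (normL1 (powWeight Ω α)) (B.perpTilde lam) := by
  intro f hf _
  refine ⟨h.solOp_mem_perpTilde B hμ hgap.1 hf, ?_⟩
  have hw := measurable_powWeight (Ω := Ω) α
  calc normL1 (powWeight Ω α) (B.solOp lam f)
      ≤ ∫⁻ x in Ω, RegKernel.resolventConst N C M.toNNReal g.toNNReal *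
          (kernelOp (volume.restrict Ω) k (fun y => ‖f y‖ₑ) x * powWeight Ω α x) := by
        refine lintegral_mono_ae ((h.enorm_solOp_le B hμ hg hgap hM hf).mono fun x hx => ?_)
        rw [← mul_assoc]
        gcongr
    _ = _ := by
        rw [lintegral_const_mul' _ _ ENNReal.coe_ne_top,
          lintegral_kernelOp_mul h.reg.meas h.reg.symm (measurable_enorm_Lp f) hw]
        congr 1
        refine lintegral_congr_ae ((h.weight_eq α).mono fun x hx => ?_)
        simp only
        rw [hx]

/-- Monotonicity: |f| ≤ c·δ^α implies T|f| ≤ c·T(δ^α). -/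
theorem maps_weightedLinf (hb : ∀ᵐ x ∂(volume.restrict Ω), 0 < bdist Ω x) (α : ℝ) {M g : ℝ}
    (hg : 0 < g) (hgap : B.Gap M g lam) (hM : -M ≤ lam) :
    B.Maps lam (RegKernel.resolventConst N C M.toNNReal g.toNNReal) (normLinf (powWeight Ω α))
      (B.perp lam) (normLinf (A.weight α)) (B.perp lam) := by
  intro f hf _
  refine ⟨h.solOp_mem_perp B hμ hgap.1 hf, normLinf_le_of_bound ?_⟩
  have hfb : ∀ᵐ x ∂(volume.restrict Ω), ‖f x‖ₑ ≤ normLinf (powWeight Ω α) f * powWeight Ω α x := by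
    refine exists_bound_of_normLinf (hb.mono fun x hx => ⟨?_, ENNReal.ofReal_ne_top⟩)
    exact (ENNReal.ofReal_pos.mpr (Real.rpow_pos_of_pos hx α)).ne'
  have h1 := kernelOp_mono (k := k) hfb
  rw [kernelOp_const_mul h.reg.meas (measurable_powWeight α)] at h1
  filter_upwards [h.enorm_solOp_le B hμ hg hgap hM (h.perp_subset_perpTilde B hf), h.weight_eq α]
    with x hx hx2
  rw [hx2, mul_assoc]
  exact hx.trans (mul_le_mul_right (h1 x) _)

/-- On the surviving modes λ_j/(λ_j-λ) = 1 + λ/(λ_j-λ) ≤ 1 + |M|/g. Only λ < M matters, as a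
negative λ makes the ratio smaller. -/
theorem maps_H2 {M g : ℝ} (hg : 0 < g) (hgap : B.Gap M g lam) :
    B.Maps lam (1 + |M| / g).toNNReal (normLp 2) (B.perp lam) B.normH2 (B.perp lam) := by
  intro f hf _
  refine ⟨h.solOp_mem_perp B hμ hgap.1 hf, ?_⟩
  obtain ⟨u, hu, rfl⟩ := (mem_perp_iff B).mp hf
  rw [h.solOp_L2 B hμ hgap.1]
  set c := 1 + |M| / g with hc
  have hc0 : 0 ≤ c := by positivity
  have hterm : ∀ j, B.val j ^ 2 * pair (B.spectralSol lam u : Fn Ω) (B.fn j : Fn Ω) ^ 2 ≤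
      c ^ 2 * ⟪B.fn j, u⟫ ^ 2 := by
    intro j
    rw [pair_eq_inner, real_inner_comm, h.inner_fn_spectralSol B hgap.1]
    rcases le_or_gt j (B.index lam) with hj | hj
    · rw [hu j hj]
      simp
    · have h1 := h.gap_le B hgap hj
      have h2 : 0 < B.val j - lam := hg.trans_le h1
      have h3 := (h.eigen_aux B j).1
      have h4 : B.val j / (B.val j - lam) ≤ c := by
        rw [div_le_iff₀ h2, hc, add_mul, one_mul]
        have h5 : |M| ≤ |M| / g * (B.val j - lam) := by
          rw [div_mul_eq_mul_div, le_div_iff₀ hg]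
          gcongr
        have h6 := (h.lt_of_gap B hgap).le.trans (le_abs_self M)
        linarith
      calc B.val j ^ 2 * (⟪B.fn j, u⟫ / (B.val j - lam)) ^ 2
          = (B.val j / (B.val j - lam)) ^ 2 * ⟪B.fn j, u⟫ ^ 2 := by ring
        _ ≤ c ^ 2 * ⟪B.fn j, u⟫ ^ 2 := by gcongr
  have hs := (hasSum_inner_sq B.fn u).mul_left (c ^ 2)
  have hbound : ∑' j, ENNReal.ofReal (B.val j ^ 2 *
      pair (B.spectralSol lam u : Fn Ω) (B.fn j : Fn Ω) ^ 2) ≤ ENNReal.ofReal (c * ‖u‖) ^ (2 : ℝ) := by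
    calc _ ≤ ∑' j, ENNReal.ofReal (c ^ 2 * ⟪B.fn j, u⟫ ^ 2) :=
          ENNReal.tsum_le_tsum fun j => ENNReal.ofReal_le_ofReal (hterm j)
      _ = ENNReal.ofReal (c ^ 2 * ‖u‖ ^ 2) := by
          rw [← hs.tsum_eq, ENNReal.ofReal_tsum_of_nonneg (fun j => by positivity) hs.summable]
      _ = _ := by
          rw [← mul_pow, ENNReal.ofReal_pow (by positivity), ENNReal.rpow_ofNat]
  calc B.normH2 (B.spectralSol lam u : Fn Ω)
      ≤ (ENNReal.ofReal (c * ‖u‖) ^ (2 : ℝ)) ^ (1 / 2 : ℝ) := by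
        unfold Eigenbasis.normH2
        gcongr
    _ = ENNReal.ofReal c * ‖u‖ₑ := by
        rw [← ENNReal.rpow_mul, mul_one_div_cancel two_ne_zero, ENNReal.rpow_one,
          ENNReal.ofReal_mul hc0, ofReal_norm]
    _ = _ := by rw [Lp.enorm_def]; rfl

end GreenOperator.Regular

end NonlocalEig
end

noncomputable section

namespace NonlocalEig

/-! ### Integrals of powers of the distance -/

section Riesz

variable {n : ℕ}

theorem nontrivial_space (hn : 1 ≤ n) : Nontrivial (Space n) := by
  have : Nonempty (Fin n) := ⟨⟨0, hn⟩⟩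
  infer_instance

theorem lintegral_dist_eq (F : ℝ → ℝ≥0∞) (x : Space n) :
    ∫⁻ y, F (dist x y) = ∫⁻ y : Space n, F ‖y‖ := by
  simp only [dist_eq_norm]
  exact lintegral_sub_left_eq_self (μ := (volume : Measure (Space n))) (fun y => F ‖y‖) x

/-- Polar coordinates for a non-negative radial function. -/
theorem lintegral_norm_eq (hn : 1 ≤ n) {f : ℝ → ℝ} (hf : ∀ r, 0 ≤ f r)
    (hi : IntegrableOn (fun r => r ^ (n - 1) * f r) (Ioi 0)) :
    ∫⁻ y : Space n, ENNReal.ofReal (f ‖y‖) =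
      ENNReal.ofReal (n * (volume.real (Metric.ball (0 : Space n) 1) *
        ∫ r in Ioi 0, r ^ (n - 1) * f r)) := by
  have := nontrivial_space hn
  have hfin : Module.finrank ℝ (Space n) = n := finrank_euclideanSpace_fin
  have h1 : Integrable (fun y : Space n => f ‖y‖) := by
    rw [integrable_fun_norm_addHaar, hfin]
    simpa using hi
  rw [← ofReal_integral_eq_lintegral_ofReal h1 (ae_of_all _ fun y => hf _),
    integral_fun_norm_addHaar, hfin]
  simp

theorem exists_lintegral_ball_le (hn : 1 ≤ n) {a : ℝ} (ha : a < n) :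
    ∃ R : ℝ≥0, ∀ (ρ : ℝ), 0 < ρ → ∀ x : Space n,
      ∫⁻ y, ENNReal.ofReal ((Iio ρ).indicator (fun t => t ^ (-a)) (dist x y)) ≤
        R * ENNReal.ofReal (ρ ^ (n - a)) := by
  set V := volume.real (Metric.ball (0 : Space n) 1)
  refine ⟨(n * (V * (n - a)⁻¹)).toNNReal, fun ρ hρ x => ?_⟩
  have ha' : -1 < (n : ℝ) - 1 - a := by linarith
  have hcongr : ∀ r ∈ Ioi (0 : ℝ), r ^ (n - 1) *
      (Iio ρ).indicator (fun t => |t| ^ (-a)) r =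
        (Iio ρ).indicator (fun t => t ^ ((n : ℝ) - 1 - a)) r := by
    intro r hr
    rw [mem_Ioi] at hr
    by_cases h : r ∈ Iio ρ
    · rw [indicator_of_mem h, indicator_of_mem h, abs_of_pos hr, ← Real.rpow_natCast,
        ← Real.rpow_add hr, Nat.cast_sub hn, Nat.cast_one]
      ring_nf
    · rw [indicator_of_notMem h, indicator_of_notMem h, mul_zero]
  have hI : IntegrableOn (fun t : ℝ => t ^ ((n : ℝ) - 1 - a)) (Ioo 0 ρ) :=
    (intervalIntegral.integrableOn_Ioo_rpow_iff hρ).mpr ha'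
  have hset : Ioi (0 : ℝ) ∩ Iio ρ = Ioo 0 ρ := Ioi_inter_Iio
  -- A real power of a negative base may be negative; |t| makes the radial function non-negative on
  -- the whole line, as the polar coordinate formula requires, without changing it on norms.
  have e1 : ∀ y : Space n, ENNReal.ofReal ((Iio ρ).indicator (fun t => t ^ (-a)) ‖y‖) =
      ENNReal.ofReal ((Iio ρ).indicator (fun t => |t| ^ (-a)) ‖y‖) := by
    intro y
    by_cases h : ‖y‖ ∈ Iio ρ
    · rw [indicator_of_mem h, indicator_of_mem h, abs_norm]
    · rw [indicator_of_notMem h, indicator_of_notMem h]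
  rw [lintegral_dist_eq (fun t => ENNReal.ofReal ((Iio ρ).indicator (fun t => t ^ (-a)) t)),
    lintegral_congr e1, lintegral_norm_eq hn (fun r => indicator_nonneg (fun t _ => by positivity) r)]
  · rw [setIntegral_congr_fun measurableSet_Ioi hcongr, setIntegral_indicator measurableSet_Iio,
      hset, ← integral_Ioc_eq_integral_Ioo, ← intervalIntegral.integral_of_le hρ.le,
      integral_rpow (Or.inl ha'), show (n : ℝ) - 1 - a + 1 = n - a by ring,
      Real.zero_rpow (by linarith), sub_zero]
    have hna : 0 < n - a := by linarith
    change _ ≤ ENNReal.ofReal _ * _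
    rw [← ENNReal.ofReal_mul (by positivity)]
    refine ENNReal.ofReal_le_ofReal (le_of_eq ?_)
    field_simp
    rfl
  · rw [integrableOn_congr_fun hcongr measurableSet_Ioi, IntegrableOn,
      integrable_indicator_iff measurableSet_Iio, IntegrableOn, Measure.restrict_restrict
      measurableSet_Iio, inter_comm, hset]
    exact hI

theorem exists_lintegral_compl_ball_le (hn : 1 ≤ n) {b : ℝ} (hb : n < b) :
    ∃ R : ℝ≥0, ∀ (ρ : ℝ), 0 < ρ → ∀ x : Space n,
      ∫⁻ y, ENNReal.ofReal ((Ici ρ).indicator (fun t => t ^ (-b)) (dist x y)) ≤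
        R * ENNReal.ofReal (ρ ^ (n - b)) := by
  set V := volume.real (Metric.ball (0 : Space n) 1)
  refine ⟨(n * (V * (b - n)⁻¹)).toNNReal, fun ρ hρ x => ?_⟩
  have hb' : (n : ℝ) - 1 - b < -1 := by linarith
  have hcongr : ∀ r ∈ Ioi (0 : ℝ), r ^ (n - 1) *
      (Ici ρ).indicator (fun t => |t| ^ (-b)) r =
        (Ici ρ).indicator (fun t => t ^ ((n : ℝ) - 1 - b)) r := by
    intro r hr
    rw [mem_Ioi] at hr
    by_cases h : r ∈ Ici ρ
    · rw [indicator_of_mem h, indicator_of_mem h, abs_of_pos hr, ← Real.rpow_natCast,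
        ← Real.rpow_add hr, Nat.cast_sub hn, Nat.cast_one]
      ring_nf
    · rw [indicator_of_notMem h, indicator_of_notMem h, mul_zero]
  have hI : IntegrableOn (fun t : ℝ => t ^ ((n : ℝ) - 1 - b)) (Ici ρ) := by
    rw [integrableOn_Ici_iff_integrableOn_Ioi]
    exact integrableOn_Ioi_rpow_of_lt hb' hρ
  have hset : Ioi (0 : ℝ) ∩ Ici ρ = Ici ρ :=
    inter_eq_right.mpr fun t ht => lt_of_lt_of_le hρ ht
  have e1 : ∀ y : Space n, ENNReal.ofReal ((Ici ρ).indicator (fun t => t ^ (-b)) ‖y‖) =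
      ENNReal.ofReal ((Ici ρ).indicator (fun t => |t| ^ (-b)) ‖y‖) := by
    intro y
    by_cases h : ‖y‖ ∈ Ici ρ
    · rw [indicator_of_mem h, indicator_of_mem h, abs_norm]
    · rw [indicator_of_notMem h, indicator_of_notMem h]
  rw [lintegral_dist_eq (fun t => ENNReal.ofReal ((Ici ρ).indicator (fun t => t ^ (-b)) t)),
    lintegral_congr e1, lintegral_norm_eq hn (fun r => indicator_nonneg (fun t _ => by positivity) r)]
  · rw [setIntegral_congr_fun measurableSet_Ioi hcongr, setIntegral_indicator measurableSet_Ici,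
      hset, integral_Ici_eq_integral_Ioi, integral_Ioi_rpow_of_lt hb' hρ,
      show (n : ℝ) - 1 - b + 1 = n - b by ring]
    have hnb : 0 < b - n := by linarith
    change _ ≤ ENNReal.ofReal _ * _
    rw [← ENNReal.ofReal_mul (by positivity)]
    refine ENNReal.ofReal_le_ofReal (le_of_eq ?_)
    rw [show (n : ℝ) - b = -(b - n) by ring, neg_div_neg_eq]
    field_simp
    rfl
  · rw [integrableOn_congr_fun hcongr measurableSet_Ioi, IntegrableOn,
      integrable_indicator_iff measurableSet_Ici, IntegrableOn, Measure.restrict_restrict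
      measurableSet_Ici, inter_comm, hset]
    exact hI

end Riesz

/-! ### The distance to the boundary of a bounded open set -/

section Geometry

variable {n : ℕ} {Ω : Set (Space n)}

theorem frontier_nonempty (hn : 1 ≤ n) (hΩ : IsC11 Ω) : (frontier Ω).Nonempty := by
  have := nontrivial_space hn
  rw [nonempty_frontier_iff]
  refine ⟨hΩ.nonempty, fun h => ?_⟩
  have hb := hΩ.bounded
  rw [h] at hb
  exact NormedSpace.unbounded_univ ℝ (Space n) hb

theorem bdist_pos (hn : 1 ≤ n) (hΩ : IsC11 Ω) {x : Space n} (hx : x ∈ Ω) : 0 < bdist Ω x := by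
  refine (isClosed_frontier.notMem_iff_infDist_pos (frontier_nonempty hn hΩ)).mp fun h => ?_
  rw [hΩ.isOpen.frontier_eq] at h
  exact h.2 hx

theorem bdist_le_add (x y : Space n) : bdist Ω x ≤ bdist Ω y + dist x y :=
  Metric.infDist_le_infDist_add_dist

theorem exists_diam_bound (hn : 1 ≤ n) (hΩ : IsC11 Ω) : ∃ D : ℝ, 1 ≤ D ∧
    (∀ x ∈ Ω, ∀ y ∈ Ω, dist x y < D) ∧ ∀ x ∈ Ω, bdist Ω x ≤ D := by
  obtain ⟨D, hD⟩ := (Metric.isBounded_iff.mp hΩ.bounded.closure)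
  obtain ⟨z, hz⟩ := frontier_nonempty hn hΩ
  refine ⟨max D 0 + 1, by linarith [le_max_right D 0], fun x hx y hy => ?_, fun x hx => ?_⟩
  · linarith [hD (subset_closure hx) (subset_closure hy), le_max_left D 0]
  · have := hD (subset_closure hx) (frontier_subset_closure hz)
    have h2 : bdist Ω x ≤ dist x z := Metric.infDist_le_dist_of_mem hz
    linarith [le_max_left D 0]

theorem restrict_ne_zero (hΩ : IsC11 Ω) : (volume.restrict Ω : Measure (Space n)) ≠ 0 := by
  rw [Ne, Measure.restrict_eq_zero]
  exact (hΩ.isOpen.measure_pos volume hΩ.nonempty).ne'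

/-- Indicators of infinitely many disjoint annuli around an interior point are orthogonal and
nonzero. -/
theorem not_finiteDimensional_L2 (hn : 1 ≤ n) (hΩ : IsC11 Ω) :
    ¬ FiniteDimensional ℝ (L2 Ω) := by
  intro hfd
  have := nontrivial_space hn
  obtain ⟨a, ha⟩ := hΩ.nonempty
  obtain ⟨r, hr, hball⟩ := Metric.isOpen_iff.mp hΩ.isOpen a ha
  obtain ⟨e, he⟩ := exists_norm_eq (Space n) zero_le_one
  let S : ℕ → Set (Space n) := fun j => Metric.ball a (r / (j + 1)) \ Metric.closedBall a (r / (j + 2))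
  have hSm : ∀ j, MeasurableSet (S j) := fun j =>
    Metric.isOpen_ball.measurableSet.diff Metric.isClosed_closedBall.measurableSet
  have hSfin : ∀ j, (volume.restrict Ω) (S j) ≠ ∞ := fun j =>
    ((Measure.restrict_apply_le _ _).trans_lt
      ((measure_mono sdiff_subset).trans_lt Metric.isBounded_ball.measure_lt_top)).ne
  have hSpos : ∀ j, (volume.restrict Ω) (S j) ≠ 0 := by
    intro j
    have hj : (0 : ℝ) < j + 1 := by positivity
    have hsub : S j ⊆ Ω := fun x hx => hball (Metric.ball_subset_ball
      (div_le_self hr.le (by linarith [Nat.cast_nonneg (α := ℝ) j])) hx.1)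
    rw [Measure.restrict_eq_self _ hsub]
    have ho : IsOpen (S j) := Metric.isOpen_ball.sdiff Metric.isClosed_closedBall
    refine (ho.measure_pos volume ?_).ne'
    obtain ⟨t, ht1, ht2⟩ := exists_between (show r / ((j : ℝ) + 2) < r / (j + 1) by
      gcongr
      linarith)
    have ht0 : 0 < t := lt_trans (by positivity) ht1
    have hd : dist (a + t • e) a = t := by
      rw [dist_eq_norm, add_sub_cancel_left, norm_smul, he, mul_one, Real.norm_of_nonneg ht0.le]
    refine ⟨a + t • e, ?_, ?_⟩
    · rw [Metric.mem_ball, hd]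
      exact ht2
    · rw [Metric.mem_closedBall, hd, not_le]
      exact ht1
  have hdisj : ∀ i j, i < j → S i ∩ S j = ∅ := by
    intro i j hij
    rw [eq_empty_iff_forall_notMem]
    rintro x ⟨hx1, hx2⟩
    have h1 := hx1.2
    have h2 := hx2.1
    rw [Metric.mem_closedBall, not_le] at h1
    rw [Metric.mem_ball] at h2
    have h3 : r / ((j : ℝ) + 1) ≤ r / (i + 2) := by
      have : ((i + 1 : ℕ) : ℝ) ≤ j := by exact_mod_cast hij
      push_cast at this
      exact div_le_div_of_nonneg_left hr.le (by positivity) (by linarith)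
    linarith
  let v : ℕ → L2 Ω := fun j => indicatorConstLp 2 (hSm j) (hSfin j) (1 : ℝ)
  have hinner : ∀ i j, ⟪v i, v j⟫ = (volume.restrict Ω).real (S i ∩ S j) := fun i j =>
    L2.real_inner_indicatorConstLp_one_indicatorConstLp_one (hSm i) (hSm j) (hSfin i) (hSfin j)
  have hli : LinearIndependent ℝ v := by
    refine linearIndependent_of_ne_zero_of_inner_eq_zero (fun j h0 => ?_) fun i j hij => ?_
    · have := hinner j j
      rw [h0, inner_zero_left, inter_self, eq_comm, measureReal_eq_zero_iff (hSfin j)] at this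
      exact hSpos j this
    · change ⟪v i, v j⟫ = 0
      rw [hinner]
      rcases lt_or_gt_of_ne hij with h | h
      · rw [hdisj i j h, measureReal_empty]
      · rw [inter_comm, hdisj j i h, measureReal_empty]
  have hfin : Finite ℕ := hli.finite
  exact Finite.false hfin

end Geometry

end NonlocalEig
end

noncomputable section

namespace NonlocalEig

/-! ### Pointwise inequalities for the comparison function -/

section Pointwise

theorem min_div_rpow {δ r γ : ℝ} (hδ : 0 ≤ δ) (hr : 0 < r) (hγ : 0 ≤ γ) :
    min (δ ^ γ / r ^ γ) 1 = min (δ / r) 1 ^ γ := by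
  rw [← Real.div_rpow hδ hr.le]
  rcases le_total (δ / r) 1 with h | h
  · rw [min_eq_left h, min_eq_left (Real.rpow_le_one (by positivity) h hγ)]
  · rw [min_eq_right h, min_eq_right (Real.one_le_rpow h hγ), Real.one_rpow]

/-- Since δz ≤ δy + b, the product δz·min(δy/b, 1) is at most 2δy, so the weight at z near x can be
traded for the weight at y; a ≥ r/2 then replaces a by r. The constant is 8 = 2·4. -/
theorem min_div_mul_three_le {δx δy δz a b r : ℝ} (hx : 0 < δx) (hy : 0 < δy) (hz : 0 < δz)
    (ha : 0 < a) (hb : 0 < b) (hr : 0 < r) (hra : r / 2 ≤ a) (hzy : δz ≤ δy + b) :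
    min (δx / a) 1 * min (δz / a) 1 * (min (δz / b) 1 * min (δy / b) 1) ≤
      8 * (min (δx / r) 1 * min (δy / r) 1) := by
  have h1 : min (δx / a) 1 ≤ 2 * min (δx / r) 1 := by
    rw [mul_min_of_nonneg _ _ zero_le_two]
    refine min_le_min ?_ (by norm_num)
    rw [← mul_div_assoc, div_le_div_iff₀ ha hr]
    nlinarith
  have h2 : min (δz / a) 1 * min (δy / b) 1 ≤ 4 * min (δy / r) 1 := by
    rw [mul_min_of_nonneg _ _ (by norm_num : (0 : ℝ) ≤ 4)]
    refine le_min ?_ ?_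
    · have h3 : δz * min (δy / b) 1 ≤ 2 * δy := by
        calc δz * min (δy / b) 1 ≤ (δy + b) * min (δy / b) 1 := by gcongr
          _ = δy * min (δy / b) 1 + b * min (δy / b) 1 := by ring
          _ ≤ δy * 1 + b * (δy / b) := by
            gcongr
            · exact min_le_right _ _
            · exact min_le_left _ _
          _ = 2 * δy := by
            field_simp
            ring
      calc min (δz / a) 1 * min (δy / b) 1 ≤ δz / a * min (δy / b) 1 := by
            gcongr
            exact min_le_left _ _
        _ = δz * min (δy / b) 1 / a := by ring
        _ ≤ 2 * δy / a := by gcongr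
        _ ≤ 4 * (δy / r) := by
            rw [← mul_div_assoc, div_le_div_iff₀ ha hr]
            nlinarith
    · have h4 : min (δz / a) 1 * min (δy / b) 1 ≤ 1 * 1 := by
        gcongr
        · exact min_le_right _ _
        · exact min_le_right _ _
      linarith
  calc min (δx / a) 1 * min (δz / a) 1 * (min (δz / b) 1 * min (δy / b) 1)
      = min (δx / a) 1 * (min (δz / a) 1 * min (δy / b) 1) * min (δz / b) 1 := by ring
    _ ≤ (2 * min (δx / r) 1) * (4 * min (δy / r) 1) * 1 := by
        gcongr
        exact min_le_right _ _
    _ = _ := by ring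

/-- The `3G` inequality, when the first distance dominates. -/
theorem three_G_of_le {δx δy δz a b r p γ : ℝ} (hx : 0 < δx) (hy : 0 < δy) (hz : 0 < δz)
    (ha : 0 < a) (hb : 0 < b) (hr : 0 < r) (hra : r / 2 ≤ a) (hzy : δz ≤ δy + b) (hp : 0 ≤ p)
    (hγ0 : 0 ≤ γ) (hγ1 : γ ≤ 1) :
    a ^ (-p) * min (δx ^ γ / a ^ γ) 1 * min (δz ^ γ / a ^ γ) 1 *
        (b ^ (-p) * min (δz ^ γ / b ^ γ) 1 * min (δy ^ γ / b ^ γ) 1) ≤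
      2 ^ p * 8 * (r ^ (-p) * min (δx ^ γ / r ^ γ) 1 * min (δy ^ γ / r ^ γ) 1) * b ^ (-p) := by
  simp only [min_div_rpow hx.le ha hγ0, min_div_rpow hz.le ha hγ0, min_div_rpow hz.le hb hγ0,
    min_div_rpow hy.le hb hγ0, min_div_rpow hx.le hr hγ0, min_div_rpow hy.le hr hγ0]
  have h1 : a ^ (-p) ≤ 2 ^ p * r ^ (-p) := by
    calc a ^ (-p) ≤ (r / 2) ^ (-p) :=
          Real.rpow_le_rpow_of_nonpos (by positivity) hra (by linarith)
      _ = 2 ^ p * r ^ (-p) := by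
          rw [Real.div_rpow hr.le zero_le_two, Real.rpow_neg zero_le_two, div_inv_eq_mul, mul_comm]
  have h2 := Real.rpow_le_rpow (by positivity)
    (min_div_mul_three_le hx hy hz ha hb hr hra hzy) hγ0
  have h8 : (8 : ℝ) ^ γ ≤ 8 := by
    calc (8 : ℝ) ^ γ ≤ 8 ^ (1 : ℝ) := Real.rpow_le_rpow_of_exponent_le (by norm_num) hγ1
      _ = 8 := Real.rpow_one _
  have h3 : min (δx / a) 1 ^ γ * min (δz / a) 1 ^ γ * (min (δz / b) 1 ^ γ * min (δy / b) 1 ^ γ) ≤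
      8 * (min (δx / r) 1 ^ γ * min (δy / r) 1 ^ γ) := by
    rw [← Real.mul_rpow (by positivity) (by positivity),
      ← Real.mul_rpow (by positivity) (by positivity),
      ← Real.mul_rpow (by positivity) (by positivity),
      ← Real.mul_rpow (by positivity) (by positivity)]
    refine h2.trans ?_
    rw [Real.mul_rpow (by norm_num) (by positivity)]
    gcongr
  calc _ = a ^ (-p) * (min (δx / a) 1 ^ γ * min (δz / a) 1 ^ γ *
        (min (δz / b) 1 ^ γ * min (δy / b) 1 ^ γ)) * b ^ (-p) := by ring
    _ ≤ 2 ^ p * r ^ (-p) * (8 * (min (δx / r) 1 ^ γ * min (δy / r) 1 ^ γ)) * b ^ (-p) := by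
        gcongr
    _ = _ := by ring

theorem rpow_neg_mul_rpow_neg_le {u v a b : ℝ} (hu : 0 < u) (hv : 0 < v) (ha : 0 ≤ a)
    (hb : 0 ≤ b) : u ^ (-a) * v ^ (-b) ≤ u ^ (-(a + b)) + v ^ (-(a + b)) := by
  have hu' : 0 < u ^ (-(a + b)) := by positivity
  have hv' : 0 < v ^ (-(a + b)) := by positivity
  rcases le_total u v with h | h
  · calc u ^ (-a) * v ^ (-b) ≤ u ^ (-a) * u ^ (-b) := by
          gcongr 1
          exact Real.rpow_le_rpow_of_nonpos hu h (by linarith)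
      _ = u ^ (-(a + b)) := by rw [← Real.rpow_add hu]; ring_nf
      _ ≤ _ := by linarith
  · calc u ^ (-a) * v ^ (-b) ≤ v ^ (-a) * v ^ (-b) := by
          gcongr 1
          exact Real.rpow_le_rpow_of_nonpos hv h (by linarith)
      _ = v ^ (-(a + b)) := by rw [← Real.rpow_add hv]; ring_nf
      _ ≤ _ := by linarith

/-- Composition of Riesz kernels, pointwise. -/
theorem riesz_mul_le {u v r a p c : ℝ} (hu : 0 < u) (hv : 0 < v) (hr : 0 < r) (hruv : r ≤ u + v)
    (hc : 0 ≤ c) (hca : c ≤ a) (hcp : c ≤ p) :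
    u ^ (-a) * v ^ (-p) ≤ 2 ^ c * r ^ (-c) * (u ^ (-(a - c + p)) + v ^ (-(a - c + p))) := by
  -- One of u, v is at least r/2. That factor gives up t^(-c) ≤ 2^c r^(-c), and the exponents that
  -- remain add up to a - c + p.
  have key : ∀ {t : ℝ}, 0 < t → r / 2 ≤ t → ∀ e, t ^ (-e) ≤ 2 ^ c * r ^ (-c) * t ^ (-(e - c)) := by
    intro t ht hrt e
    have h1 : t ^ (-c) ≤ 2 ^ c * r ^ (-c) := by
      calc t ^ (-c) ≤ (r / 2) ^ (-c) :=
            Real.rpow_le_rpow_of_nonpos (by positivity) hrt (by linarith)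
        _ = _ := by
            rw [Real.div_rpow hr.le zero_le_two, Real.rpow_neg zero_le_two, div_inv_eq_mul, mul_comm]
    calc t ^ (-e) = t ^ (-c) * t ^ (-(e - c)) := by rw [← Real.rpow_add ht]; ring_nf
      _ ≤ _ := by gcongr
  rcases le_total (r / 2) u with h | h
  · calc u ^ (-a) * v ^ (-p) ≤ 2 ^ c * r ^ (-c) * u ^ (-(a - c)) * v ^ (-p) := by
          gcongr
          exact key hu h a
      _ = 2 ^ c * r ^ (-c) * (u ^ (-(a - c)) * v ^ (-p)) := by ring
      _ ≤ _ := by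
          gcongr
          exact rpow_neg_mul_rpow_neg_le hu hv (by linarith) (by linarith)
  · have h' : r / 2 ≤ v := by linarith
    calc u ^ (-a) * v ^ (-p) ≤ u ^ (-a) * (2 ^ c * r ^ (-c) * v ^ (-(p - c))) := by
          gcongr
          exact key hv h' p
      _ = 2 ^ c * r ^ (-c) * (u ^ (-a) * v ^ (-(p - c))) := by ring
      _ ≤ _ := by
          gcongr
          have := rpow_neg_mul_rpow_neg_le hu hv (a := a) (b := p - c) (by linarith) (by linarith)
          rwa [show a + (p - c) = a - c + p by ring] at this

/-- The gain of decay at the boundary, pointwise. -/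
theorem boundary_gain_le {δx δz r γ β σ : ℝ} (hx : 0 < δx) (hz : 0 < δz) (hr : 0 < r)
    (hzx : δz ≤ δx + r) (hβ : 0 ≤ β) (hσ : 0 ≤ σ) (hβσ : β + σ ≤ γ) (hγ1 : γ ≤ 1) :
    min (δx ^ γ / r ^ γ) 1 * δz ^ β ≤ 2 * (δx ^ (β + σ) * r ^ (-σ)) := by
  have hγ0 : 0 ≤ γ := by linarith
  have h2 : (2 : ℝ) ^ β ≤ 2 := by
    calc (2 : ℝ) ^ β ≤ 2 ^ (1 : ℝ) := Real.rpow_le_rpow_of_exponent_le (by norm_num) (by linarith)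
      _ = 2 := Real.rpow_one _
  rw [min_div_rpow hx.le hr hγ0]
  -- If r ≤ δx, then δz ≤ 2δx and (δx/r)^σ ≥ 1. Otherwise δz ≤ 2r, and the minimum supplies
  -- (δx/r)^(β+σ) because β + σ ≤ γ.
  rcases le_total r δx with h | h
  · have h3 : δz ^ β ≤ 2 * δx ^ β := by
      calc δz ^ β ≤ (2 * δx) ^ β := Real.rpow_le_rpow hz.le (by linarith) hβ
        _ = 2 ^ β * δx ^ β := Real.mul_rpow zero_le_two hx.le
        _ ≤ _ := by gcongr
    have h4 : 1 ≤ δx ^ σ * r ^ (-σ) := by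
      rw [Real.rpow_neg hr.le, ← div_eq_mul_inv, ← Real.div_rpow hx.le hr.le]
      exact Real.one_le_rpow ((one_le_div hr).mpr h) hσ
    calc min (δx / r) 1 ^ γ * δz ^ β ≤ 1 * (2 * δx ^ β) := by
          gcongr
          exact Real.rpow_le_one (by positivity) (min_le_right _ _) hγ0
      _ ≤ 1 * (2 * δx ^ β) * (δx ^ σ * r ^ (-σ)) := le_mul_of_one_le_right (by positivity) h4
      _ = _ := by rw [Real.rpow_add hx]; ring
  · have h3 : δz ^ β ≤ 2 * r ^ β := by
      calc δz ^ β ≤ (2 * r) ^ β := Real.rpow_le_rpow hz.le (by linarith) hβ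
        _ = 2 ^ β * r ^ β := Real.mul_rpow zero_le_two hr.le
        _ ≤ _ := by gcongr
    have h4 : min (δx / r) 1 ^ γ ≤ (δx / r) ^ (β + σ) := by
      calc min (δx / r) 1 ^ γ ≤ (δx / r) ^ γ :=
            Real.rpow_le_rpow (by positivity) (min_le_left _ _) hγ0
        _ ≤ _ := Real.rpow_le_rpow_of_exponent_ge (by positivity) ((div_le_one hr).mpr h) hβσ
    calc min (δx / r) 1 ^ γ * δz ^ β ≤ (δx / r) ^ (β + σ) * (2 * r ^ β) := by gcongr
      _ = 2 * (δx ^ (β + σ) * (r ^ (-(β + σ)) * r ^ β)) := by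
          rw [Real.div_rpow hx.le hr.le, Real.rpow_neg hr.le]
          ring
      _ = _ := by
          rw [← Real.rpow_add hr]
          ring_nf

end Pointwise

/-! ### The Riesz kernel and the comparison kernel on `Ω` -/

section Kernels

variable {n : ℕ} {Ω : Set (Space n)} {s γ : ℝ}

/-- The Riesz kernel `|x-y|^(-a)`. -/
def rieszKernel (a : ℝ) (x y : Space n) : ℝ≥0 := (dist x y ^ (-a)).toNNReal

/-- The comparison function as a kernel. -/
def profileKernel (Ω : Set (Space n)) (s γ : ℝ) (x y : Space n) : ℝ≥0 := (profile Ω s γ x y).toNNReal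

theorem measurable_rieszKernel (a : ℝ) :
    Measurable (Function.uncurry (rieszKernel (n := n) a)) := by
  unfold rieszKernel Function.uncurry
  fun_prop

theorem measurable_profile : Measurable fun q : Space n × Space n => profile Ω s γ q.1 q.2 := by
  have := measurable_bdist (Ω := Ω)
  unfold profile
  fun_prop

theorem measurable_profileKernel : Measurable (Function.uncurry (profileKernel Ω s γ)) :=
  measurable_profile.real_toNNReal

theorem profile_nonneg (x y : Space n) : 0 ≤ profile Ω s γ x y := by
  have h : ∀ z, 0 ≤ bdist Ω z := fun z => Metric.infDist_nonneg
  have := h x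
  have := h y
  unfold profile
  positivity

theorem profile_le (x y : Space n) : profile Ω s γ x y ≤ dist x y ^ (-((n : ℝ) - 2 * s)) := by
  have h : ∀ z, 0 ≤ bdist Ω z := fun z => Metric.infDist_nonneg
  have := h x
  have := h y
  unfold profile
  calc _ ≤ dist x y ^ (-((n : ℝ) - 2 * s)) * 1 * 1 := by
        gcongr
        · exact min_le_right _ _
        · exact min_le_right _ _
    _ = _ := by ring

theorem profile_symm (x y : Space n) : profile Ω s γ x y = profile Ω s γ y x := by
  unfold profile
  rw [dist_comm]
  ring

theorem profileKernel_le_rieszKernel (x y : Space n) :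
    profileKernel Ω s γ x y ≤ rieszKernel ((n : ℝ) - 2 * s) x y :=
  Real.toNNReal_le_toNNReal (profile_le x y)

theorem ae_ne (hn : 1 ≤ n) (x : Space n) : ∀ᵐ y ∂(volume.restrict Ω), x ≠ y := by
  have := nontrivial_space hn
  refine ae_restrict_of_ae ?_
  filter_upwards [Measure.ae_ne volume x] with y hy using hy.symm

theorem ae_mem (hΩ : IsC11 Ω) : ∀ᵐ y ∂(volume.restrict Ω), y ∈ Ω :=
  ae_restrict_mem hΩ.isOpen.measurableSet

theorem rieszKernel_eq (a : ℝ) (x y : Space n) :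
    (rieszKernel a x y : ℝ≥0∞) = ENNReal.ofReal (dist x y ^ (-a)) := rfl

theorem rieszKernel_comm (a : ℝ) (x y : Space n) : rieszKernel a x y = rieszKernel a y x := by
  unfold rieszKernel
  rw [dist_comm]

theorem exists_lintegral_rieszKernel_le (hn : 1 ≤ n) (hΩ : IsC11 Ω) {a : ℝ} (ha : a < n) :
    ∃ R : ℝ≥0, ∀ x ∈ Ω, ∫⁻ y in Ω, rieszKernel a x y ≤ R := by
  obtain ⟨D, hD1, hD, -⟩ := exists_diam_bound hn hΩ
  obtain ⟨R, hR⟩ := exists_lintegral_ball_le hn ha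
  refine ⟨R * (D ^ (n - a)).toNNReal, fun x hx => ?_⟩
  refine le_trans ?_ (hR D (by linarith) x)
  refine le_trans (lintegral_mono_ae ?_) (setLIntegral_le_lintegral Ω _)
  filter_upwards [ae_mem hΩ] with y hy
  rw [indicator_of_mem (mem_Iio.mpr (hD x hx y hy)), rieszKernel_eq]

/-- Composition of integral operators. -/
theorem kernelOp_kernelOp {X : Type*} [MeasurableSpace X] {μ : Measure X} [SFinite μ]
    {k k' : X → X → ℝ≥0} (hk : Measurable (Function.uncurry k))
    (hk' : Measurable (Function.uncurry k')) {F : X → ℝ≥0∞} (hF : Measurable F) (x : X) :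
    kernelOp μ k (kernelOp μ k' F) x =
      ∫⁻ y, (∫⁻ z, (k x z : ℝ≥0∞) * k' z y ∂μ) * F y ∂μ := by
  have hkx : Measurable fun z => (k x z : ℝ≥0∞) := (hk.of_uncurry_left).coe_nnreal_ennreal
  have hk'e : Measurable fun q : X × X => (k' q.1 q.2 : ℝ≥0∞) := hk'.coe_nnreal_ennreal
  have h1 : ∀ z, (k x z : ℝ≥0∞) * kernelOp μ k' F z = ∫⁻ y, (k x z : ℝ≥0∞) * k' z y * F y ∂μ := by
    intro z
    unfold kernelOp
    rw [← lintegral_const_mul _ (measurable_kernel_mul hk' hF z)]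
    exact lintegral_congr fun y => (mul_assoc _ _ _).symm
  have h2 : ∀ y, (∫⁻ z, (k x z : ℝ≥0∞) * k' z y ∂μ) * F y =
      ∫⁻ z, (k x z : ℝ≥0∞) * k' z y * F y ∂μ := fun y =>
    (lintegral_mul_const _ (hkx.mul (hk'e.comp measurable_prodMk_right))).symm
  rw [kernelOp]
  simp only [h1, h2]
  refine lintegral_lintegral_swap ?_
  exact (((hkx.comp measurable_fst).mul hk'e).mul (hF.comp measurable_snd)).aemeasurable

/-- `3G` inequality for the comparison function. -/
theorem profile_three_G (hn : 1 ≤ n) (hΩ : IsC11 Ω) (hγ0 : 0 < γ) (hγ1 : γ ≤ 1)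
    (hp : 0 < (n : ℝ) - 2 * s) {x y z : Space n} (hx : x ∈ Ω) (hy : y ∈ Ω) (hz : z ∈ Ω)
    (hxy : x ≠ y) (hxz : x ≠ z) (hzy : z ≠ y) :
    profile Ω s γ x z * profile Ω s γ z y ≤ 2 ^ ((n : ℝ) - 2 * s) * 8 * profile Ω s γ x y *
      (dist x z ^ (-((n : ℝ) - 2 * s)) + dist z y ^ (-((n : ℝ) - 2 * s))) := by
  have dx := bdist_pos hn hΩ hx
  have dy := bdist_pos hn hΩ hy
  have dz := bdist_pos hn hΩ hz
  have ha := dist_pos.mpr hxz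
  have hb := dist_pos.mpr hzy
  have hr := dist_pos.mpr hxy
  have htri := dist_triangle x z y
  have hP := profile_nonneg (Ω := Ω) (s := s) (γ := γ) x y
  -- At least one of |x-z|, |z-y| is at least |x-y|/2; the second case is the first with x and y
  -- exchanged.
  rcases le_total (dist x y / 2) (dist x z) with h | h
  · have h1 := bdist_le_add (Ω := Ω) z y
    refine (three_G_of_le dx dy dz ha hb hr h h1 hp.le hγ0.le hγ1).trans ?_
    change 2 ^ ((n : ℝ) - 2 * s) * 8 * profile Ω s γ x y * _ ≤ _
    gcongr
    exact le_add_of_nonneg_left (by positivity)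
  · have h1 := bdist_le_add (Ω := Ω) z x
    rw [dist_comm z x] at h1
    have h2 : dist x y / 2 ≤ dist z y := by linarith
    have := three_G_of_le dy dx dz hb ha hr h2 h1 hp.le hγ0.le hγ1
    calc profile Ω s γ x z * profile Ω s γ z y
        = dist z y ^ (-((n : ℝ) - 2 * s)) * min (bdist Ω y ^ γ / dist z y ^ γ) 1 *
          min (bdist Ω z ^ γ / dist z y ^ γ) 1 * (dist x z ^ (-((n : ℝ) - 2 * s)) *
          min (bdist Ω z ^ γ / dist x z ^ γ) 1 * min (bdist Ω x ^ γ / dist x z ^ γ) 1) := by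
          unfold profile
          ring
      _ ≤ _ := this
      _ = 2 ^ ((n : ℝ) - 2 * s) * 8 * profile Ω s γ x y * dist x z ^ (-((n : ℝ) - 2 * s)) := by
          unfold profile
          ring
      _ ≤ _ := by
          gcongr
          exact le_add_of_nonneg_right (by positivity)

/-- The 3G inequality integrated in the intermediate point, where |x-z|^(-(n-2s)) has bounded
integral over Ω. -/
theorem exists_kernelOp_profile_comp_le (hn : 1 ≤ n) (hΩ : IsC11 Ω) (hs0 : 0 < s) (hγ0 : 0 < γ)
    (hγ1 : γ ≤ 1) (hp : 0 < (n : ℝ) - 2 * s) :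
    ∃ R : ℝ≥0, ∀ F : Space n → ℝ≥0∞, Measurable F → ∀ x ∈ Ω,
      kernelOp (volume.restrict Ω) (profileKernel Ω s γ)
        (kernelOp (volume.restrict Ω) (profileKernel Ω s γ) F) x ≤
      R * kernelOp (volume.restrict Ω) (profileKernel Ω s γ) F x := by
  obtain ⟨R, hR⟩ := exists_lintegral_rieszKernel_le hn hΩ (a := (n : ℝ) - 2 * s) (by linarith)
  refine ⟨(2 ^ ((n : ℝ) - 2 * s) * 8 : ℝ).toNNReal * (R + R), fun F hF x hx => ?_⟩
  have hmp := measurable_profileKernel (Ω := Ω) (s := s) (γ := γ)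
  rw [kernelOp_kernelOp hmp hmp hF]
  unfold kernelOp
  rw [← lintegral_const_mul' _ _ ENNReal.coe_ne_top]
  refine lintegral_mono_ae ?_
  filter_upwards [ae_mem hΩ, ae_ne hn x] with y hy hxy
  rw [← mul_assoc]
  gcongr
  set p := (n : ℝ) - 2 * s
  have hm1 : Measurable fun z : Space n => (rieszKernel p x z : ℝ≥0∞) :=
    ((measurable_rieszKernel p).of_uncurry_left).coe_nnreal_ennreal
  calc ∫⁻ z in Ω, (profileKernel Ω s γ x z : ℝ≥0∞) * profileKernel Ω s γ z y
      ≤ ∫⁻ z in Ω, (2 ^ p * 8 : ℝ).toNNReal * profileKernel Ω s γ x y *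
          ((rieszKernel p x z : ℝ≥0∞) + rieszKernel p y z) := by
        refine lintegral_mono_ae ?_
        filter_upwards [ae_mem hΩ, ae_ne hn x, ae_ne hn y] with z hz hxz hyz
        rw [rieszKernel_comm p y z]
        have h3 := Real.toNNReal_le_toNNReal
          (profile_three_G hn hΩ hγ0 hγ1 hp hx hy hz hxy hxz hyz.symm)
        rw [Real.toNNReal_mul (profile_nonneg _ _),
          Real.toNNReal_mul (mul_nonneg (by positivity) (profile_nonneg _ _)),
          Real.toNNReal_mul (by positivity), Real.toNNReal_add (by positivity) (by positivity)] at h3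
        exact_mod_cast h3
    _ = (2 ^ p * 8 : ℝ).toNNReal * profileKernel Ω s γ x y *
          ((∫⁻ z in Ω, (rieszKernel p x z : ℝ≥0∞)) + ∫⁻ z in Ω, (rieszKernel p y z : ℝ≥0∞)) := by
        rw [lintegral_const_mul' _ _ (by finiteness), lintegral_add_left hm1]
    _ ≤ (2 ^ p * 8 : ℝ).toNNReal * profileKernel Ω s γ x y * (R + R) := by
        gcongr
        · exact hR x hx
        · exact hR y hy
    _ = _ := by push_cast; ring

/-- Composition of Riesz operators. -/
theorem exists_kernelOp_riesz_comp_le (hn : 1 ≤ n) (hΩ : IsC11 Ω) (hs0 : 0 < s) {a c : ℝ}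
    (hc : 0 ≤ c) (hca : c ≤ a) (hcp : c ≤ (n : ℝ) - 2 * s) (hacs : a ≤ c + s) :
    ∃ R : ℝ≥0, ∀ F : Space n → ℝ≥0∞, Measurable F → ∀ x ∈ Ω,
      kernelOp (volume.restrict Ω) (rieszKernel a)
        (kernelOp (volume.restrict Ω) (rieszKernel ((n : ℝ) - 2 * s)) F) x ≤
      R * kernelOp (volume.restrict Ω) (rieszKernel c) F x := by
  set p := (n : ℝ) - 2 * s with hp
  -- Lowering the exponent by at most s, rather than by the full order 2s, keeps a - c + p ≤ n - s <
  -- n and avoids the borderline case.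
  obtain ⟨R, hR⟩ := exists_lintegral_rieszKernel_le hn hΩ (a := a - c + p) (by linarith)
  refine ⟨(2 ^ c : ℝ).toNNReal * (R + R), fun F hF x hx => ?_⟩
  rw [kernelOp_kernelOp (measurable_rieszKernel a) (measurable_rieszKernel p) hF]
  unfold kernelOp
  rw [← lintegral_const_mul' _ _ ENNReal.coe_ne_top]
  refine lintegral_mono_ae ?_
  filter_upwards [ae_mem hΩ, ae_ne hn x] with y hy hxy
  rw [← mul_assoc]
  gcongr
  set e := a - c + p
  have hm1 : Measurable fun z : Space n => (rieszKernel e x z : ℝ≥0∞) :=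
    ((measurable_rieszKernel e).of_uncurry_left).coe_nnreal_ennreal
  calc ∫⁻ z in Ω, (rieszKernel a x z : ℝ≥0∞) * rieszKernel p z y
      ≤ ∫⁻ z in Ω, (2 ^ c : ℝ).toNNReal * rieszKernel c x y *
          ((rieszKernel e x z : ℝ≥0∞) + rieszKernel e y z) := by
        refine lintegral_mono_ae ?_
        filter_upwards [ae_mem hΩ, ae_ne hn x, ae_ne hn y] with z hz hxz hyz
        rw [rieszKernel_comm e y z]
        have h3 := Real.toNNReal_le_toNNReal (riesz_mul_le (dist_pos.mpr hxz)
          (dist_pos.mpr hyz.symm) (dist_pos.mpr hxy) (dist_triangle x z y) hc hca hcp)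
        rw [Real.toNNReal_mul (by positivity), Real.toNNReal_mul (by positivity),
          Real.toNNReal_mul (by positivity), Real.toNNReal_add (by positivity) (by positivity)] at h3
        exact_mod_cast h3
    _ = (2 ^ c : ℝ).toNNReal * rieszKernel c x y *
          ((∫⁻ z in Ω, (rieszKernel e x z : ℝ≥0∞)) + ∫⁻ z in Ω, (rieszKernel e y z : ℝ≥0∞)) := by
        rw [lintegral_const_mul' _ _ (by finiteness), lintegral_add_left hm1]
    _ ≤ (2 ^ c : ℝ).toNNReal * rieszKernel c x y * (R + R) := by
        gcongr
        · exact hR x hx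
        · exact hR y hy
    _ = _ := by push_cast; ring

/-- Powers of the comparison operator are dominated by Riesz operators. -/
theorem exists_kernelOp_profile_iterate_le (hn : 1 ≤ n) (hΩ : IsC11 Ω) (hs0 : 0 < s)
    (hp : 0 < (n : ℝ) - 2 * s) (j : ℕ) :
    ∃ R : ℝ≥0, ∀ F : Space n → ℝ≥0∞, Measurable F → ∀ x ∈ Ω,
      (kernelOp (volume.restrict Ω) (profileKernel Ω s γ))^[j + 1] F x ≤
      R * kernelOp (volume.restrict Ω) (rieszKernel (max ((n : ℝ) - 2 * s - j * s) 0)) F x := by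
  set p := (n : ℝ) - 2 * s with hpdef
  have hle : ∀ F : Space n → ℝ≥0∞, kernelOp (volume.restrict Ω) (profileKernel Ω s γ) F ≤
      kernelOp (volume.restrict Ω) (rieszKernel p) F := fun F x => lintegral_mono fun y =>
    mul_le_mul_left (ENNReal.coe_le_coe.mpr (profileKernel_le_rieszKernel x y)) _
  induction j with
  | zero =>
    refine ⟨1, fun F _ x _ => ?_⟩
    rw [Nat.cast_zero, zero_mul, sub_zero, max_eq_left hp.le]
    simpa using hle F x
  | succ j ih =>
    obtain ⟨R, hR⟩ := ih
    obtain ⟨R', hR'⟩ := exists_kernelOp_riesz_comp_le hn hΩ hs0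
      (a := max (p - j * s) 0) (c := max (p - (j + 1 : ℕ) * s) 0) (le_max_right _ _)
      (max_le_max (by push_cast; linarith) le_rfl)
      (max_le (by push_cast; have : 0 ≤ (j : ℝ) * s := by positivity
                  linarith) hp.le)
      (max_le (by push_cast; linarith [le_max_left (p - (j + 1) * s) 0])
        (by linarith [le_max_right (p - (j + 1 : ℕ) * s) 0]))
    refine ⟨R * R', fun F hF x hx => ?_⟩
    rw [Function.iterate_succ_apply]
    calc _ ≤ R * kernelOp (volume.restrict Ω) (rieszKernel (max (p - j * s) 0))
            (kernelOp (volume.restrict Ω) (profileKernel Ω s γ) F) x :=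
          hR _ (measurable_kernelOp measurable_profileKernel hF) x hx
      _ ≤ R * kernelOp (volume.restrict Ω) (rieszKernel (max (p - j * s) 0))
            (kernelOp (volume.restrict Ω) (rieszKernel p) F) x := by
          gcongr
          exact kernelOp_mono (ae_of_all _ (hle F)) x
      _ ≤ R * (R' * _) := by gcongr; exact hR' F hF x hx
      _ = _ := by push_cast; ring

/-- The comparison operator gains decay at the boundary. -/
theorem exists_kernelOp_profile_rpow_le (hn : 1 ≤ n) (hΩ : IsC11 Ω) (hs0 : 0 < s)
    (hγ1 : γ ≤ 1) {β σ : ℝ} (hβ : 0 ≤ β) (hσ : 0 ≤ σ)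
    (hσs : σ ≤ s) (hβσ : β + σ ≤ γ) :
    ∃ R : ℝ≥0, ∀ x ∈ Ω, kernelOp (volume.restrict Ω) (profileKernel Ω s γ) (powWeight Ω β) x ≤
      R * powWeight Ω (β + σ) x := by
  set p := (n : ℝ) - 2 * s with hpdef
  -- The factor |x-z|^(-σ) paid for the gain is integrable against the kernel, as σ ≤ s gives p + σ
  -- ≤ n - s.
  obtain ⟨R, hR⟩ := exists_lintegral_rieszKernel_le hn hΩ (a := p + σ) (by linarith)
  refine ⟨2 * R, fun x hx => ?_⟩
  have hdx := bdist_pos hn hΩ hx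
  calc kernelOp (volume.restrict Ω) (profileKernel Ω s γ) (powWeight Ω β) x
      ≤ ∫⁻ z in Ω, 2 * powWeight Ω (β + σ) x * (rieszKernel (p + σ) x z : ℝ≥0∞) := by
        refine lintegral_mono_ae ?_
        filter_upwards [ae_mem hΩ, ae_ne hn x] with z hz hxz
        have hdz := bdist_pos hn hΩ hz
        have hr := dist_pos.mpr hxz
        have h1 := bdist_le_add (Ω := Ω) z x
        rw [dist_comm z x] at h1
        have h2 := boundary_gain_le hdx hdz hr h1 hβ hσ hβσ hγ1
        have h3 : profile Ω s γ x z * bdist Ω z ^ β ≤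
            2 * bdist Ω x ^ (β + σ) * dist x z ^ (-(p + σ)) := by
          unfold profile
          calc dist x z ^ (-((n : ℝ) - 2 * s)) * min (bdist Ω x ^ γ / dist x z ^ γ) 1 *
                min (bdist Ω z ^ γ / dist x z ^ γ) 1 * bdist Ω z ^ β
              ≤ dist x z ^ (-((n : ℝ) - 2 * s)) * min (bdist Ω x ^ γ / dist x z ^ γ) 1 *
                1 * bdist Ω z ^ β := by
                gcongr
                exact min_le_right _ _
            _ = dist x z ^ (-p) * (min (bdist Ω x ^ γ / dist x z ^ γ) 1 * bdist Ω z ^ β) := by ring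
            _ ≤ dist x z ^ (-p) * (2 * (bdist Ω x ^ (β + σ) * dist x z ^ (-σ))) := by gcongr
            _ = 2 * bdist Ω x ^ (β + σ) * (dist x z ^ (-p) * dist x z ^ (-σ)) := by ring
            _ = _ := by
                rw [← Real.rpow_add hr]
                ring_nf
        have h4 := ENNReal.ofReal_le_ofReal h3
        rw [ENNReal.ofReal_mul (profile_nonneg _ _), ENNReal.ofReal_mul (by positivity),
          ENNReal.ofReal_mul (by positivity), ENNReal.ofReal_ofNat] at h4
        exact h4
    _ = 2 * powWeight Ω (β + σ) x * ∫⁻ z in Ω, (rieszKernel (p + σ) x z : ℝ≥0∞) :=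
        lintegral_const_mul' _ _ (by unfold powWeight; finiteness)
    _ ≤ 2 * powWeight Ω (β + σ) x * R := by gcongr; exact hR x hx
    _ = _ := by push_cast; ring

/-- Each application improves the boundary exponent by at most s, until it saturates at γ. -/
theorem exists_kernelOp_profile_iterate_one_le (hn : 1 ≤ n) (hΩ : IsC11 Ω) (hs0 : 0 < s)
    (hγ0 : 0 < γ) (hγ1 : γ ≤ 1) (m : ℕ) :
    ∃ R : ℝ≥0, ∀ x ∈ Ω, (kernelOp (volume.restrict Ω) (profileKernel Ω s γ))^[m] 1 x ≤
      R * powWeight Ω (min (m * s) γ) x := by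
  induction m with
  | zero => exact ⟨1, fun x _ => by simp [powWeight, min_eq_left hγ0.le]⟩
  | succ m ih =>
    obtain ⟨R, hR⟩ := ih
    have hms : 0 ≤ (m : ℝ) * s := by positivity
    obtain ⟨R', hR'⟩ := exists_kernelOp_profile_rpow_le hn hΩ hs0 hγ1 (γ := γ)
      (β := min (m * s) γ) (σ := min ((m + 1 : ℕ) * s) γ - min (m * s) γ) (le_min hms hγ0.le)
      (sub_nonneg.mpr (min_le_min (by push_cast; linarith) le_rfl))
      (by
        rw [sub_le_iff_le_add]
        rcases le_total ((m : ℝ) * s) γ with h | h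
        · rw [min_eq_left h]
          refine (min_le_left _ _).trans ?_
          push_cast
          linarith
        · rw [min_eq_right h]
          exact (min_le_right _ _).trans (by linarith))
      (by rw [add_sub_cancel]; exact min_le_right _ _)
    refine ⟨R * R', fun x hx => ?_⟩
    rw [add_sub_cancel] at hR'
    rw [Function.iterate_succ_apply']
    have h1 : (kernelOp (volume.restrict Ω) (profileKernel Ω s γ))^[m] 1 ≤ᵐ[volume.restrict Ω]
        fun x => R * powWeight Ω (min (m * s) γ) x := (ae_mem hΩ).mono hR
    have h2 := kernelOp_mono (k := profileKernel Ω s γ) h1 x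
    rw [kernelOp_const_mul measurable_profileKernel (measurable_powWeight _)] at h2
    calc _ ≤ _ := h2
      _ ≤ R * (R' * _) := mul_le_mul_right (hR' x hx) _
      _ = _ := by push_cast; ring

end Kernels

end NonlocalEig
end

/-! ### The regularizing property for Green's functions -/

noncomputable section

namespace NonlocalEig

section Comparable

variable {X : Type*} [MeasurableSpace X] {μ : Measure X} {k k' : X → X → ℝ≥0}

theorem kernelOp_le_of_kernel_le {x : X} {K : ℝ≥0} (h : ∀ᵐ y ∂μ, k' x y ≤ K * k x y)
    (F : X → ℝ≥0∞) : kernelOp μ k' F x ≤ K * kernelOp μ k F x := by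
  unfold kernelOp
  rw [← lintegral_const_mul' _ _ ENNReal.coe_ne_top]
  refine lintegral_mono_ae (h.mono fun y hy => ?_)
  rw [← mul_assoc, ← ENNReal.coe_mul]
  gcongr

theorem kernelOp_iterate_le_of_kernel_le [SFinite μ] (hk : Measurable (Function.uncurry k))
    {K : ℝ≥0} (h : ∀ᵐ x ∂μ, ∀ᵐ y ∂μ, k' x y ≤ K * k x y)
    {F : X → ℝ≥0∞} (hF : Measurable F) (m : ℕ) :
    ∀ᵐ x ∂μ, (kernelOp μ k')^[m] F x ≤ K ^ m * (kernelOp μ k)^[m] F x := by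
  induction m with
  | zero => simp
  | succ m ih =>
    have h2 := kernelOp_mono (k := k') ih
    filter_upwards [h] with x hx
    simp only [Function.iterate_succ_apply']
    calc _ ≤ _ := h2 x
      _ ≤ K * kernelOp μ k (fun x => (K : ℝ≥0∞) ^ m * (kernelOp μ k)^[m] F x) x :=
        kernelOp_le_of_kernel_le hx _
      _ = _ := by
        rw [kernelOp_const_mul hk (measurable_kernelOp_iterate hk hF m)]
        ring

/-- The regularizing property passes to comparable kernels. -/
theorem RegKernel.of_comparable [SFinite μ] {d : X → ℝ≥0} {N : ℕ} {C K : ℝ≥0}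
    (h : RegKernel μ k d N C) (hk' : Measurable (Function.uncurry k'))
    (hs : ∀ x y, k' x y = k' y x) (hK : 1 ≤ K)
    (hle : ∀ᵐ x ∂μ, ∀ᵐ y ∂μ, k' x y ≤ K * k x y)
    (hge : ∀ᵐ x ∂μ, ∀ᵐ y ∂μ, k x y ≤ K * k' x y) :
    RegKernel μ k' d N (C * K ^ (N + 3)) := by
  -- The four estimates lose K³, K^(N+1), K and K; since K ≥ 1, the exponent N + 3 covers them all.
  have hpow : ∀ {i : ℕ}, i ≤ N + 3 → (C : ℝ≥0∞) * K ^ i ≤ (C * K ^ (N + 3) : ℝ≥0) := by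
    intro i hi
    push_cast
    gcongr
    exact_mod_cast hK
  have hC : C ≤ C * K ^ (N + 3) := le_mul_of_one_le_right' (one_le_pow₀ hK)
  refine ⟨hk', hs, h.d_meas, h.d_pos, h.d_le.mono fun x hx => hx.trans hC,
    h.measure_le.trans (by exact_mod_cast hC), h.one_le.trans hC, fun F hF => ?_, fun F hF => ?_,
    fun F hF => ?_, ?_⟩
  · have h2 := kernelOp_iterate_le_of_kernel_le h.meas hle hF 2
    filter_upwards [h2, hge, h.comp_le F hF] with x hx1 hx2 hx3
    calc kernelOp μ k' (kernelOp μ k' F) x ≤ K ^ 2 * kernelOp μ k (kernelOp μ k F) x := hx1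
      _ ≤ K ^ 2 * (C * (K * kernelOp μ k' F x)) := by
          gcongr
          exact hx3.trans (mul_le_mul_right (kernelOp_le_of_kernel_le hx2 F) _)
      _ = C * K ^ 3 * kernelOp μ k' F x := by ring
      _ ≤ _ := by gcongr; exact hpow (by omega)
  · filter_upwards [kernelOp_iterate_le_of_kernel_le h.meas hle hF (N + 1), h.iter_le F hF]
      with x hx1 hx2
    calc _ ≤ _ := hx1
      _ ≤ _ := mul_le_mul_right hx2 _
      _ = C * K ^ (N + 1) * (d x * ∫⁻ y, F y * d y ∂μ) := by ring
      _ ≤ _ := by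
          rw [mul_assoc (_ : ℝ≥0∞) (d x : ℝ≥0∞)]
          gcongr
          exact hpow (by omega)
  · filter_upwards [hge, h.lower F hF] with x hx1 hx2
    calc _ ≤ _ := hx2
      _ ≤ C * (K * kernelOp μ k' F x) := mul_le_mul_right (kernelOp_le_of_kernel_le hx1 F) _
      _ = C * K ^ 1 * kernelOp μ k' F x := by ring
      _ ≤ _ := by gcongr; exact hpow (by omega)
  · filter_upwards [hle, h.one] with x hx1 hx2
    calc _ ≤ _ := kernelOp_le_of_kernel_le hx1 _
      _ ≤ K * C := mul_le_mul_right hx2 _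
      _ = C * K ^ 1 := by ring
      _ ≤ _ := hpow (by omega)

end Comparable

variable {n : ℕ} {Ω : Set (Space n)} {s γ κ : ℝ}

theorem coe_bweight (x : Space n) : (bweight Ω γ x : ℝ≥0∞) = powWeight Ω γ x := rfl

/-- For the smoothing property write T^(N+1) = T^m T^(j+1) T^m. After enough compositions the middle
factor has a bounded kernel. The left factor yields d through T^m 1 ≤ R₃ d, and the right one yields
∫F d by moving T^m onto the constant 1. -/
theorem exists_profile_regKernel (hn : 1 ≤ n) (hΩ : IsC11 Ω) (hs0 : 0 < s) (hγ0 : 0 < γ)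
    (hγ1 : γ ≤ 1) (hp : 0 < (n : ℝ) - 2 * s) :
    ∃ (N : ℕ) (C : ℝ≥0),
      RegKernel (volume.restrict Ω) (profileKernel Ω s γ) (bweight Ω γ) N C := by
  set T := kernelOp (volume.restrict Ω) (profileKernel Ω s γ) with hT
  have hsymm : ∀ x y, profileKernel Ω s γ x y = profileKernel Ω s γ y x := fun x y => by
    unfold profileKernel
    rw [profile_symm]
  have hmeas : Measurable (Function.uncurry (profileKernel Ω s γ)) := measurable_profileKernel
  obtain ⟨D, hD1, hDd, hDb⟩ := exists_diam_bound hn hΩ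
  obtain ⟨R₁, hR₁⟩ := exists_kernelOp_profile_comp_le hn hΩ hs0 hγ0 hγ1 hp
  obtain ⟨j, hj⟩ := exists_nat_ge (((n : ℝ) - 2 * s) / s)
  obtain ⟨m, hm⟩ := exists_nat_ge (γ / s)
  rw [div_le_iff₀ hs0] at hj hm
  obtain ⟨R₂, hR₂⟩ := exists_kernelOp_profile_iterate_le (γ := γ) hn hΩ hs0 hp j
  obtain ⟨R₃, hR₃⟩ := exists_kernelOp_profile_iterate_one_le hn hΩ hs0 hγ0 hγ1 m
  obtain ⟨R₄, hR₄⟩ := exists_lintegral_rieszKernel_le hn hΩ (a := (n : ℝ) - 2 * s) (by linarith)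
  rw [max_eq_right (by linarith)] at hR₂
  rw [min_eq_right hm] at hR₃
  have hvol : volume Ω < ∞ := hΩ.bounded.measure_lt_top
  -- iterated integrals
  have hone : ∀ (i : ℕ) (F : Space n → ℝ≥0∞), Measurable F →
      ∫⁻ x in Ω, T^[i] F x = ∫⁻ x in Ω, F x * T^[i] 1 x := by
    intro i
    induction i with
    | zero => intro F _; simp
    | succ i ih =>
      intro F hF
      rw [Function.iterate_succ_apply, ih _ (measurable_kernelOp hmeas hF),
        lintegral_kernelOp_mul hmeas hsymm hF
          (measurable_kernelOp_iterate hmeas measurable_one i)]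
      simp only [Function.iterate_succ_apply']
      rfl
  have hT3 : ∀ F : Space n → ℝ≥0∞, Measurable F →
      ∫⁻ x in Ω, T^[m] F x ≤ R₃ * ∫⁻ x in Ω, F x * bweight Ω γ x := by
    intro F hF
    rw [hone m F hF, ← lintegral_const_mul' _ _ ENNReal.coe_ne_top]
    refine lintegral_mono_ae ((ae_mem hΩ).mono fun x hx => ?_)
    calc F x * T^[m] 1 x ≤ F x * (R₃ * powWeight Ω γ x) := mul_le_mul_right (hR₃ x hx) _
      _ = _ := by rw [coe_bweight]; ring
  have hconst : ∀ (i : ℕ) (c : ℝ≥0∞) (F : Space n → ℝ≥0∞), F ≤ᵐ[volume.restrict Ω] (fun _ => c) →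
      ∀ᵐ x ∂(volume.restrict Ω), T^[i] F x ≤ c * T^[i] 1 x := by
    intro i c F hF
    induction i with
    | zero => exact hF.mono fun x hx => by simpa using hx
    | succ i ih =>
      have h2 := kernelOp_mono (k := profileKernel Ω s γ) ih
      rw [kernelOp_const_mul hmeas (measurable_kernelOp_iterate hmeas measurable_one i)] at h2
      simp only [Function.iterate_succ_apply']
      exact ae_of_all _ h2
  have hiter : ∀ F : Space n → ℝ≥0∞, Measurable F → ∀ᵐ x ∂(volume.restrict Ω),
      T^[m + j + m + 1] F x ≤
        (R₂ * R₃ * R₃ : ℝ≥0) * (bweight Ω γ x * ∫⁻ y in Ω, F y * bweight Ω γ y) := by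
    intro F hF
    have h1 : T^[j + 1] (T^[m] F) ≤ᵐ[volume.restrict Ω]
        fun _ => R₂ * (R₃ * ∫⁻ y in Ω, F y * bweight Ω γ y) := by
      filter_upwards [ae_mem hΩ] with x hx
      refine (hR₂ _ (measurable_kernelOp_iterate hmeas hF m) x hx).trans ?_
      gcongr
      refine le_trans (le_of_eq ?_) (hT3 F hF)
      exact lintegral_congr fun y => by simp [rieszKernel, hT]
    filter_upwards [hconst m _ _ h1, ae_mem hΩ] with x hx1 hx
    rw [show m + j + m + 1 = m + (j + 1 + m) by ring, Function.iterate_add_apply,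
      Function.iterate_add_apply]
    calc _ ≤ _ := hx1
      _ ≤ R₂ * (R₃ * ∫⁻ y in Ω, F y * bweight Ω γ y) * (R₃ * powWeight Ω γ x) :=
        mul_le_mul_right (hR₃ x hx) _
      _ = _ := by rw [coe_bweight]; push_cast; ring
  -- D bounds both the diameter and δ, so |x-y|^(-p) ≥ D^(-p) and each minimum is at least δ^γ/D^γ;
  -- the losses multiply to D^(p+2γ).
  set R₅ : ℝ≥0 := (D ^ ((n : ℝ) - 2 * s + 2 * γ)).toNNReal with hR₅
  have hlow : ∀ F : Space n → ℝ≥0∞, Measurable F → ∀ᵐ x ∂(volume.restrict Ω),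
      bweight Ω γ x * ∫⁻ y in Ω, F y * bweight Ω γ y ≤ R₅ * T F x := by
    intro F hF
    filter_upwards [ae_mem hΩ] with x hx
    rw [hT]
    unfold kernelOp
    rw [← lintegral_const_mul' _ _ ENNReal.coe_ne_top, ← lintegral_const_mul' _ _ ENNReal.coe_ne_top]
    refine lintegral_mono_ae ?_
    filter_upwards [ae_mem hΩ, ae_ne hn x] with y hy hxy
    have hr := dist_pos.mpr hxy
    have hD0 : 0 < D := by linarith
    have hdx := bdist_pos hn hΩ hx
    have hdy := bdist_pos hn hΩ hy
    have key : bdist Ω x ^ γ * bdist Ω y ^ γ ≤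
        D ^ ((n : ℝ) - 2 * s + 2 * γ) * profile Ω s γ x y := by
      have hmin : ∀ z ∈ Ω, bdist Ω z ^ γ / D ^ γ ≤ min (bdist Ω z ^ γ / dist x y ^ γ) 1 := by
        intro z hz
        have hdz := bdist_pos hn hΩ hz
        refine le_min ?_ ?_
        · gcongr
          exact (hDd x hx y hy).le
        · rw [div_le_one (by positivity)]
          exact Real.rpow_le_rpow hdz.le (hDb z hz) hγ0.le
      have hpw : D ^ (-((n : ℝ) - 2 * s)) ≤ dist x y ^ (-((n : ℝ) - 2 * s)) :=
        Real.rpow_le_rpow_of_nonpos hr (hDd x hx y hy).le (by linarith)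
      calc bdist Ω x ^ γ * bdist Ω y ^ γ = D ^ ((n : ℝ) - 2 * s + 2 * γ) *
            (D ^ (-((n : ℝ) - 2 * s)) * (bdist Ω x ^ γ / D ^ γ) * (bdist Ω y ^ γ / D ^ γ)) := by
            rw [Real.rpow_add hD0, Real.rpow_neg hD0.le, two_mul γ, Real.rpow_add hD0 γ γ]
            field_simp
        _ ≤ _ := by
            unfold profile
            gcongr
            · exact hmin x hx
            · exact hmin y hy
    have h4 := ENNReal.ofReal_le_ofReal key
    rw [ENNReal.ofReal_mul (by positivity), ENNReal.ofReal_mul (by positivity)] at h4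
    calc (bweight Ω γ x : ℝ≥0∞) * (F y * bweight Ω γ y)
        = ENNReal.ofReal (bdist Ω x ^ γ) * ENNReal.ofReal (bdist Ω y ^ γ) * F y := by
          rw [coe_bweight, coe_bweight]; unfold powWeight; ring
      _ ≤ _ := mul_le_mul_left h4 _
      _ = _ := by rw [mul_assoc]; rfl
  set C : ℝ≥0 := 1 + (D ^ γ).toNNReal + (volume Ω).toNNReal + R₁ + R₂ * R₃ * R₃ + R₅ + R₄ with hC
  refine ⟨m + j + m, C, hmeas, hsymm, ?_, ?_, ?_, ?_, ?_, fun F hF => ?_, fun F hF => ?_,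
    fun F hF => ?_, ?_⟩
  · exact (measurable_bdist.pow_const γ).real_toNNReal
  · filter_upwards [ae_mem hΩ] with x hx
    exact Real.toNNReal_pos.mpr (Real.rpow_pos_of_pos (bdist_pos hn hΩ hx) _)
  · filter_upwards [ae_mem hΩ] with x hx
    refine (Real.toNNReal_le_toNNReal (Real.rpow_le_rpow (bdist_pos hn hΩ hx).le (hDb x hx)
      hγ0.le)).trans ?_
    rw [hC]
    simp only [add_assoc]
    exact le_add_left (le_add_right le_rfl)
  · rw [Measure.restrict_apply_univ, ← ENNReal.coe_toNNReal hvol.ne]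
    refine ENNReal.coe_le_coe.mpr ?_
    rw [hC]
    simp only [add_assoc]
    exact le_add_left (le_add_left (le_add_right le_rfl))
  · rw [hC]
    simp only [add_assoc]
    exact le_add_right le_rfl
  · filter_upwards [ae_mem hΩ] with x hx
    refine (hR₁ F hF x hx).trans (mul_le_mul_left (ENNReal.coe_le_coe.mpr ?_) _)
    rw [hC]
    simp only [add_assoc]
    exact le_add_left (le_add_left (le_add_left (le_add_right le_rfl)))
  · filter_upwards [hiter F hF] with x hx
    rw [← mul_assoc] at hx
    refine hx.trans (mul_le_mul_left (mul_le_mul_left (ENNReal.coe_le_coe.mpr ?_) _) _)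
    rw [hC]
    simp only [add_assoc]
    exact le_add_left (le_add_left (le_add_left (le_add_left (le_add_right le_rfl))))
  · filter_upwards [hlow F hF] with x hx
    refine hx.trans (mul_le_mul_left (ENNReal.coe_le_coe.mpr ?_) _)
    rw [hC]
    exact le_add_right (le_add_left le_rfl)
  · filter_upwards [ae_mem hΩ] with x hx
    have h1 : kernelOp (volume.restrict Ω) (profileKernel Ω s γ) 1 x ≤ R₄ := by
      refine le_trans ?_ (hR₄ x hx)
      unfold kernelOp
      refine lintegral_mono fun y => ?_
      simpa using profileKernel_le_rieszKernel x y
    refine h1.trans (ENNReal.coe_le_coe.mpr ?_)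
    rw [hC]
    exact le_add_left le_rfl

namespace GreenOperator

/-- The Green's function is measurable only up to null sets and symmetric only off the diagonal of
Ω. Symmetrizing a measurable representative gives a kernel with both properties everywhere. -/
theorem ae_ae_kernel (A : GreenOperator Ω s γ κ) (hn : 1 ≤ n) (hΩ : IsC11 Ω) :
    ∃ k : Space n → Space n → ℝ≥0, Measurable (Function.uncurry k) ∧ (∀ x y, k x y = k y x) ∧
      ∀ᵐ x ∂(volume.restrict Ω), ∀ᵐ y ∂(volume.restrict Ω), A.kernel x y = k x y := by
  set μ : Measure (Space n) := volume.restrict Ω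
  set K := A.kernel_measurable.mk (Function.uncurry A.kernel) with hK
  have hKm : Measurable K := A.kernel_measurable.stronglyMeasurable_mk.measurable
  have hKe : ∀ᵐ q ∂(μ.prod μ), Function.uncurry A.kernel q = K q := A.kernel_measurable.ae_eq_mk
  have h1 := Measure.ae_ae_of_ae_prod hKe
  have h2 := Measure.ae_ae_of_ae_prod (Measure.measurePreserving_swap.quasiMeasurePreserving.ae hKe)
  refine ⟨fun x y => ((K (x, y) + K (y, x)) / 2).toNNReal, ?_, fun x y => by
    simp only [add_comm], ?_⟩
  · exact ((hKm.add (hKm.comp measurable_swap)).div_const 2).real_toNNReal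
  · filter_upwards [h1, h2, ae_mem hΩ] with x hx1 hx2 hx
    filter_upwards [hx1, hx2, ae_mem hΩ, ae_ne hn x] with y hy1 hy2 hy hxy
    simp only [Function.uncurry_apply_pair, Prod.swap_prod_mk] at hy1 hy2
    rw [← hy1, ← hy2, ← A.kernel_symm x hx y hy hxy, add_self_div_two,
      Real.coe_toNNReal _ (A.kernel_pos x hx y hy hxy).le]

theorem kappa_pos (A : GreenOperator Ω s γ κ) {x y : Space n} (hx : x ∈ Ω)
    (hy : y ∈ Ω) (hxy : x ≠ y) : 0 < κ := by
  have h1 := A.kernel_pos x hx y hy hxy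
  have h2 := A.kernel_upper x hx y hy hxy
  have h3 := profile_nonneg (Ω := Ω) (s := s) (γ := γ) x y
  by_contra h
  have := mul_nonpos_of_nonpos_of_nonneg (not_lt.mp h) h3
  linarith

/-- For `n > 2s` every Green operator has a regularizing kernel, with uniform constants. -/
theorem exists_regular (hn : 1 ≤ n) (hΩ : IsC11 Ω) (hs0 : 0 < s) (hγ0 : 0 < γ)
    (hγ1 : γ ≤ 1) (hp : 0 < (n : ℝ) - 2 * s) (κ : ℝ) :
    ∃ (N : ℕ) (C K : ℝ≥0), ∀ A : GreenOperator Ω s γ κ, ∃ k : Space n → Space n → ℝ≥0,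
      A.Regular k N C ∧ ∀ᵐ x ∂(volume.restrict Ω), ∀ᵐ y ∂(volume.restrict Ω),
        k x y ≤ K * rieszKernel ((n : ℝ) - 2 * s) x y := by
  obtain ⟨N, C, hC⟩ := exists_profile_regKernel hn hΩ hs0 hγ0 hγ1 hp
  -- κ is an arbitrary real here, but an operator with these bounds forces κ > 0; the maximum with 1
  -- meets the requirement 1 ≤ K of `RegKernel.of_comparable`.
  refine ⟨N, C * (max 1 κ.toNNReal) ^ (N + 3), max 1 κ.toNNReal, fun A => ?_⟩
  obtain ⟨k, hk, hks, hkA⟩ := A.ae_ae_kernel hn hΩ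
  have hboth : ∀ᵐ x ∂(volume.restrict Ω), ∀ᵐ y ∂(volume.restrict Ω),
      k x y ≤ max 1 κ.toNNReal * profileKernel Ω s γ x y ∧
      profileKernel Ω s γ x y ≤ max 1 κ.toNNReal * k x y := by
    filter_upwards [hkA, ae_mem hΩ] with x hx1 hx
    filter_upwards [hx1, ae_mem hΩ, ae_ne hn x] with y hy1 hy hxy
    have hκ := A.kappa_pos hx hy hxy
    have h1 := A.kernel_lower x hx y hy hxy
    have h2 := A.kernel_upper x hx y hy hxy
    rw [hy1] at h1 h2
    have hP : (profileKernel Ω s γ x y : ℝ) = profile Ω s γ x y :=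
      Real.coe_toNNReal _ (profile_nonneg x y)
    rw [← hP] at h1 h2
    have hcoe : (κ.toNNReal : ℝ) = κ := Real.coe_toNNReal _ hκ.le
    constructor
    · refine le_trans ?_ (mul_le_mul_left (le_max_right _ _) _)
      rw [← NNReal.coe_le_coe, NNReal.coe_mul, hcoe]
      exact h2
    · refine le_trans ?_ (mul_le_mul_left (le_max_right _ _) _)
      rw [← NNReal.coe_le_coe, NNReal.coe_mul, hcoe]
      rwa [inv_mul_le_iff₀ hκ] at h1
  refine ⟨k, ⟨hC.of_comparable hk hks (le_max_left _ _)
    (hboth.mono fun x hx => hx.mono fun y hy => hy.1)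
    (hboth.mono fun x hx => hx.mono fun y hy => hy.2), hkA⟩, ?_⟩
  exact hboth.mono fun x hx => hx.mono fun y hy =>
    hy.1.trans (mul_le_mul_right (profileKernel_le_rieszKernel x y) _)

end GreenOperator

/-! ### The Hardy–Littlewood–Sobolev inequality -/

section HLS

variable {n : ℕ}

/-- The part of the Riesz kernel at distances in `S`. -/
def truncKernel (a : ℝ) (S : Set ℝ) (x y : Space n) : ℝ≥0 :=
  (S.indicator (fun t => t ^ (-a)) (dist x y)).toNNReal

theorem measurable_truncKernel (a : ℝ) {S : Set ℝ} (hS : MeasurableSet S) :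
    Measurable (Function.uncurry (truncKernel (n := n) a S)) := by
  have h1 : Measurable fun t : ℝ => S.indicator (fun t => t ^ (-a)) t :=
    (measurable_id.pow_const (-a)).indicator hS
  exact (h1.comp (measurable_fst.dist measurable_snd)).real_toNNReal

theorem truncKernel_comm (a : ℝ) (S : Set ℝ) (x y : Space n) :
    truncKernel a S x y = truncKernel a S y x := by
  unfold truncKernel
  rw [dist_comm]

theorem truncKernel_add_compl (a ρ : ℝ) (x y : Space n) :
    (rieszKernel a x y : ℝ≥0∞) = truncKernel a (Iio ρ) x y + truncKernel a (Ici ρ) x y := by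
  unfold rieszKernel truncKernel
  rcases lt_or_ge (dist x y) ρ with h | h
  · rw [indicator_of_mem (mem_Iio.mpr h), indicator_of_notMem (by simpa using h)]
    simp
  · rw [indicator_of_notMem (by simpa using h), indicator_of_mem (mem_Ici.mpr h)]
    simp

theorem coe_truncKernel_rpow {a q : ℝ} (hq : 0 < q) (S : Set ℝ) (x y : Space n) :
    (truncKernel a S x y : ℝ≥0∞) ^ q =
      ENNReal.ofReal (S.indicator (fun t => t ^ (-(a * q))) (dist x y)) := by
  have h0 : ENNReal.ofReal (S.indicator (fun t => t ^ (-a)) (dist x y)) =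
    (truncKernel a S x y : ℝ≥0∞) := rfl
  rw [← h0]
  by_cases h : dist x y ∈ S
  · rw [indicator_of_mem h, indicator_of_mem h,
      ENNReal.ofReal_rpow_of_nonneg (by positivity) hq.le, ← Real.rpow_mul dist_nonneg, neg_mul]
  · rw [indicator_of_notMem h, indicator_of_notMem h, ENNReal.ofReal_zero, ENNReal.zero_rpow_of_pos hq]

variable {α p q : ℝ}

/-- Hölder: the truncated kernel lies in L^(p') because (n-α)p' > n, which is the condition p < n/α,
and its norm scales like ρ^(-n/q). -/
theorem exists_kernelOp_far_le (hn : 1 ≤ n) (hp : 1 < p) (hpα : p < n / α) (hα : 0 < α)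
    (hq : 1 / q = 1 / p - α / n) (Ω : Set (Space n)) :
    ∃ R : ℝ≥0, ∀ F : Space n → ℝ≥0∞, Measurable F → ∫⁻ y in Ω, F y ^ p ≤ 1 →
      ∀ ρ : ℝ, 0 < ρ → ∀ x,
      kernelOp (volume.restrict Ω) (truncKernel (n - α) (Ici ρ)) F x ≤
        R * ENNReal.ofReal (ρ ^ (-n / q)) := by
  have hn0 : (0 : ℝ) < n := by exact_mod_cast hn
  set p' := p / (p - 1) with hp'
  have hp1 : 0 < p - 1 := by linarith
  have hp'0 : 0 < p' := by positivity
  have hconj : p'.HolderConjugate p := (Real.HolderConjugate.conjExponent hp).symm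
  have hinv : 1 / p' = 1 - 1 / p := by rw [hp']; field_simp
  have hlt : α / n < 1 / p := by
    rw [lt_div_iff₀ hα] at hpα
    rw [div_lt_div_iff₀ hn0 (by linarith)]
    linarith
  have hgt : (n : ℝ) < (n - α) * p' := by
    have h1 : (n : ℝ) * (1 / p') < n - α := by
      have : (n : ℝ) * (α / n) < n * (1 / p) := by gcongr
      rw [mul_div_cancel₀ _ hn0.ne'] at this
      rw [hinv]
      linarith
    rwa [mul_one_div, div_lt_iff₀ hp'0] at h1
  obtain ⟨R, hR⟩ := exists_lintegral_compl_ball_le hn hgt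
  refine ⟨R ^ (1 / p'), fun F hF hF1 ρ hρ x => ?_⟩
  have hm := measurable_truncKernel (n := n) (n - α) (measurableSet_Ici (a := ρ))
  calc kernelOp (volume.restrict Ω) (truncKernel (n - α) (Ici ρ)) F x
      ≤ (∫⁻ y in Ω, (truncKernel (n - α) (Ici ρ) x y : ℝ≥0∞) ^ p') ^ (1 / p') *
        (∫⁻ y in Ω, F y ^ p) ^ (1 / p) :=
        ENNReal.lintegral_mul_le_Lp_mul_Lq _ hconj
          hm.of_uncurry_left.coe_nnreal_ennreal.aemeasurable hF.aemeasurable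
    _ ≤ (R * ENNReal.ofReal (ρ ^ (n - (n - α) * p'))) ^ (1 / p') * 1 ^ (1 / p) := by
        gcongr
        simp only [coe_truncKernel_rpow hp'0]
        exact (setLIntegral_le_lintegral _ _).trans (hR ρ hρ x)
    _ = _ := by
        rw [ENNReal.one_rpow, mul_one, ENNReal.mul_rpow_of_nonneg _ _ (by positivity),
          ENNReal.ofReal_rpow_of_nonneg (by positivity) (by positivity), ← Real.rpow_mul hρ.le,
          ENNReal.coe_rpow_of_nonneg _ (by positivity)]
        congr 3
        have : -(n : ℝ) / q = -n * (1 / q) := by ring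
        rw [this, hq, sub_mul, mul_assoc, mul_one_div_cancel hp'0.ne', hinv]
        field_simp
        ring

/-- Split the kernel at radius ρ(t) and the function at height H(t) so that the far part and the
near part acting on values below H are each at most t/4. Where the potential exceeds t, the near
part of F·1_{F>H} is at least t/2, and Markov's inequality applies. Keeping F·1_{F>H} on the right
lets the estimate be integrated in t to a strong bound. -/
theorem exists_meas_riesz_lt_le (hn : 1 ≤ n) (hα : 0 < α) (hp : 1 < p)
    (hpα : p < n / α) (hq : 1 / q = 1 / p - α / n) (hq0 : 0 < q) (Ω : Set (Space n)) :
    ∃ C c : ℝ≥0, 0 < c ∧ ∀ F : Space n → ℝ≥0∞, Measurable F → ∫⁻ y in Ω, F y ^ p ≤ 1 →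
      ∀ t : ℝ, 0 < t → volume.restrict Ω
        {x | ENNReal.ofReal t < kernelOp (volume.restrict Ω) (rieszKernel (n - α)) F x} ≤
      C * ENNReal.ofReal (t ^ (-1 - q * α / n)) *
        ∫⁻ y in Ω, {y | c * ENNReal.ofReal t ^ (q / p) < F y}.indicator F y := by
  have hn0 : (0 : ℝ) < n := by exact_mod_cast hn
  obtain ⟨R₁, hR₁⟩ := exists_kernelOp_far_le hn hp hpα hα hq Ω
  obtain ⟨R₀, hR₀⟩ := exists_lintegral_ball_le (n := n) hn (a := n - α) (by linarith)
  rw [sub_sub_cancel] at hR₀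
  -- Chosen so that at ρ = c₀ t^(-q/n) the far part R₁ ρ^(-n/q) is at most t/4; adding 1 keeps c₀
  -- positive even if R₁ = 0.
  set c₀ : ℝ := (4 * (R₁ + 1)) ^ (q / n) with hc₀
  have hc₀0 : 0 < c₀ := by positivity
  -- Chosen so that the near part applied to the constant H = c t^(q/p) is at most t/4; the powers
  -- of t match because q/p - qα/n = 1.
  set c : ℝ := (4 * (R₀ + 1) * c₀ ^ α)⁻¹ with hc
  have hc0 : 0 < c := by positivity
  refine ⟨2 * R₀ * (c₀ ^ α).toNNReal, c.toNNReal, Real.toNNReal_pos.mpr hc0,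
    fun F hF hF1 t ht => ?_⟩
  set μ : Measure (Space n) := volume.restrict Ω
  set ρ : ℝ := c₀ * t ^ (-q / n) with hρ
  have hρ0 : 0 < ρ := by positivity
  set H : ℝ≥0∞ := (c.toNNReal : ℝ≥0∞) * ENNReal.ofReal t ^ (q / p) with hH
  set G : Space n → ℝ≥0∞ := {y | H < F y}.indicator F with hG
  have hGm : Measurable G := hF.indicator (measurableSet_lt measurable_const hF)
  have hFG : ∀ y, F y ≤ H + G y := fun y => by
    by_cases h : H < F y
    · rw [hG, indicator_of_mem (by exact h)]; exact le_add_self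
    · exact (not_lt.mp h).trans le_self_add
  have hnm := measurable_truncKernel (n := n) (n - α) (measurableSet_Iio (a := ρ))
  have hfm := measurable_truncKernel (n := n) (n - α) (measurableSet_Ici (a := ρ))
  have hρα : ρ ^ α = c₀ ^ α * t ^ (-(q * α / n)) := by
    rw [hρ, Real.mul_rpow hc₀0.le (by positivity), ← Real.rpow_mul ht.le]
    congr 2
    ring
  have hnear : ∀ x, ∫⁻ y, (truncKernel (n - α) (Iio ρ) x y : ℝ≥0∞) ∂μ ≤
      R₀ * ENNReal.ofReal (ρ ^ α) := fun x => (setLIntegral_le_lintegral _ _).trans (hR₀ ρ hρ0 x)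
  have hfar : ∀ x, kernelOp μ (truncKernel (n - α) (Ici ρ)) F x ≤ ENNReal.ofReal (t / 4) := by
    intro x
    refine (hR₁ F hF hF1 ρ hρ0 x).trans ?_
    rw [← ENNReal.ofReal_coe_nnreal, ← ENNReal.ofReal_mul (by positivity)]
    refine ENNReal.ofReal_le_ofReal ?_
    have : ρ ^ (-n / q) = (4 * ((R₁ : ℝ) + 1))⁻¹ * t := by
      rw [hρ, Real.mul_rpow hc₀0.le (by positivity), hc₀, ← Real.rpow_mul (by positivity),
        ← Real.rpow_mul ht.le, show q / n * (-n / q) = -1 by field_simp,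
        show -q / n * (-n / q) = 1 by field_simp, Real.rpow_neg_one, Real.rpow_one]
    rw [this, ← mul_assoc, div_eq_inv_mul]
    gcongr
    rw [mul_inv, mul_left_comm]
    refine mul_le_of_le_one_right (by norm_num) ?_
    rw [← div_eq_mul_inv, div_le_one (by positivity)]
    linarith
  have hlow : H * (R₀ * ENNReal.ofReal (ρ ^ α)) ≤ ENNReal.ofReal (t / 4) := by
    have h1 : (c.toNNReal : ℝ≥0∞) = ENNReal.ofReal c := rfl
    rw [hH, h1, ENNReal.ofReal_rpow_of_pos ht, ← ENNReal.ofReal_mul hc0.le,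
      ← ENNReal.ofReal_coe_nnreal, ← ENNReal.ofReal_mul (by positivity),
      ← ENNReal.ofReal_mul (by positivity)]
    refine ENNReal.ofReal_le_ofReal ?_
    have h2 : t ^ (q / p) * t ^ (-(q * α / n)) = t := by
      rw [← Real.rpow_add ht]
      have : q / p + -(q * α / n) = 1 := by
        have : q / p + -(q * α / n) = q * (1 / p - α / n) := by ring
        rw [this, ← hq, mul_one_div_cancel hq0.ne']
      rw [this, Real.rpow_one]
    calc c * t ^ (q / p) * (R₀ * ρ ^ α)
        = c * R₀ * c₀ ^ α * (t ^ (q / p) * t ^ (-(q * α / n))) := by rw [hρα]; ring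
      _ = (R₀ / (R₀ + 1)) * (t / 4) := by rw [h2, hc]; field_simp
      _ ≤ 1 * (t / 4) := by
          gcongr
          rw [div_le_one (by positivity)]
          linarith
      _ = _ := one_mul _
  have hsplit : ∀ x, kernelOp μ (rieszKernel (n - α)) F x ≤
      ENNReal.ofReal (t / 2) + kernelOp μ (truncKernel (n - α) (Iio ρ)) G x := by
    intro x
    calc kernelOp μ (rieszKernel (n - α)) F x
        ≤ ∫⁻ y, ((truncKernel (n - α) (Iio ρ) x y * H +
            truncKernel (n - α) (Iio ρ) x y * G y) + truncKernel (n - α) (Ici ρ) x y * F y) ∂μ := by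
          refine lintegral_mono fun y => ?_
          rw [truncKernel_add_compl (n - α) ρ, add_mul, ← mul_add]
          gcongr
          exact hFG y
      _ = (∫⁻ y, (truncKernel (n - α) (Iio ρ) x y : ℝ≥0∞) ∂μ) * H +
            kernelOp μ (truncKernel (n - α) (Iio ρ)) G x +
            kernelOp μ (truncKernel (n - α) (Ici ρ)) F x := by
          rw [lintegral_add_right _ (measurable_kernel_mul hfm hF x),
            lintegral_add_right _ (measurable_kernel_mul hnm hGm x),
            lintegral_mul_const _ hnm.of_uncurry_left.coe_nnreal_ennreal]
          rfl
      _ ≤ ENNReal.ofReal (t / 4) + kernelOp μ (truncKernel (n - α) (Iio ρ)) G x +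
            ENNReal.ofReal (t / 4) := by
          gcongr
          · rw [mul_comm]
            exact (mul_le_mul_right (hnear x) _).trans hlow
          · exact hfar x
      _ = _ := by
          rw [add_right_comm, ← ENNReal.ofReal_add (by positivity) (by positivity)]
          ring_nf
  have hint : ∫⁻ x, kernelOp μ (truncKernel (n - α) (Iio ρ)) G x ∂μ ≤
      R₀ * ENNReal.ofReal (ρ ^ α) * ∫⁻ y, G y ∂μ := by
    have h1 := lintegral_kernelOp_mul (μ := μ) hnm (truncKernel_comm _ _) hGm measurable_one
    simp only [Pi.one_apply, mul_one] at h1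
    rw [h1, mul_comm, ← lintegral_mul_const _ hGm]
    refine lintegral_mono fun y => ?_
    gcongr
    refine le_trans (le_of_eq ?_) (hnear y)
    simp [kernelOp]
  have ht2 : ENNReal.ofReal (t / 2) ≠ 0 := by simpa using ht
  calc μ {x | ENNReal.ofReal t < kernelOp μ (rieszKernel (n - α)) F x}
      ≤ μ {x | ENNReal.ofReal (t / 2) ≤ kernelOp μ (truncKernel (n - α) (Iio ρ)) G x} := by
        refine measure_mono fun x hx => ?_
        have h1 := (lt_of_lt_of_le hx (hsplit x)).le
        rw [show t = t / 2 + t / 2 by ring, ENNReal.ofReal_add (by positivity) (by positivity),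
          show (t / 2 + t / 2) / 2 = t / 2 by ring] at h1
        exact (ENNReal.add_le_add_iff_left ENNReal.ofReal_ne_top).mp h1
    _ ≤ (∫⁻ x, kernelOp μ (truncKernel (n - α) (Iio ρ)) G x ∂μ) / ENNReal.ofReal (t / 2) :=
        meas_ge_le_lintegral_div (measurable_kernelOp hnm hGm).aemeasurable ht2
          ENNReal.ofReal_ne_top
    _ ≤ (R₀ * ENNReal.ofReal (ρ ^ α) * ∫⁻ y, G y ∂μ) / ENNReal.ofReal (t / 2) := by gcongr
    _ = _ := by
        rw [ENNReal.div_eq_inv_mul, ← ENNReal.ofReal_inv_of_pos (by positivity), hρα,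
          ENNReal.ofReal_mul (by positivity)]
        have : t ^ (-1 - q * α / n) = t⁻¹ * t ^ (-(q * α / n)) := by
          rw [← Real.rpow_neg_one, ← Real.rpow_add ht]
          rfl
        rw [this, ENNReal.ofReal_mul (by positivity), inv_div, div_eq_mul_inv,
          ENNReal.ofReal_mul zero_le_two, ENNReal.ofReal_ofNat]
        push_cast
        rw [show ((c₀ ^ α).toNNReal : ℝ≥0∞) = ENNReal.ofReal (c₀ ^ α) from rfl]
        ring

/-- `∫₀^G t^{r-1} dt = G^r / r`. -/
theorem lintegral_Ioi_lt_rpow {r : ℝ} (hr : 0 < r) (G : ℝ≥0∞) :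
    ENNReal.ofReal r * ∫⁻ t in Ioi (0 : ℝ), {t | ENNReal.ofReal t < G}.indicator
      (fun t => ENNReal.ofReal (t ^ (r - 1))) t = G ^ r := by
  have hfin : ∀ g : ℝ≥0, ENNReal.ofReal r * ∫⁻ t in Ioi (0 : ℝ),
      {t | ENNReal.ofReal t < g}.indicator (fun t => ENNReal.ofReal (t ^ (r - 1))) t =
        (g : ℝ≥0∞) ^ r := by
    intro g
    have h1 : ∫⁻ t in Ioi (0 : ℝ),
        {t | ENNReal.ofReal t < g}.indicator (fun t => ENNReal.ofReal (t ^ (r - 1))) t =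
        ∫⁻ t in Ioo (0 : ℝ) g, ENNReal.ofReal (t ^ (r - 1)) := by
      rw [← Ioi_inter_Iio, inter_comm, ← Measure.restrict_restrict measurableSet_Iio,
        ← lintegral_indicator measurableSet_Iio]
      refine setLIntegral_congr_fun measurableSet_Ioi fun t ht => ?_
      have : ENNReal.ofReal t < g ↔ t < g := by
        rw [← ENNReal.ofReal_coe_nnreal]
        exact ⟨fun h => (ENNReal.ofReal_lt_ofReal_iff_of_nonneg (le_of_lt ht)).mp h,
          fun h => (ENNReal.ofReal_lt_ofReal_iff_of_nonneg (le_of_lt ht)).mpr h⟩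
      simp only [indicator, mem_ofPred_eq, mem_Iio, this]
    have hii := (intervalIntegral.intervalIntegrable_rpow' (a := 0) (b := g) (r := r - 1)
      (by linarith))
    rw [h1, ← ofReal_integral_eq_lintegral_ofReal, ← integral_Ioc_eq_integral_Ioo,
      ← intervalIntegral.integral_of_le g.coe_nonneg, integral_rpow (Or.inl (by linarith)), sub_add_cancel,
      Real.zero_rpow hr.ne', sub_zero, ← ENNReal.ofReal_mul hr.le, mul_div_cancel₀ _ hr.ne',
      ← ENNReal.ofReal_rpow_of_nonneg g.coe_nonneg hr.le, ENNReal.ofReal_coe_nnreal]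
    · rw [intervalIntegrable_iff_integrableOn_Ioo_of_le g.coe_nonneg] at hii
      exact hii
    · filter_upwards [ae_restrict_mem measurableSet_Ioo] with t ht
      exact Real.rpow_nonneg ht.1.le _
  induction G with
  | coe g => exact hfin g
  | top =>
    rw [ENNReal.top_rpow_of_pos hr]
    refine ENNReal.eq_top_of_forall_nnreal_le fun m => ?_
    have h1 := hfin (m ^ (1 / r))
    rw [← ENNReal.coe_rpow_of_nonneg _ hr.le, ← NNReal.rpow_mul, one_div_mul_cancel hr.ne',
      NNReal.rpow_one] at h1
    rw [← h1]
    refine mul_le_mul_right (lintegral_mono fun t => ?_) _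
    exact indicator_le_indicator_of_subset (fun t _ => ENNReal.ofReal_lt_top) (fun _ => zero_le) t

end HLS

section HLS

variable {n : ℕ} {α p q : ℝ}

/-- Layer-cake formula, the truncated weak estimate, and Tonelli. For fixed y the variable t ranges
up to (F(y)/c)^(p/q), so the inner integral of t^(r-1) is a multiple of F(y)^(p-1); with the factor
F(y) this makes ∫F^p. -/
theorem exists_lintegral_riesz_rpow_le (hn : 1 ≤ n) (hα : 0 < α) (hp : 1 < p)
    (hpα : p < n / α) (hq : 1 / q = 1 / p - α / n) (hq0 : 0 < q) (Ω : Set (Space n)) :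
    ∃ C : ℝ≥0, ∀ F : Space n → ℝ≥0∞, Measurable F → ∫⁻ y in Ω, F y ^ p ≤ 1 →
      ∫⁻ x in Ω, kernelOp (volume.restrict Ω) (rieszKernel (n - α)) F x ^ q ≤ C := by
  obtain ⟨C, c, hc, hweak⟩ := exists_meas_riesz_lt_le hn hα hp hpα hq hq0 Ω
  -- The power of t left after multiplying the weak bound by t^(q-1) is r - 1, and (p/q)·r = p - 1.
  set r : ℝ := q * (1 - 1 / p) with hr
  have hr0 : 0 < r := mul_pos hq0 (sub_pos.mpr (by rw [div_lt_one (by linarith)]; exact hp))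
  have hrr : -1 - q * α / n + (q - 1) = r - 1 := by
    have : q * (1 / q) = q * (1 / p - α / n) := by rw [hq]
    rw [mul_one_div_cancel hq0.ne'] at this
    rw [hr, mul_div_assoc]
    linarith
  have hc' : (c : ℝ≥0∞) ≠ 0 := by exact_mod_cast hc.ne'
  have hfin : ENNReal.ofReal q * C * ((ENNReal.ofReal r)⁻¹ * (c : ℝ≥0∞)⁻¹ ^ (p - 1)) ≠ ∞ := by
    have h1 : (ENNReal.ofReal r)⁻¹ ≠ ∞ := ENNReal.inv_ne_top.mpr (by simpa using hr0)
    have h2 : (c : ℝ≥0∞)⁻¹ ^ (p - 1) ≠ ∞ :=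
      ENNReal.rpow_ne_top_of_nonneg (by linarith) (ENNReal.inv_ne_top.mpr hc')
    finiteness
  refine ⟨(ENNReal.ofReal q * C * ((ENNReal.ofReal r)⁻¹ * (c : ℝ≥0∞)⁻¹ ^ (p - 1))).toNNReal,
    fun F hF hF1 => ?_⟩
  rw [ENNReal.coe_toNNReal hfin]
  set μ : Measure (Space n) := volume.restrict Ω
  set U := kernelOp μ (rieszKernel (n - α)) F with hU
  have hUm : Measurable U := measurable_kernelOp (measurable_rieszKernel _) hF
  -- the inner integral
  have hinner : ∀ y, ∫⁻ t in Ioi (0 : ℝ), {t | c * ENNReal.ofReal t ^ (q / p) < F y}.indicator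
      (fun t => ENNReal.ofReal (t ^ (r - 1))) t =
      (ENNReal.ofReal r)⁻¹ * (F y / c) ^ (p - 1) := by
    intro y
    have h1 := lintegral_Ioi_lt_rpow hr0 ((F y / c) ^ (p / q))
    have h2 : {t : ℝ | ENNReal.ofReal t < (F y / c) ^ (p / q)} =
        {t | c * ENNReal.ofReal t ^ (q / p) < F y} := by
      ext t
      simp only [mem_ofPred_eq]
      rw [show p / q = (q / p)⁻¹ by rw [inv_div], ENNReal.lt_rpow_inv_iff (by positivity),
        ENNReal.lt_div_iff_mul_lt (Or.inl hc') (Or.inl ENNReal.coe_ne_top), mul_comm]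
    rw [h2, ← ENNReal.rpow_mul, show p / q * r = p - 1 by rw [hr]; field_simp] at h1
    rw [← h1, ← mul_assoc, ENNReal.inv_mul_cancel (by simpa using hr0) ENNReal.ofReal_ne_top,
      one_mul]
  have hm1 : MeasurableSet {z : Space n × ℝ | ENNReal.ofReal z.2 < U z.1} :=
    measurableSet_lt (by fun_prop) (hUm.comp measurable_fst)
  have hm2 : MeasurableSet {z : ℝ × Space n | c * ENNReal.ofReal z.1 ^ (q / p) < F z.2} :=
    measurableSet_lt (by fun_prop) (hF.comp measurable_snd)
  calc ∫⁻ x, U x ^ q ∂μ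
      = ∫⁻ x, (ENNReal.ofReal q * ∫⁻ t in Ioi (0 : ℝ), {t | ENNReal.ofReal t < U x}.indicator
          (fun t => ENNReal.ofReal (t ^ (q - 1))) t) ∂μ :=
        lintegral_congr fun x => (lintegral_Ioi_lt_rpow hq0 (U x)).symm
    _ = ENNReal.ofReal q * ∫⁻ t in Ioi (0 : ℝ), ∫⁻ x, {t | ENNReal.ofReal t < U x}.indicator
          (fun t => ENNReal.ofReal (t ^ (q - 1))) t ∂μ := by
        rw [lintegral_const_mul' _ _ ENNReal.ofReal_ne_top, lintegral_lintegral_swap]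
        exact (Measurable.indicator (f := fun z : Space n × ℝ => ENNReal.ofReal (z.2 ^ (q - 1)))
          (by fun_prop) hm1).aemeasurable
    _ = ENNReal.ofReal q * ∫⁻ t in Ioi (0 : ℝ),
          ENNReal.ofReal (t ^ (q - 1)) * μ {x | ENNReal.ofReal t < U x} := by
        congr 1
        refine lintegral_congr fun t => ?_
        rw [← lintegral_indicator_const (measurableSet_lt measurable_const hUm)]
        rfl
    _ ≤ ENNReal.ofReal q * ∫⁻ t in Ioi (0 : ℝ), C * ∫⁻ y, F y *
          {t | c * ENNReal.ofReal t ^ (q / p) < F y}.indicator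
            (fun t => ENNReal.ofReal (t ^ (r - 1))) t ∂μ := by
        refine mul_le_mul_right (setLIntegral_mono' measurableSet_Ioi fun t ht => ?_) _
        have ht0 : (0 : ℝ) < t := ht
        calc _ ≤ ENNReal.ofReal (t ^ (q - 1)) * (C * ENNReal.ofReal (t ^ (-1 - q * α / n)) *
              ∫⁻ y in Ω, {y | c * ENNReal.ofReal t ^ (q / p) < F y}.indicator F y) :=
              mul_le_mul_right (hweak F hF hF1 t ht) _
          _ = C * (ENNReal.ofReal (t ^ (r - 1)) *
              ∫⁻ y in Ω, {y | c * ENNReal.ofReal t ^ (q / p) < F y}.indicator F y) := by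
              rw [← hrr, Real.rpow_add ht0, ENNReal.ofReal_mul (by positivity)]
              ring
          _ = _ := by
              rw [← lintegral_const_mul' _ _ ENNReal.ofReal_ne_top]
              congr 1
              refine lintegral_congr fun y => ?_
              by_cases h : c * ENNReal.ofReal t ^ (q / p) < F y
              · rw [indicator_of_mem (by exact h), indicator_of_mem (by exact h), mul_comm]
              · rw [indicator_of_notMem (by exact h), indicator_of_notMem (by exact h), mul_zero,
                  mul_zero]
    _ = ENNReal.ofReal q * (C * ∫⁻ y, (F y * ∫⁻ t in Ioi (0 : ℝ),
          {t | c * ENNReal.ofReal t ^ (q / p) < F y}.indicator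
            (fun t => ENNReal.ofReal (t ^ (r - 1))) t) ∂μ) := by
        have hmi : Measurable fun z : ℝ × Space n =>
            {z : ℝ × Space n | c * ENNReal.ofReal z.1 ^ (q / p) < F z.2}.indicator
              (fun z => ENNReal.ofReal (z.1 ^ (r - 1))) z :=
          Measurable.indicator (by fun_prop) hm2
        rw [lintegral_const_mul' _ _ ENNReal.coe_ne_top, lintegral_lintegral_swap]
        · congr 2
          refine lintegral_congr fun y => ?_
          exact lintegral_const_mul _ (hmi.comp measurable_prodMk_right)
        · exact ((hF.comp measurable_snd).mul hmi).aemeasurable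
    _ = ENNReal.ofReal q * (C * (((ENNReal.ofReal r)⁻¹ * (c : ℝ≥0∞)⁻¹ ^ (p - 1)) *
          ∫⁻ y, F y ^ p ∂μ)) := by
        rw [← lintegral_const_mul _ (hF.pow_const p)]
        congr 2
        refine lintegral_congr fun y => ?_
        have h1 : F y ^ p = F y * F y ^ (p - 1) := by
          conv_lhs => rw [show p = 1 + (p - 1) by ring,
            ENNReal.rpow_add_of_nonneg _ _ zero_le_one (by linarith), ENNReal.rpow_one]
        rw [hinner, div_eq_mul_inv, ENNReal.mul_rpow_of_nonneg _ _ (by linarith), h1]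
        ring
    _ ≤ ENNReal.ofReal q * (C * (((ENNReal.ofReal r)⁻¹ * (c : ℝ≥0∞)⁻¹ ^ (p - 1)) * 1)) := by
        gcongr
    _ = _ := by ring

/-- The Hardy–Littlewood–Sobolev inequality. -/
theorem exists_riesz_norm_le (hn : 1 ≤ n) (hα : 0 < α) (hp : 1 < p)
    (hpα : p < n / α) (hq : 1 / q = 1 / p - α / n) (hq0 : 0 < q) (Ω : Set (Space n)) :
    ∃ C : ℝ≥0, ∀ F : Space n → ℝ≥0∞, Measurable F → ∫⁻ y in Ω, F y ^ p ≠ ∞ →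
      (∫⁻ x in Ω, kernelOp (volume.restrict Ω) (rieszKernel (n - α)) F x ^ q) ^ (1 / q) ≤
        C * (∫⁻ y in Ω, F y ^ p) ^ (1 / p) := by
  have hp0 : 0 < p := by linarith
  obtain ⟨C, hC⟩ := exists_lintegral_riesz_rpow_le hn hα hp hpα hq hq0 Ω
  refine ⟨C ^ (1 / q), fun F hF hFt => ?_⟩
  set μ : Measure (Space n) := volume.restrict Ω
  rcases eq_or_ne (∫⁻ y, F y ^ p ∂μ) 0 with h0 | h0
  · rw [lintegral_eq_zero_iff (hF.pow_const p)] at h0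
    have h1 : F ≤ᵐ[μ] 0 := h0.mono fun x hx => by
      have hx' : F x ^ p = 0 := hx
      exact ((ENNReal.rpow_eq_zero_iff_of_pos hp0).mp hx').le
    have h2 : ∀ x, kernelOp μ (rieszKernel (n - α)) F x = 0 := fun x =>
      nonpos_iff_eq_zero.mp ((kernelOp_mono (k := rieszKernel (n - α)) h1 x).trans
        (by simp [kernelOp]))
    simp [h2, hq0]
  set N : ℝ≥0∞ := (∫⁻ y, F y ^ p ∂μ) ^ (1 / p) with hN
  have hN0 : N ≠ 0 := by
    rw [hN, Ne, ENNReal.rpow_eq_zero_iff_of_pos (by positivity)]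
    exact h0
  have hNt : N ≠ ∞ := ENNReal.rpow_ne_top_of_nonneg (by positivity) hFt
  have hNp : N ^ p = ∫⁻ y, F y ^ p ∂μ := by
    rw [hN, ← ENNReal.rpow_mul, one_div_mul_cancel hp0.ne', ENNReal.rpow_one]
  have h1 := hC (fun y => N⁻¹ * F y) (hF.const_mul _) (by
    simp only [ENNReal.mul_rpow_of_nonneg _ _ hp0.le]
    rw [lintegral_const_mul _ (hF.pow_const p), ← hNp,
      ← ENNReal.mul_rpow_of_nonneg _ _ hp0.le, ENNReal.inv_mul_cancel hN0 hNt, ENNReal.one_rpow])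
  rw [kernelOp_const_mul (measurable_rieszKernel _) hF] at h1
  simp only [ENNReal.mul_rpow_of_nonneg _ _ hq0.le] at h1
  rw [lintegral_const_mul _ ((measurable_kernelOp (measurable_rieszKernel _) hF).pow_const q)] at h1
  have h2 := ENNReal.rpow_le_rpow h1 (show 0 ≤ 1 / q by positivity)
  rw [ENNReal.mul_rpow_of_nonneg _ _ (by positivity), ← ENNReal.rpow_mul,
    mul_one_div_cancel hq0.ne', ENNReal.rpow_one, ENNReal.inv_mul_le_iff hN0 hNt,
    mul_comm] at h2
  rwa [ENNReal.coe_rpow_of_nonneg _ (by positivity)]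

end HLS

/-! ### Riesz potentials on a bounded domain: endpoint estimates -/

section Domain

variable {n : ℕ} {Ω : Set (Space n)}

/-- Young's inequality for the Riesz kernel on a bounded set. -/
theorem exists_riesz_norm_le_L1 (hn : 1 ≤ n) (hΩ : IsC11 Ω) {a q : ℝ} (hq : 1 ≤ q)
    (haq : a * q < n) :
    ∃ C : ℝ≥0, ∀ F : Space n → ℝ≥0∞, Measurable F →
      (∫⁻ x in Ω, kernelOp (volume.restrict Ω) (rieszKernel a) F x ^ q) ^ (1 / q) ≤
        C * ∫⁻ y in Ω, F y := by
  have hq0 : 0 < q := by linarith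
  obtain ⟨R, hR⟩ := exists_lintegral_rieszKernel_le hn hΩ haq
  refine ⟨R ^ (1 / q), fun F hF => ?_⟩
  set μ : Measure (Space n) := volume.restrict Ω
  have hk := measurable_rieszKernel (n := n) a
  have hkq : ∀ x y : Space n, (rieszKernel a x y : ℝ≥0∞) ^ q = rieszKernel (a * q) x y := by
    intro x y
    rw [rieszKernel_eq, rieszKernel_eq, ENNReal.ofReal_rpow_of_nonneg (by positivity) hq0.le,
      ← Real.rpow_mul dist_nonneg, neg_mul]
  have h1 : ∀ x, kernelOp μ (rieszKernel a) F x ^ q ≤ (∫⁻ y, F y ∂μ) ^ (q - 1) *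
      kernelOp μ (rieszKernel (a * q)) F x := by
    intro x
    -- Jensen with weight F puts the power q on the kernel, which remains integrable because aq < n.
    have := lintegral_mul_rpow_le (μ := μ) hq hF (G := fun y => (rieszKernel a x y : ℝ≥0∞))
      hk.of_uncurry_left.coe_nnreal_ennreal
    simp only [hkq] at this
    simpa only [kernelOp, mul_comm] using this
  have h2 : ∫⁻ x, kernelOp μ (rieszKernel (a * q)) F x ∂μ ≤ R * ∫⁻ y, F y ∂μ := by
    have := lintegral_kernelOp_mul (μ := μ) (measurable_rieszKernel (n := n) (a * q))
      (rieszKernel_comm _) hF measurable_one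
    simp only [Pi.one_apply, mul_one] at this
    rw [this, mul_comm (R : ℝ≥0∞), ← lintegral_mul_const _ hF]
    refine lintegral_mono_ae ((ae_mem hΩ).mono fun y hy => mul_le_mul_right ?_ _)
    refine le_trans (le_of_eq ?_) (hR y hy)
    simp [kernelOp]
  have h3 : ∫⁻ x, kernelOp μ (rieszKernel a) F x ^ q ∂μ ≤ R * (∫⁻ y, F y ∂μ) ^ q := by
    calc _ ≤ ∫⁻ x, (∫⁻ y, F y ∂μ) ^ (q - 1) * kernelOp μ (rieszKernel (a * q)) F x ∂μ :=
          lintegral_mono h1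
      _ = (∫⁻ y, F y ∂μ) ^ (q - 1) * ∫⁻ x, kernelOp μ (rieszKernel (a * q)) F x ∂μ :=
          lintegral_const_mul _ (measurable_kernelOp (measurable_rieszKernel _) hF)
      _ ≤ (∫⁻ y, F y ∂μ) ^ (q - 1) * (R * ∫⁻ y, F y ∂μ) := by gcongr
      _ = R * ((∫⁻ y, F y ∂μ) ^ (q - 1) * (∫⁻ y, F y ∂μ) ^ (1 : ℝ)) := by
          rw [ENNReal.rpow_one]; ring
      _ = _ := by
          rw [← ENNReal.rpow_add_of_nonneg _ _ (by linarith) zero_le_one, sub_add_cancel]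
  calc _ ≤ (R * (∫⁻ y, F y ∂μ) ^ q) ^ (1 / q) := by gcongr
    _ = _ := by
      rw [ENNReal.mul_rpow_of_nonneg _ _ (by positivity), ← ENNReal.rpow_mul,
        mul_one_div_cancel hq0.ne', ENNReal.rpow_one, ENNReal.coe_rpow_of_nonneg _ (by positivity)]

/-- Hölder, the kernel being uniformly in L^(q') over Ω. -/
theorem exists_riesz_le_norm (hn : 1 ≤ n) (hΩ : IsC11 Ω) {a q : ℝ} (hq : 1 < q)
    (haq : a * (q / (q - 1)) < n) :
    ∃ C : ℝ≥0, ∀ F : Space n → ℝ≥0∞, Measurable F → ∀ x ∈ Ω,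
      kernelOp (volume.restrict Ω) (rieszKernel a) F x ≤ C * (∫⁻ y in Ω, F y ^ q) ^ (1 / q) := by
  have hq1 : 0 < q - 1 := by linarith
  set q' := q / (q - 1) with hq'
  have hq'0 : 0 < q' := by positivity
  have hconj : q'.HolderConjugate q := (Real.HolderConjugate.conjExponent hq).symm
  obtain ⟨R, hR⟩ := exists_lintegral_rieszKernel_le hn hΩ haq
  refine ⟨R ^ (1 / q'), fun F hF x hx => ?_⟩
  have hkq : ∀ y : Space n, (rieszKernel a x y : ℝ≥0∞) ^ q' = rieszKernel (a * q') x y := by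
    intro y
    rw [rieszKernel_eq, rieszKernel_eq, ENNReal.ofReal_rpow_of_nonneg (by positivity) hq'0.le,
      ← Real.rpow_mul dist_nonneg, neg_mul]
  calc _ ≤ (∫⁻ y in Ω, (rieszKernel a x y : ℝ≥0∞) ^ q') ^ (1 / q') *
        (∫⁻ y in Ω, F y ^ q) ^ (1 / q) :=
        ENNReal.lintegral_mul_le_Lp_mul_Lq _ hconj
          (measurable_rieszKernel a).of_uncurry_left.coe_nnreal_ennreal.aemeasurable hF.aemeasurable
    _ ≤ (R : ℝ≥0∞) ^ (1 / q') * (∫⁻ y in Ω, F y ^ q) ^ (1 / q) := by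
        gcongr
        simp only [hkq]
        exact hR x hx
    _ = _ := by rw [ENNReal.coe_rpow_of_nonneg _ (by positivity)]

end Domain

/-! ### Unweighted mapping properties of the solution operator -/

variable {n : ℕ} {Ω : Set (Space n)} {s γ κ : ℝ}

theorem normLp_ofReal {p : ℝ} (hp : 0 < p) (f : Fn Ω) :
    normLp (ENNReal.ofReal p) f = (∫⁻ x in Ω, ‖f x‖ₑ ^ p) ^ (1 / p) := by
  rw [normLp, eLpNorm_eq_lintegral_rpow_enorm_toReal (by simpa using hp) ENNReal.ofReal_ne_top,
    ENNReal.toReal_ofReal hp.le]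

theorem normLp_one (f : Fn Ω) : normLp 1 f = ∫⁻ x in Ω, ‖f x‖ₑ := eLpNorm_one_eq_lintegral_enorm

theorem measurable_enorm_fn (f : Fn Ω) : Measurable fun x => ‖f x‖ₑ := f.measurable.enorm

/-- A function bounded by `c U` has `L^p` norm bounded by that of `c U`. -/
theorem normLp_le_of_bound {p : ℝ} (hp : 0 < p) {u : Fn Ω} {c : ℝ≥0} {U : Space n → ℝ≥0∞}
    (h : ∀ᵐ x ∂(volume.restrict Ω), ‖u x‖ₑ ≤ c * U x) :
    normLp (ENNReal.ofReal p) u ≤ c * (∫⁻ x in Ω, U x ^ p) ^ (1 / p) := by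
  rw [normLp_ofReal hp]
  calc _ ≤ (∫⁻ x in Ω, (c : ℝ≥0∞) ^ p * U x ^ p) ^ (1 / p) := by
        refine ENNReal.rpow_le_rpow (lintegral_mono_ae (h.mono fun x hx => ?_)) (by positivity)
        rw [← ENNReal.mul_rpow_of_nonneg _ _ hp.le]
        gcongr
    _ = _ := by
        rw [lintegral_const_mul' _ _ (ENNReal.rpow_ne_top_of_nonneg hp.le ENNReal.coe_ne_top),
          ENNReal.mul_rpow_of_nonneg _ _ (by positivity), ← ENNReal.rpow_mul,
          mul_one_div_cancel hp.ne', ENNReal.rpow_one]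

namespace GreenOperator.Regular

variable {A : GreenOperator Ω s γ κ} {k : Space n → Space n → ℝ≥0} {N : ℕ} {C K : ℝ≥0}
  (h : A.Regular k N C) (B : Eigenbasis A) {lam : ℝ}
  (hμ : (volume.restrict Ω : Measure (Space n)) ≠ 0)
  (hK : ∀ᵐ x ∂(volume.restrict Ω), ∀ᵐ y ∂(volume.restrict Ω),
    k x y ≤ K * rieszKernel ((n : ℝ) - 2 * s) x y)
include h hμ hK

theorem enorm_solOp_le_riesz {M g : ℝ} (hg : 0 < g) (hgap : B.Gap M g lam) (hM : -M ≤ lam)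
    {f : Fn Ω} (hf : f ∈ B.perpTilde lam) :
    ∀ᵐ x ∂(volume.restrict Ω), ‖B.solOp lam f x‖ₑ ≤
      (RegKernel.resolventConst N C M.toNNReal g.toNNReal * K : ℝ≥0) *
        kernelOp (volume.restrict Ω) (rieszKernel ((n : ℝ) - 2 * s)) (fun y => ‖f y‖ₑ) x := by
  filter_upwards [h.enorm_solOp_le B hμ hg hgap hM hf, hK] with x hx1 hx2
  rw [ENNReal.coe_mul, mul_assoc]
  exact hx1.trans (mul_le_mul_right (kernelOp_le_of_kernel_le hx2 _) _)

theorem maps_L1_Lp {p : ℝ} (hp : 1 ≤ p) {c : ℝ≥0}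
    (hc : ∀ F : Space n → ℝ≥0∞, Measurable F →
      (∫⁻ x in Ω, kernelOp (volume.restrict Ω) (rieszKernel ((n : ℝ) - 2 * s)) F x ^ p) ^ (1 / p) ≤
        c * ∫⁻ y in Ω, F y)
    {M g : ℝ} (hg : 0 < g) (hgap : B.Gap M g lam) (hM : -M ≤ lam) :
    B.Maps lam (RegKernel.resolventConst N C M.toNNReal g.toNNReal * K * c) (normLp 1)
      (B.perpTilde lam) (normLp (ENNReal.ofReal p)) (B.perpTilde lam) := by
  intro f hf _
  refine ⟨h.solOp_mem_perpTilde B hμ hgap.1 hf, ?_⟩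
  refine (normLp_le_of_bound (by linarith)
    (h.enorm_solOp_le_riesz B hμ hK hg hgap hM hf)).trans ?_
  rw [normLp_one, ENNReal.coe_mul (_ * _), mul_assoc]
  gcongr
  exact hc _ (measurable_enorm_fn f)

theorem maps_Lp_Lq {p q : ℝ} (hp : 0 < p) (hq : 0 < q) {c : ℝ≥0}
    (hc : ∀ F : Space n → ℝ≥0∞, Measurable F → ∫⁻ y in Ω, F y ^ p ≠ ∞ →
      (∫⁻ x in Ω, kernelOp (volume.restrict Ω) (rieszKernel ((n : ℝ) - 2 * s)) F x ^ q) ^ (1 / q) ≤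
        c * (∫⁻ y in Ω, F y ^ p) ^ (1 / p))
    {M g : ℝ} (hg : 0 < g) (hgap : B.Gap M g lam) (hM : -M ≤ lam) :
    B.Maps lam (RegKernel.resolventConst N C M.toNNReal g.toNNReal * K * c)
      (normLp (ENNReal.ofReal p)) (B.perpTilde lam)
      (normLp (ENNReal.ofReal q)) (B.perpTilde lam) := by
  intro f hf hfin
  refine ⟨h.solOp_mem_perpTilde B hμ hgap.1 hf, ?_⟩
  refine (normLp_le_of_bound hq (h.enorm_solOp_le_riesz B hμ hK hg hgap hM hf)).trans ?_
  rw [normLp_ofReal hp] at hfin ⊢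
  rw [ENNReal.coe_mul (_ * _), mul_assoc]
  gcongr
  refine hc _ (measurable_enorm_fn f) fun htop => ?_
  rw [htop, ENNReal.top_rpow_of_pos (by positivity)] at hfin
  exact lt_irrefl _ hfin

theorem maps_Lq_Linf (hΩ : IsC11 Ω) {q : ℝ} (hq : 0 < q) {c : ℝ≥0}
    (hc : ∀ F : Space n → ℝ≥0∞, Measurable F → ∀ x ∈ Ω,
      kernelOp (volume.restrict Ω) (rieszKernel ((n : ℝ) - 2 * s)) F x ≤
        c * (∫⁻ y in Ω, F y ^ q) ^ (1 / q))
    {M g : ℝ} (hg : 0 < g) (hgap : B.Gap M g lam) (hM : -M ≤ lam) :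
    B.Maps lam (RegKernel.resolventConst N C M.toNNReal g.toNNReal * K * c)
      (normLp (ENNReal.ofReal q)) (B.perp lam) (normLp ∞) (B.perp lam) := by
  intro f hf _
  refine ⟨h.solOp_mem_perp B hμ hgap.1 hf, ?_⟩
  rw [normLp_ofReal hq, normLp, eLpNorm_exponent_top]
  refine eLpNormEssSup_le_of_ae_enorm_bound ?_
  filter_upwards [h.enorm_solOp_le_riesz B hμ hK hg hgap hM (h.perp_subset_perpTilde B hf),
    ae_mem hΩ] with x hx1 hx
  refine hx1.trans ?_
  rw [ENNReal.coe_mul (_ * _), mul_assoc]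
  gcongr
  exact hc _ (measurable_enorm_fn f) x hx

end GreenOperator.Regular

/-! ### Nonexistence of the Green's function for n < 2s -/

variable {n : ℕ} {Ω : Set (Space n)} {s γ κ : ℝ}

/-- Lower bound for the comparison function near two distinct points. -/
theorem exists_profile_lower (hn : 1 ≤ n) (hΩ : IsC11 Ω) (hγ0 : 0 < γ)
    (hp : (n : ℝ) - 2 * s < 0) {a b : Space n} (ha : a ∈ Ω) (hb : b ∈ Ω) (hab : a ≠ b) :
    ∃ c ε₀ : ℝ, 0 < c ∧ 0 < ε₀ ∧ ∀ x ∈ Metric.ball a ε₀, ∀ y ∈ Metric.ball b ε₀, x ∈ Ω → y ∈ Ω →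
      x ≠ y ∧ c ≤ profile Ω s γ x y := by
  obtain ⟨D, hD1, hD, -⟩ := exists_diam_bound hn hΩ
  have hD0 : 0 < D := by linarith
  have hr := dist_pos.mpr hab
  have hda := bdist_pos hn hΩ ha
  have hdb := bdist_pos hn hΩ hb
  set m := min (bdist Ω a) (bdist Ω b) / 2 with hm
  have hm0 : 0 < m := by positivity
  refine ⟨(dist a b / 2) ^ (-((n : ℝ) - 2 * s)) * min (m ^ γ / D ^ γ) 1 * min (m ^ γ / D ^ γ) 1,
    min (dist a b / 4) m, by positivity, by positivity, fun x hx y hy hxΩ hyΩ => ?_⟩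
  rw [Metric.mem_ball, lt_min_iff] at hx hy
  have hdist : dist a b / 2 ≤ dist x y := by
    have h1 := dist_triangle4 a x y b
    rw [dist_comm a x] at h1
    linarith [hx.1, hy.1]
  have hxy : 0 < dist x y := by linarith
  have hmx : m ≤ bdist Ω x := by
    have h1 := bdist_le_add (Ω := Ω) a x
    rw [dist_comm] at h1
    have h2 := min_le_left (bdist Ω a) (bdist Ω b)
    linarith [hx.2]
  have hmy : m ≤ bdist Ω y := by
    have h1 := bdist_le_add (Ω := Ω) b y
    rw [dist_comm] at h1
    have h2 := min_le_right (bdist Ω a) (bdist Ω b)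
    linarith [hy.2]
  have hmin : ∀ z : Space n, m ≤ bdist Ω z →
      min (m ^ γ / D ^ γ) 1 ≤ min (bdist Ω z ^ γ / dist x y ^ γ) 1 := by
    intro z hz
    refine min_le_min ?_ le_rfl
    have := hD x hxΩ y hyΩ
    have : 0 ≤ bdist Ω z := by linarith
    gcongr
  refine ⟨dist_pos.mp hxy, ?_⟩
  unfold profile
  have h1 := hmin x hmx
  have h2 := hmin y hmy
  have h3 : 0 ≤ -((n : ℝ) - 2 * s) := by linarith
  have h4 : 0 ≤ bdist Ω x := by linarith
  gcongr

/-- For `n < 2s` no non-negative operator has a Green's function satisfying the bounds. -/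
theorem isEmpty_greenOperator (hn : 1 ≤ n) (hΩ : IsC11 Ω) (hγ0 : 0 < γ)
    (hp : (n : ℝ) - 2 * s < 0) : IsEmpty (GreenOperator Ω s γ κ) := by
  -- The contradiction is with ⟨𝓛⁻¹f, f⟩ ≥ 0. The kernel is small near the diagonal and bounded
  -- below between two separated points, so the difference of the indicators of two small balls has
  -- negative energy.
  refine ⟨fun A => ?_⟩
  have := nontrivial_space hn
  obtain ⟨a, ha⟩ := hΩ.nonempty
  obtain ⟨b, hb, hba⟩ : ∃ b ∈ Ω, b ≠ a := by
    obtain ⟨b, hb1, hb2⟩ := (Module.punctured_nhds_neBot ℝ (Space n) a).nonempty_of_mem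
      (inter_mem (mem_nhdsWithin_of_mem_nhds (hΩ.isOpen.mem_nhds ha)) self_mem_nhdsWithin)
    exact ⟨b, hb1, hb2⟩
  have hκ := A.kappa_pos ha hb hba.symm
  obtain ⟨c, ε₀, hc, hε₀, hlow⟩ := exists_profile_lower hn hΩ hγ0 hp ha hb hba.symm
  obtain ⟨ra, hra, hballa⟩ := Metric.isOpen_iff.mp hΩ.isOpen a ha
  obtain ⟨rb, hrb, hballb⟩ := Metric.isOpen_iff.mp hΩ.isOpen b hb
  set e := -((n : ℝ) - 2 * s) with he
  have he0 : 0 < e := by linarith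
  set c₀ := κ⁻¹ * c with hc₀
  have hc₀0 : 0 < c₀ := by positivity
  -- a small radius
  set ε₁ := (c₀ / (2 * κ)) ^ (1 / e) / 2 with hε₁
  have hε₁0 : 0 < ε₁ := by positivity
  set ε := min (min ε₀ ε₁) (min ra rb) with hε
  have hε0 : 0 < ε := by positivity
  -- c₁ bounds the kernel from above inside each ball and c₀ bounds it from below between the balls;
  -- as e > 0, a small radius makes c₁ < c₀.
  set c₁ := κ * (2 * ε) ^ e with hc₁
  have hc₁₀ : c₁ < c₀ := by
    have h1 : (2 * ε) ^ e ≤ c₀ / (2 * κ) := by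
      calc (2 * ε) ^ e ≤ ((c₀ / (2 * κ)) ^ (1 / e)) ^ e := by
            gcongr
            have : ε ≤ ε₁ := (min_le_left _ _).trans (min_le_right _ _)
            linarith
        _ = _ := by rw [← Real.rpow_mul (by positivity), one_div_mul_cancel he0.ne', Real.rpow_one]
    calc c₁ ≤ κ * (c₀ / (2 * κ)) := by rw [hc₁]; gcongr
      _ = c₀ / 2 := by field_simp
      _ < c₀ := by linarith
  set μ : Measure (Space n) := volume.restrict Ω with hμ
  have hfin : IsFiniteMeasure μ := ⟨by
    rw [hμ, Measure.restrict_apply_univ]; exact hΩ.bounded.measure_lt_top⟩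
  set Ba := Metric.ball a ε
  set Bb := Metric.ball b ε
  have hBa : MeasurableSet Ba := Metric.isOpen_ball.measurableSet
  have hBb : MeasurableSet Bb := Metric.isOpen_ball.measurableSet
  have hBaΩ : Ba ⊆ Ω := (Metric.ball_subset_ball ((min_le_right _ _).trans (min_le_left _ _))).trans
    hballa
  have hBbΩ : Bb ⊆ Ω := (Metric.ball_subset_ball ((min_le_right _ _).trans (min_le_right _ _))).trans
    hballb
  have hεε₀ : ε ≤ ε₀ := (min_le_left _ _).trans (min_le_left _ _)
  have hsep : ∀ x ∈ Ba, ∀ y ∈ Bb, x ≠ y ∧ c ≤ profile Ω s γ x y := fun x hx y hy =>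
    hlow x (Metric.ball_subset_ball hεε₀ hx) y (Metric.ball_subset_ball hεε₀ hy) (hBaΩ hx)
      (hBbΩ hy)
  have hdisj : ∀ x ∈ Ba, x ∉ Bb := fun x hx hx' => (hsep x hx x hx').1 rfl
  set V := μ.real Ba with hV
  have hVb : μ.real Bb = V := by
    rw [hV, measureReal_def, measureReal_def, hμ, Measure.restrict_apply hBa,
      Measure.restrict_apply hBb, inter_eq_left.mpr hBaΩ, inter_eq_left.mpr hBbΩ,
      Measure.addHaar_ball_center, Measure.addHaar_ball_center volume a]
  have hV0 : 0 < V := by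
    rw [hV, measureReal_def, hμ, Measure.restrict_apply hBa, inter_eq_left.mpr hBaΩ]
    exact ENNReal.toReal_pos (Metric.measure_ball_pos volume a hε0).ne' measure_ball_lt_top.ne
  obtain ⟨D, hD1, hD, -⟩ := exists_diam_bound hn hΩ
  obtain ⟨k, hk, hks, hkA⟩ := A.ae_ae_kernel hn hΩ
  -- bounds for the kernel
  have hkb : ∀ᵐ x ∂μ, ∀ᵐ y ∂μ, (k x y : ℝ) ≤ κ * D ^ e ∧
      ((x ∈ Ba ∧ y ∈ Ba) ∨ (x ∈ Bb ∧ y ∈ Bb) → (k x y : ℝ) ≤ c₁) ∧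
      ((x ∈ Ba ∧ y ∈ Bb) ∨ (x ∈ Bb ∧ y ∈ Ba) → c₀ ≤ (k x y : ℝ)) := by
    filter_upwards [hkA, ae_mem hΩ] with x hx1 hx
    filter_upwards [hx1, ae_mem hΩ, ae_ne hn x] with y hy1 hy hxy
    have h1 := A.kernel_lower x hx y hy hxy
    have h2 := A.kernel_upper x hx y hy hxy
    rw [hy1] at h1 h2
    have h3 := profile_le (Ω := Ω) (s := s) (γ := γ) x y
    refine ⟨h2.trans ?_, fun h => h2.trans ?_, fun h => le_trans ?_ h1⟩
    · gcongr
      exact h3.trans (Real.rpow_le_rpow dist_nonneg (hD x hx y hy).le he0.le)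
    · have hd : dist x y ≤ 2 * ε := by
        rcases h with h | h
        · have := dist_triangle_right x y a
          linarith [Metric.mem_ball.mp h.1, Metric.mem_ball.mp h.2]
        · have := dist_triangle_right x y b
          linarith [Metric.mem_ball.mp h.1, Metric.mem_ball.mp h.2]
      rw [hc₁]
      gcongr
      exact h3.trans (Real.rpow_le_rpow dist_nonneg hd he0.le)
    · rw [hc₀]
      gcongr
      rcases h with h | h
      · exact (hsep x h.1 y h.2).2
      · rw [profile_symm]
        exact (hsep y h.2 x h.1).2
  -- the test function and its image
  set f₀ : Space n → ℝ := fun x => Ba.indicator 1 x - Bb.indicator 1 x with hf₀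
  have hf₀m : Measurable f₀ :=
    (measurable_one.indicator hBa).sub (measurable_one.indicator hBb)
  have hf₀b : ∀ x, ‖f₀ x‖ ≤ 1 := by
    intro x
    rw [hf₀]
    by_cases h1 : x ∈ Ba
    · simp [h1, hdisj x h1]
    · by_cases h2 : x ∈ Bb <;> simp [h1, h2]
  set v : Space n → ℝ := fun x => ∫ y, (k x y : ℝ) * f₀ y ∂μ with hv
  have hkr : Measurable fun q : Space n × Space n => (k q.1 q.2 : ℝ) := hk.coe_nnreal_real
  have hvm : StronglyMeasurable v :=
    StronglyMeasurable.integral_prod_right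
      (f := fun x y => (k x y : ℝ) * f₀ y)
      (hkr.mul (hf₀m.comp measurable_snd)).stronglyMeasurable
  have hki : ∀ᵐ x ∂μ, Integrable (fun y => (k x y : ℝ) * f₀ y) μ := by
    filter_upwards [hkb] with x hx
    refine Integrable.of_bound
      ((hkr.comp measurable_prodMk_left).mul hf₀m).aestronglyMeasurable (κ * D ^ e) ?_
    filter_upwards [hx] with y hy
    rw [norm_mul, NNReal.norm_eq]
    exact (mul_le_of_le_one_right (by positivity) (hf₀b y)).trans hy.1
  have hvb : ∀ᵐ x ∂μ, ‖v x‖ ≤ κ * D ^ e * μ.real univ := by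
    filter_upwards [hkb] with x hx
    refine norm_integral_le_of_norm_le_const ?_
    filter_upwards [hx] with y hy
    rw [norm_mul, NNReal.norm_eq]
    exact (mul_le_of_le_one_right (by positivity) (hf₀b y)).trans hy.1
  have hi : ∀ c c' : ℝ, Integrable (fun y => Ba.indicator (fun _ => c) y -
      Bb.indicator (fun _ => c') y) μ := fun c c' =>
    ((integrable_const c).indicator hBa).sub ((integrable_const c').indicator hBb)
  have hI : ∀ c c' : ℝ, ∫ y, (Ba.indicator (fun _ => c) y - Bb.indicator (fun _ => c') y) ∂μ =
      V * (c - c') := by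
    intro c c'
    rw [integral_sub ((integrable_const c).indicator hBa) ((integrable_const c').indicator hBb),
      integral_indicator_const _ hBa, integral_indicator_const _ hBb, hVb]
    simp only [smul_eq_mul]
    ring
  have hva : ∀ᵐ x ∂μ, x ∈ Ba → v x ≤ V * (c₁ - c₀) := by
    filter_upwards [hkb, hki] with x hx hxi hxa
    rw [← hI c₁ c₀]
    refine integral_mono_ae hxi (hi c₁ c₀) ?_
    filter_upwards [hx] with y hy
    by_cases h1 : y ∈ Ba
    · simpa [hf₀, h1, hdisj y h1] using hy.2.1 (Or.inl ⟨hxa, h1⟩)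
    · by_cases h2 : y ∈ Bb
      · simpa [hf₀, h1, h2] using hy.2.2 (Or.inl ⟨hxa, h2⟩)
      · simp [hf₀, h1, h2]
  have hvb' : ∀ᵐ x ∂μ, x ∈ Bb → V * (c₀ - c₁) ≤ v x := by
    filter_upwards [hkb, hki] with x hx hxi hxb
    rw [← hI c₀ c₁]
    refine integral_mono_ae (hi c₀ c₁) hxi ?_
    filter_upwards [hx] with y hy
    by_cases h1 : y ∈ Ba
    · simpa [hf₀, h1, hdisj y h1] using hy.2.2 (Or.inr ⟨hxb, h1⟩)
    · by_cases h2 : y ∈ Bb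
      · simpa [hf₀, h1, h2] using hy.2.1 (Or.inr ⟨hxb, h2⟩)
      · simp [hf₀, h1, h2]
  have hfL : MemLp f₀ 2 μ := MemLp.of_bound hf₀m.aestronglyMeasurable 1 (ae_of_all _ hf₀b)
  have hvL : MemLp v 2 μ := MemLp.of_bound hvm.aestronglyMeasurable _ hvb
  have hgraph : (hvL.toLp v, hfL.toLp f₀) ∈ A.L.graph := by
    rw [A.green]
    filter_upwards [hvL.coeFn_toLp, hkA] with x hx1 hx2
    rw [hx1]
    refine integral_congr_ae ?_
    filter_upwards [hx2, hfL.coeFn_toLp] with y hy1 hy2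
    rw [hy1, hy2]
  obtain ⟨w, hw1, hw2⟩ := (LinearPMap.mem_graph_iff _).mp hgraph
  have hnonneg := A.L_nonneg w
  simp only at hw1 hw2
  rw [hw1, hw2, L2.inner_def] at hnonneg
  -- The contribution of the ball around b is also non-positive and is dropped; the ball around a
  -- alone makes the energy negative.
  have hle : ∫ x, ⟪(hfL.toLp f₀ : Space n → ℝ) x, (hvL.toLp v : Space n → ℝ) x⟫ ∂μ ≤
      ∫ x, Ba.indicator (fun _ => V * (c₁ - c₀)) x ∂μ := by
    refine integral_mono_ae (L2.integrable_inner _ _) ((integrable_const _).indicator hBa) ?_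
    filter_upwards [hfL.coeFn_toLp, hvL.coeFn_toLp, hva, hvb'] with x hx1 hx2 hx3 hx4
    rw [hx1, hx2]
    by_cases h1 : x ∈ Ba
    · simpa [hf₀, h1, hdisj x h1] using hx3 h1
    · by_cases h2 : x ∈ Bb
      · have h3 := hx4 h2
        have h4 : 0 < V * (c₀ - c₁) := mul_pos hV0 (by linarith)
        simp [hf₀, h1, h2]
        linarith
      · simp [hf₀, h1, h2]
  rw [integral_indicator_const _ hBa, smul_eq_mul] at hle
  have : V * (V * (c₁ - c₀)) < 0 :=
    mul_neg_of_pos_of_neg hV0 (mul_neg_of_pos_of_neg hV0 (by linarith))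
  linarith

end NonlocalEig

end

/-! ### Assembly of the theorem -/

theorem mainTheorem5 {n : ℕ} (hn : 1 ≤ n) (s γ : ℝ) (hs0 : 0 < s) (hs1 : s < 1)
    (hγ0 : 0 < γ) (hγ1 : γ ≤ 1) (hns : (n : ℝ) ≠ 2 * s)
    (Ω : Set (NonlocalEig.Space n)) (hΩ : NonlocalEig.IsC11 Ω) (κ : ℝ) :
    -- the objects are well defined
    (∀ A : NonlocalEig.GreenOperator Ω s γ κ,
      Nonempty (NonlocalEig.Eigenbasis A) ∧
      ∀ B : NonlocalEig.Eigenbasis A, 0 < B.val 0 ∧ Tendsto B.val atTop atTop ∧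
        ∀ lam : ℝ, lam ∉ Set.range B.val →
          B.WellDefined lam ∧
          ∀ f : NonlocalEig.Fn Ω, f ∈ B.perpTilde lam ↔
            ∀ ε > (0 : ℝ≥0∞), ∃ h ∈ B.perp lam,
              NonlocalEig.normL1 (NonlocalEig.powWeight Ω γ) (f - h) < ε) ∧
    -- the mapping properties, with uniform bounds
    ∀ M g : ℝ, 0 < g →
      -- `L¹(𝔾₀(δ^α)) → L¹(δ^α)`
      (∀ α : ℝ, -1 - γ < α → ∃ C : ℝ≥0,
        ∀ (A : NonlocalEig.GreenOperator Ω s γ κ) (B : NonlocalEig.Eigenbasis A) (lam : ℝ),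
          B.Gap M g lam → -M ≤ lam →
          B.Maps lam C (NonlocalEig.normL1 (A.weight α)) (B.perpTilde lam)
            (NonlocalEig.normL1 (NonlocalEig.powWeight Ω α)) (B.perpTilde lam)) ∧
      -- `L¹ → L^p`
      (∀ p : ℝ, 1 ≤ p → p < n / (n - 2 * s) → ∃ C : ℝ≥0,
        ∀ (A : NonlocalEig.GreenOperator Ω s γ κ) (B : NonlocalEig.Eigenbasis A) (lam : ℝ),
          B.Gap M g lam → -M ≤ lam →
          B.Maps lam C (NonlocalEig.normLp 1) (B.perpTilde lam)
            (NonlocalEig.normLp (ENNReal.ofReal p)) (B.perpTilde lam)) ∧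
      -- `L² → ℍ²`; here no lower bound on `lam` is needed
      (∃ C : ℝ≥0,
        ∀ (A : NonlocalEig.GreenOperator Ω s γ κ) (B : NonlocalEig.Eigenbasis A) (lam : ℝ),
          B.Gap M g lam →
          B.Maps lam C (NonlocalEig.normLp 2) (B.perp lam) B.normH2 (B.perp lam)) ∧
      -- `L^{p₀} → L^{p₁}`
      (∀ p₀ p₁ : ℝ, 1 < p₀ → p₀ < n / (2 * s) → 1 / p₁ = 1 / p₀ - 2 * s / n → ∃ C : ℝ≥0,
        ∀ (A : NonlocalEig.GreenOperator Ω s γ κ) (B : NonlocalEig.Eigenbasis A) (lam : ℝ),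
          B.Gap M g lam → -M ≤ lam →
          B.Maps lam C (NonlocalEig.normLp (ENNReal.ofReal p₀)) (B.perpTilde lam)
            (NonlocalEig.normLp (ENNReal.ofReal p₁)) (B.perpTilde lam)) ∧
      -- `L^q → L^∞`
      (∀ q : ℝ, n / (2 * s) < q → ∃ C : ℝ≥0,
        ∀ (A : NonlocalEig.GreenOperator Ω s γ κ) (B : NonlocalEig.Eigenbasis A) (lam : ℝ),
          B.Gap M g lam → -M ≤ lam →
          B.Maps lam C (NonlocalEig.normLp (ENNReal.ofReal q)) (B.perp lam)
            (NonlocalEig.normLp ∞) (B.perp lam)) ∧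
      -- `δ^α L^∞ → 𝔾₀(δ^α) L^∞`
      (∀ α : ℝ, -1 - γ < α → ∃ C : ℝ≥0,
        ∀ (A : NonlocalEig.GreenOperator Ω s γ κ) (B : NonlocalEig.Eigenbasis A) (lam : ℝ),
          B.Gap M g lam → -M ≤ lam →
          B.Maps lam C (NonlocalEig.normLinf (NonlocalEig.powWeight Ω α)) (B.perp lam)
            (NonlocalEig.normLinf (A.weight α)) (B.perp lam)) := by
  have hμ := NonlocalEig.restrict_ne_zero hΩ
  have hn0 : (0 : ℝ) < n := by exact_mod_cast hn
  -- For n < 2s there is no operator 𝓛 with these properties, and every claim is vacuous.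
  rcases lt_or_gt_of_ne hns with hlt | hgt
  · have hemp : IsEmpty (NonlocalEig.GreenOperator Ω s γ κ) :=
      NonlocalEig.isEmpty_greenOperator hn hΩ hγ0 (by linarith)
    exact ⟨fun A => isEmptyElim A, fun M g _ => ⟨fun _ _ => ⟨0, fun A => isEmptyElim A⟩,
      fun _ _ _ => ⟨0, fun A => isEmptyElim A⟩, ⟨0, fun A => isEmptyElim A⟩,
      fun _ _ _ _ _ => ⟨0, fun A => isEmptyElim A⟩, fun _ _ => ⟨0, fun A => isEmptyElim A⟩,
      fun _ _ => ⟨0, fun A => isEmptyElim A⟩⟩⟩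
  have hp : 0 < (n : ℝ) - 2 * s := by linarith
  obtain ⟨N, C, K, hreg⟩ := NonlocalEig.GreenOperator.exists_regular hn hΩ hs0 hγ0 hγ1 hp κ
  refine ⟨fun A => ?_, fun M g hg => ⟨fun α _ => ?_, fun p hp1 hp2 => ?_, ?_,
    fun p₀ p₁ hp1 hp2 hp3 => ?_, fun q hq => ?_, fun α _ => ?_⟩⟩
  · obtain ⟨k, hk, -⟩ := hreg A
    exact ⟨hk.nonempty_eigenbasis (NonlocalEig.not_finiteDimensional_L2 hn hΩ), fun B =>
      ⟨(hk.eigen_aux B 0).1, hk.tendsto_val B, fun lam hlam =>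
        ⟨hk.wellDefined B hμ hlam, fun f => hk.mem_perpTilde_iff B⟩⟩⟩
  · refine ⟨NonlocalEig.RegKernel.resolventConst N C M.toNNReal g.toNNReal, fun A B lam hgap hM => ?_⟩
    obtain ⟨k, hk, -⟩ := hreg A
    exact hk.maps_weightedL1 B hμ α hg hgap hM
  · obtain ⟨c, hc⟩ := NonlocalEig.exists_riesz_norm_le_L1 hn hΩ (a := (n : ℝ) - 2 * s) hp1
      (by rwa [lt_div_iff₀ hp, mul_comm] at hp2)
    refine ⟨NonlocalEig.RegKernel.resolventConst N C M.toNNReal g.toNNReal * K * c, fun A B lam hgap hM => ?_⟩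
    obtain ⟨k, hk, hK⟩ := hreg A
    exact hk.maps_L1_Lp B hμ hK hp1 hc hg hgap hM
  · refine ⟨(1 + |M| / g).toNNReal, fun A B lam hgap => ?_⟩
    obtain ⟨k, hk, -⟩ := hreg A
    exact hk.maps_H2 B hμ hg hgap
  · have hp0 : 0 < p₀ := by linarith
    have hp₁ : 0 < p₁ := by
      have h1 : 2 * s / n < 1 / p₀ := by
        rw [lt_div_iff₀ (by positivity)] at hp2
        rw [div_lt_div_iff₀ hn0 hp0]
        linarith
      exact one_div_pos.mp (by linarith)
    obtain ⟨c, hc⟩ := NonlocalEig.exists_riesz_norm_le hn (α := 2 * s) (by positivity) hp1 hp2 hp3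
      hp₁ Ω
    refine ⟨NonlocalEig.RegKernel.resolventConst N C M.toNNReal g.toNNReal * K * c, fun A B lam hgap hM => ?_⟩
    obtain ⟨k, hk, hK⟩ := hreg A
    exact hk.maps_Lp_Lq B hμ hK hp0 hp₁ hc hg hgap hM
  · rw [div_lt_iff₀ (by positivity)] at hq
    -- Since n > 2s, the threshold n/(2s) exceeds 1, as Hölder needs.
    have hq1 : 1 < q := by
      by_contra hq1
      have := mul_le_mul_of_nonneg_right (not_lt.mp hq1) (show 0 ≤ 2 * s by positivity)
      linarith
    -- The integrability condition (n-2s)·q/(q-1) < n is equivalent to q > n/(2s).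
    obtain ⟨c, hc⟩ := NonlocalEig.exists_riesz_le_norm hn hΩ (a := (n : ℝ) - 2 * s) hq1 (by
      rw [mul_div_assoc', div_lt_iff₀ (by linarith)]
      linarith)
    refine ⟨NonlocalEig.RegKernel.resolventConst N C M.toNNReal g.toNNReal * K * c, fun A B lam hgap hM => ?_⟩
    obtain ⟨k, hk, hK⟩ := hreg A
    exact hk.maps_Lq_Linf B hμ hK hΩ (by linarith) hc hg hgap hM
  · refine ⟨NonlocalEig.RegKernel.resolventConst N C M.toNNReal g.toNNReal, fun A B lam hgap hM => ?_⟩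
    obtain ⟨k, hk, -⟩ := hreg A
    exact hk.maps_weightedLinf B hμ ((NonlocalEig.ae_mem hΩ).mono fun x hx =>
      NonlocalEig.bdist_pos hn hΩ hx) α hg hgap hM
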